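/- **Setting.** For every $q\ge 1$ let a data set be given with $q$ groups: $p=p(q)$ covariates, group sizes $r_i\ge 1$, covariate vectors $x_{ij}\in\mathbb R^p$ and responses $y_{ij}\in\mathbb R$ ($1\le i\le q$, $1\le j\le r_i$), all depending on $q$. Put $N=\sum_i r_i$, $\bar r=N/q$, $r_{\max}=\max_i r_i$, $r_{\min}=\min_i r_i$, $\bar x_i=r_i^{-1}\sum_j x_{ij}$, $\bar y_i=r_i^{-1}\sum_j y_{ij}$, $\bar y=q^{-1}\sum_i\bar y_i$. Let $X$ be the $N\times p$ matrix with rows $x_{ij}^\top$, $\bar X$ the $N\times p$ matrix whose row $(i,j)$ is $\bar x_i^\top$, and $Y,\bar Y\in\mathbb R^N$ the vectors with entries $y_{ij}$ and $\bar y_i$. Fix $a_1,a_2,b_1,b_2>0$, not depending on $q$. For $\eta=(\eta_{00}^\top,\eta_0,\eta_1,\dots,\eta_q)^\top\in\mathbb R^{p+q+1}$ with $\eta_{00}\in\mathbb R^p$ let $$V(\eta)=\frac1{\bar r q}\sum_{i=1}^q\sum_{j=1}^{r_i}\Big(\bar y-\tfrac{x_{ij}^\top\eta_{00}}{\sqrt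 q}\Big)^2+\frac{\eta_0^2}{q}+\frac1{\bar r q}\sum_{i=1}^q r_i(\eta_i+\bar y-\bar y_i)^2 .$$ **Assumptions.** (B1) There is $m>0$ with $r_{\max}/r_{\min}\le m$ for all $q$. (B2) There are $k_1,k_2>0$ such that for all large $q$, $k_1\le\lambda_{\min}\big[\frac1{\bar r q}(X^\top X-\bar X^\top\bar X)\big]$ and $\lambda_{\max}\big(\frac1{\bar r q}X^\top X\big)\le k_2$. (B3) There is $\ell>0$ with $\frac1{\bar r q}\sum_{i,j}y_{ij}^2\le\ell$ for all $q$. (B4) $p=\mathcal O(q)$. (B5) $\delta>0$ does not depend on $q$, and $\bar r/q^{2+\delta}\to\infty$ as $q\to\infty$. **Random mapping.** For each $q$, on a probability space, let $N_{00}\sim\mathrm N_p(0,I)$, $N_i\sim\mathrm N(0,1)$ ($i=0,\dots,q$), $J_1\sim\mathrm{Gamma}(q/2+a_1,1)$ and $J_2\sim\mathrm{Gamma}(N/2+a_2,1)$ be pairwise independent. For $\eta\in\mathbb R^{p+q+1}$ put $$\lambda=\frac{J_1}{b_1+\frac12\sum_{i=1}^q(\eta_i-\eta_0/\sqrt q)^2},\qquad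 \tau=\frac{J_2}{b_2+\frac12\sum_{i=1}^q\sum_{j=1}^{r_i}(y_{ij}-x_{ij}^\top\eta_{00}/\sqrt q-\eta_i)^2},$$ $t_i=r_i\tau+\lambda$, $z_i=t_i/(r_i\tau\lambda)$, $D_c=\bigoplus_{i=1}^q\frac{r_i\tau}{t_i}I_{r_i}$, $M=D_c+\frac{(I-D_c)11^\top(I-D_c)}{1^\top(I-D_c)1}$, $Q=(X^\top X-\bar X^\top M\bar X)^{-1}$, $v=\sqrt q\,Q(X^\top Y-\bar X^\top M\bar Y)$. Define $f(\eta)=(\tilde\eta_{00}^\top,\tilde\eta_0,\tilde\eta_1,\dots,\tilde\eta_q)^\top$, where $$\tilde\eta_{00}=v+\sqrt{\tfrac q\tau}\,Q^{1/2}N_{00},\qquad \tilde\eta_0=\sqrt q\,\frac{\sum_i(\bar y_i-\bar x_i^\top\tilde\eta_{00}/\sqrt q)/z_i}{\sum_i1/z_i}+\sqrt{\frac q{\sum_i1/z_i}}\,N_0,$$ $$\tilde\eta_i=\frac{\lambda}{t_i}\frac{\tilde\eta_0}{\sqrt q}+\frac{r_i\tau}{t_i}\Big(\bar y_i-\frac{\bar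 x_i^\top\tilde\eta_{00}}{\sqrt q}\Big)+\sqrt{\frac1{t_i}}\,N_i,\qquad i=1,\dots,q .$$ **Claim.** Assume (B1)–(B5). There exist nonnegative $$\gamma=\gamma(q)=\mathcal O\Big(\sqrt{\tfrac{q^{2+\delta}}{\bar r}}\vee\tfrac1{\sqrt q}\Big)\quad\text{and}\quad \gamma_0=\gamma_0(q)=\mathcal O(\sqrt q),$$ with $\gamma(q)\to0$ as $q\to\infty$, and a positive integer $q_0$ such that for all $q\ge q_0$: almost surely $s\mapsto f(\eta+s(\eta'-\eta))$ is differentiable at every $s\in[0,1]$ for all $\eta,\eta'\in\mathbb R^{p+q+1}$; for all $\eta,\eta'$ and $s\in[0,1]$ the norm of this derivative has finite expectation; and for all $\eta,\eta'$ $$\sup_{s\in[0,1]}\mathrm E\,\Big\|\frac{\mathrm d}{\mathrm ds}f(\eta+s(\eta'-\eta))\Big\|\le\begin{cases}\gamma\,\|\eta'-\eta\|&\text{if }V(\eta)+V(\eta')\le q^{\delta/3},\\ \gamma_0\,\|\eta'-\eta\|&\text{otherwise.}\end{cases}$$ Here $\|\cdot\|$ is the Euclidean norm. -/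

import Mathlib

open MeasureTheory ProbabilityTheory Filter Topology Matrix
open scoped Asymptotics

/-- A data set for the linear mixed model `y i j = (x i j)ᵀ β + η i + e i j` with `q` groups:
`p` covariates, `r i ≥ 1` observations in the `i`-th group, covariate vectors `x i j ∈ ℝ^p`
and responses `y i j ∈ ℝ`. -/
structure MixedData (q : ℕ) where
  p : ℕ
  r : Fin q → ℕ
  r_pos : ∀ i, 0 < r i
  x : (i : Fin q) → Fin (r i) → Fin p → ℝ
  y : (i : Fin q) → Fin (r i) → ℝ

/-- The smallest eigenvalue of a real symmetric matrix. -/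
noncomputable def lambdaMin {n : ℕ} (A : Matrix (Fin n) (Fin n) ℝ) : ℝ := sInf (spectrum ℝ A)

/-- The largest eigenvalue of a real symmetric matrix. -/
noncomputable def lambdaMax {n : ℕ} (A : Matrix (Fin n) (Fin n) ℝ) : ℝ := sSup (spectrum ℝ A)

open scoped MatrixOrder in
/-- The positive semidefinite square root of a positive semidefinite real matrix. -/
noncomputable def psdSqrt {n : ℕ} (A : Matrix (Fin n) (Fin n) ℝ) : Matrix (Fin n) (Fin n) ℝ :=
  CFC.sqrt A

namespace MixedData

variable {q : ℕ} (D : MixedData q)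

/-- Indices `(i, j)` of the observations; these are the rows of the design matrix. -/
abbrev Obs : Type := (i : Fin q) × Fin (D.r i)

/-- The state space `ℝ^(p+q+1)` with its Euclidean norm. The coordinates `Sum.inl k` are those of
`η₀₀ ∈ ℝ^p`, `Sum.inr 0` is `η₀`, and `Sum.inr i.succ` is `η_i` for a group `i`. -/
abbrev State : Type := EuclideanSpace ℝ (Fin D.p ⊕ Fin (q + 1))

/-- Total sample size `N`. -/
def N : ℕ := ∑ i, D.r i

def rmax : ℕ := Finset.univ.sup D.r

noncomputable def rmin : ℕ := ⨅ i, D.r i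

/-- The average group size `r̄ = q⁻¹ ∑ r_i`. -/
noncomputable def rbar : ℝ := (∑ i, (D.r i : ℝ)) / q

/-- Group mean of the covariates. -/
noncomputable def xbar (i : Fin q) (k : Fin D.p) : ℝ := (∑ j, D.x i j k) / D.r i

/-- Group mean of the responses. -/
noncomputable def ybar (i : Fin q) : ℝ := (∑ j, D.y i j) / D.r i

/-- `ȳ = q⁻¹ ∑ ȳ_i`. -/
noncomputable def ybarbar : ℝ := (∑ i, D.ybar i) / q

/-- The `N × p` design matrix. -/
def X : Matrix D.Obs (Fin D.p) ℝ := Matrix.of fun o k => D.x o.1 o.2 k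

/-- The `N × p` matrix whose rows are the group means of the covariates. -/
noncomputable def Xbar : Matrix D.Obs (Fin D.p) ℝ := Matrix.of fun o k => D.xbar o.1 k

def Y : D.Obs → ℝ := fun o => D.y o.1 o.2

noncomputable def Ybar : D.Obs → ℝ := fun o => D.ybar o.1

/-- `x_{ij}ᵀ η₀₀ / √q`. -/
noncomputable def fit (η : D.State) (i : Fin q) (j : Fin (D.r i)) : ℝ :=
  (∑ k, D.x i j k * η (Sum.inl k)) / √(q : ℝ)

/-- The drift function `V`. -/
noncomputable def V (η : D.State) : ℝ :=
  1 / (D.rbar * q) * ∑ i, ∑ j, (D.ybarbar - D.fit η i j) ^ 2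
    + η (Sum.inr 0) ^ 2 / q
    + 1 / (D.rbar * q) * ∑ i, (D.r i : ℝ) * (η (Sum.inr i.succ) + D.ybarbar - D.ybar i) ^ 2

/-! The quantities `t_i`, `z_i`, `D_c`, `M`, `Q`, `v` as functions of the precisions `lam, tau`. -/

noncomputable def t (lam tau : ℝ) (i : Fin q) : ℝ := D.r i * tau + lam

noncomputable def z (lam tau : ℝ) (i : Fin q) : ℝ := D.t lam tau i / (D.r i * tau * lam)

noncomputable def Dc (lam tau : ℝ) : Matrix D.Obs D.Obs ℝ :=
  Matrix.diagonal fun o => D.r o.1 * tau / D.t lam tau o.1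

noncomputable def M (lam tau : ℝ) : Matrix D.Obs D.Obs ℝ :=
  D.Dc lam tau + (1 / ((1 : D.Obs → ℝ) ⬝ᵥ ((1 - D.Dc lam tau) *ᵥ 1))) •
    ((1 - D.Dc lam tau) * Matrix.vecMulVec 1 1 * (1 - D.Dc lam tau))

noncomputable def Q (lam tau : ℝ) : Matrix (Fin D.p) (Fin D.p) ℝ :=
  (D.Xᵀ * D.X - D.Xbarᵀ * D.M lam tau * D.Xbar)⁻¹

noncomputable def v (lam tau : ℝ) : Fin D.p → ℝ :=
  √(q : ℝ) • (D.Q lam tau *ᵥ (D.Xᵀ *ᵥ D.Y - D.Xbarᵀ *ᵥ (D.M lam tau *ᵥ D.Ybar)))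

/-! The random mapping, as a function of realized noise `n00, n, j1, j2` and of the state. -/

/-- The precision `λ` drawn from state `η`, with noise `j1`. -/
noncomputable def lam (b₁ j1 : ℝ) (η : D.State) : ℝ :=
  j1 / (b₁ + 1 / 2 * ∑ i : Fin q, (η (Sum.inr i.succ) - η (Sum.inr 0) / √(q : ℝ)) ^ 2)

/-- The precision `τ` drawn from state `η`, with noise `j2`. -/
noncomputable def tau (b₂ j2 : ℝ) (η : D.State) : ℝ :=
  j2 / (b₂ + 1 / 2 * ∑ i, ∑ j, (D.y i j - D.fit η i j - η (Sum.inr i.succ)) ^ 2)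

/-- New value of `η₀₀`, given the precisions. -/
noncomputable def next00 (n00 : EuclideanSpace ℝ (Fin D.p)) (lam tau : ℝ) : Fin D.p → ℝ :=
  D.v lam tau + √(q / tau) • (psdSqrt (D.Q lam tau) *ᵥ fun k => n00 k)

/-- `ȳ_i - x̄_iᵀ η₀₀ / √q`. -/
noncomputable def resid (e00 : Fin D.p → ℝ) (i : Fin q) : ℝ :=
  D.ybar i - (∑ k, D.xbar i k * e00 k) / √(q : ℝ)

/-- New value of `η₀`, given the precisions and the new value `e00` of `η₀₀`. -/
noncomputable def next0 (n0 lam tau : ℝ) (e00 : Fin D.p → ℝ) : ℝ :=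
  √(q : ℝ) * ((∑ i, D.resid e00 i / D.z lam tau i) / ∑ i, 1 / D.z lam tau i)
    + √(q / ∑ i, 1 / D.z lam tau i) * n0

/-- New value of `η_i`, given the precisions and the new values `e00, e0` of `η₀₀, η₀`. -/
noncomputable def nextGroup (ni lam tau : ℝ) (e00 : Fin D.p → ℝ) (e0 : ℝ) (i : Fin q) : ℝ :=
  lam / D.t lam tau i * (e0 / √(q : ℝ)) + D.r i * tau / D.t lam tau i * D.resid e00 i
    + √(1 / D.t lam tau i) * ni

/-- The next state, given the precisions. -/
noncomputable def next (n00 : EuclideanSpace ℝ (Fin D.p)) (n : Fin (q + 1) → ℝ)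
    (lam tau : ℝ) : D.State :=
  let e00 := D.next00 n00 lam tau
  let e0 := D.next0 (n 0) lam tau e00
  WithLp.toLp 2 (Sum.elim e00 (Fin.cons e0 fun i => D.nextGroup (n i.succ) lam tau e00 e0 i))

/-- The mapping `η ↦ f(η)` for realized noise `n00, n, j1, j2`. -/
noncomputable def f (b₁ b₂ : ℝ) (n00 : EuclideanSpace ℝ (Fin D.p)) (n : Fin (q + 1) → ℝ)
    (j1 j2 : ℝ) (η : D.State) : D.State :=
  D.next n00 n (D.lam b₁ j1 η) (D.tau b₂ j2 η)

/-- The driving noise: `N₀₀ ~ N_p(0, I)`, `N_i ~ N(0,1)` for `i = 0, …, q`,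
`J₁ ~ Gamma(q/2 + a₁, 1)` and `J₂ ~ Gamma(N/2 + a₂, 1)`, all pairwise independent. -/
structure IsNoise (a₁ a₂ : ℝ) {Ω : Type*} [MeasurableSpace Ω] (P : Measure Ω)
    (N00 : Ω → EuclideanSpace ℝ (Fin D.p)) (Nn : Fin (q + 1) → Ω → ℝ) (J1 J2 : Ω → ℝ) : Prop where
  law_N00 : HasLaw N00 (stdGaussian (EuclideanSpace ℝ (Fin D.p))) P
  law_Nn : ∀ i, HasLaw (Nn i) (gaussianReal 0 1) P
  law_J1 : HasLaw J1 (gammaMeasure (q / 2 + a₁) 1) P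
  law_J2 : HasLaw J2 (gammaMeasure (D.N / 2 + a₂) 1) P
  indep_N00_Nn : ∀ i, IndepFun N00 (Nn i) P
  indep_N00_J1 : IndepFun N00 J1 P
  indep_N00_J2 : IndepFun N00 J2 P
  indep_Nn : Pairwise fun i j => IndepFun (Nn i) (Nn j) P
  indep_Nn_J1 : ∀ i, IndepFun (Nn i) J1 P
  indep_Nn_J2 : ∀ i, IndepFun (Nn i) J2 P
  indep_J1_J2 : IndepFun J1 J2 P

end MixedData

/-! ### Symmetric matrices: eigenvalue bounds, Sylvester equations and the differentiability of the
square root. -/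

section SymmetricMatrices

open scoped Matrix.Norms.L2Operator

variable {n : ℕ} {A R S Z : Matrix (Fin n) (Fin n) ℝ}

/-! The mapping sees the current state only through the two precisions λ and τ. Along a line with
direction h everything is therefore governed by their logarithmic derivatives α and β. Each
precision is a gamma variable divided by a shifted squared length, A for λ and B for τ, and
Cauchy–Schwarz gives |α| ≤ 4‖h‖/√A and |β| ≤ 4K√r̄‖h‖/√B (`exists_hasDerivAt_div_shiftedEnergy`,
`Regular.vnorm_fitted_le`).

For given precisions, put d_i = r_iτ/t_i and w_i = r_i(1 - d_i). On vectors that are constant on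
groups, M shrinks by d_i towards the mean with weights w_i. Hence Q⁻¹ is the within-group scatter,
which is coercive and free of the precisions, plus the w-weighted scatter of the group means
(`gram_apply`). The precisions enter here only through d_i, and d_i' = -(α - β)d_i(1 - d_i), so one
number κ ≥ d_i(1 - d_j) measures all these variations. The delicate object is Q^{1/2}: its
derivative solves a Sylvester equation whose solution is bounded through the coercivity of the root
(`exists_hasDerivAt_sqrt`). The outcome is `exists_hasDerivAt_next`.

Up to a constant, κ is bounded by 1, by √(λ/(r̄τ)) and by the inverse of that ratio. Without
restriction on the state, the bounds by 1 and by √(r̄τ/λ) give a derivative of order √q. If V ≤ θ²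
at the point, then B = O(r̄qθ²), so r̄τ is not small, and the bound by √(λ/(r̄τ)) gives a factor
qθ/√r̄; what remains is the noise N₀ of the new η₀, which contributes the order 1/√q. Since V on a
segment is at most the sum of its endpoint values, θ = q^{δ/6} is admissible for the contractive
case, and qθ/√r̄ ≤ √(q^{2+δ}/r̄).

All products of noise variables are dominated, by u v ≤ u² + v², by one sum Z of normalized squares
(`noiseSize`). The pathwise bounds are linear in Z (`exists_hasDerivAt_f`), and E Z is bounded
uniformly in q by one-variable moments (`IsNoise.integral_noiseSize_le`). -/

theorem Matrix.IsHermitian.dotProduct_mulVec_comm (hA : A.IsHermitian) (x y : Fin n → ℝ) :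
    x ⬝ᵥ A *ᵥ y = (A *ᵥ x) ⬝ᵥ y := by
  have h : Aᵀ = A := by simpa using hA.eq
  rw [dotProduct_mulVec, ← mulVec_transpose, h]

theorem Matrix.IsHermitian.exists_eigenpair (hA : A.IsHermitian) (i : Fin n) :
    hA.eigenvectorBasis i ≠ 0 ∧
      A *ᵥ (hA.eigenvectorBasis i) = hA.eigenvalues i • (hA.eigenvectorBasis i : Fin n → ℝ) :=
  ⟨hA.eigenvectorBasis.toBasis.ne_zero i, hA.mulVec_eigenvectorBasis i⟩

theorem Matrix.IsHermitian.posSemidef_of_eigenpairs (hA : A.IsHermitian)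
    (h : ∀ (c : ℝ) (x : Fin n → ℝ), x ≠ 0 → A *ᵥ x = c • x → 0 ≤ c) : A.PosSemidef := by
  rw [hA.posSemidef_iff_eigenvalues_nonneg]
  intro i
  refine h _ _ ?_ (hA.exists_eigenpair i).2
  intro h0
  exact (hA.exists_eigenpair i).1 (by ext k; exact congrFun h0 k)

theorem norm_toLp_mulVec_le (A : Matrix (Fin n) (Fin n) ℝ) (x : Fin n → ℝ) :
    ‖WithLp.toLp 2 (A *ᵥ x)‖ ≤ ‖A‖ * ‖WithLp.toLp 2 x‖ :=
  A.l2_opNorm_mulVec (WithLp.toLp 2 x)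

theorem norm_toLp_sq {ι : Type*} [Fintype ι] (x : ι → ℝ) :
    ‖WithLp.toLp 2 x‖ ^ 2 = x ⬝ᵥ x := by
  rw [EuclideanSpace.norm_sq_eq]
  simp [dotProduct, sq]

theorem opNorm_le_of_forall_mulVec {K : ℝ} (hK : 0 ≤ K)
    (h : ∀ x : Fin n → ℝ, (A *ᵥ x) ⬝ᵥ (A *ᵥ x) ≤ K ^ 2 * (x ⬝ᵥ x)) : ‖A‖ ≤ K := by
  rw [Matrix.l2_opNorm_def]
  refine ContinuousLinearMap.opNorm_le_bound _ hK fun x => ?_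
  have h1 := h x
  rw [← norm_toLp_sq, ← norm_toLp_sq, ← mul_pow] at h1
  exact (pow_le_pow_iff_left₀ (norm_nonneg _) (by positivity) two_ne_zero).1 h1

theorem Matrix.IsHermitian.opNorm_le_of_eigenpairs (hA : A.IsHermitian) {K : ℝ} (hK : 0 ≤ K)
    (h : ∀ (c : ℝ) (x : Fin n → ℝ), x ≠ 0 → A *ᵥ x = c • x → |c| ≤ K) : ‖A‖ ≤ K := by
  refine opNorm_le_of_forall_mulVec hK fun x => ?_
  rw [← norm_toLp_sq, ← norm_toLp_sq, ← hA.eigenvectorBasis.sum_sq_norm_inner_right,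
    ← hA.eigenvectorBasis.sum_sq_norm_inner_right, Finset.mul_sum]
  refine Finset.sum_le_sum fun i _ => ?_
  have he := hA.exists_eigenpair i
  have hc : |hA.eigenvalues i| ≤ K := by
    refine h _ _ ?_ he.2
    intro h0
    exact he.1 (by ext k; exact congrFun h0 k)
  have e1 : inner ℝ (hA.eigenvectorBasis i) (WithLp.toLp 2 (A *ᵥ x)) =
      hA.eigenvalues i * inner ℝ (hA.eigenvectorBasis i) (WithLp.toLp 2 x) := by
    simp only [EuclideanSpace.inner_eq_star_dotProduct, star_trivial]
    rw [dotProduct_comm, hA.dotProduct_mulVec_comm, he.2, smul_dotProduct, smul_eq_mul,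
      dotProduct_comm]
  rw [e1, norm_mul, mul_pow]
  have : ‖hA.eigenvalues i‖ ^ 2 ≤ K ^ 2 := by
    rw [Real.norm_eq_abs]; gcongr
  gcongr

theorem finite_spectrum_real (A : Matrix (Fin n) (Fin n) ℝ) : (spectrum ℝ A).Finite :=
  A.finite_real_spectrum

theorem mem_spectrum_of_mulVec_eq {c : ℝ} {x : Fin n → ℝ} (hx : x ≠ 0)
    (h : A *ᵥ x = c • x) : c ∈ spectrum ℝ A := by
  rw [← Matrix.spectrum_toLin']
  refine Module.End.HasEigenvalue.mem_spectrum (μ := c) ?_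
  exact Module.End.hasEigenvalue_of_hasEigenvector (x := x)
    ⟨Module.End.mem_eigenspace_iff.2 (by simpa using h), hx⟩

/-- The spectrum is finite, so its infimum bounds each eigenvalue from below. Arguing through
eigenpairs also covers dimension 0, where `sInf` of the empty spectrum is a default value but no
eigenvector exists. -/
theorem Matrix.IsHermitian.mul_dotProduct_le_of_le_lambdaMin (hA : A.IsHermitian) {c : ℝ}
    (hc : c ≤ lambdaMin A) (x : Fin n → ℝ) : c * (x ⬝ᵥ x) ≤ x ⬝ᵥ A *ᵥ x := by
  have h : (A - c • 1).PosSemidef := by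
    refine IsHermitian.posSemidef_of_eigenpairs (hA.sub (by simp [IsHermitian])) ?_
    intro μ y hy hμ
    have : A *ᵥ y = (μ + c) • y := by
      rw [sub_mulVec, smul_mulVec, one_mulVec, sub_eq_iff_eq_add] at hμ
      rw [hμ, add_smul]
    have h2 : lambdaMin A ≤ μ + c :=
      csInf_le (finite_spectrum_real A).bddBelow (mem_spectrum_of_mulVec_eq hy this)
    linarith
  have := h.dotProduct_mulVec_nonneg x
  simp only [star_trivial, sub_mulVec, smul_mulVec, one_mulVec, dotProduct_sub,
    dotProduct_smul, smul_eq_mul] at this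
  linarith

theorem Matrix.IsHermitian.dotProduct_le_of_lambdaMax_le (hA : A.IsHermitian) {c : ℝ}
    (hc : lambdaMax A ≤ c) (x : Fin n → ℝ) : x ⬝ᵥ A *ᵥ x ≤ c * (x ⬝ᵥ x) := by
  have h : (c • 1 - A).PosSemidef := by
    refine IsHermitian.posSemidef_of_eigenpairs (IsHermitian.sub (by simp [IsHermitian]) hA) ?_
    intro μ y hy hμ
    have : A *ᵥ y = (c - μ) • y := by
      rw [sub_mulVec, smul_mulVec, one_mulVec] at hμ
      rw [sub_smul, ← hμ]; abel
    have h2 : c - μ ≤ lambdaMax A :=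
      le_csSup (finite_spectrum_real A).bddAbove (mem_spectrum_of_mulVec_eq hy this)
    linarith
  have := h.dotProduct_mulVec_nonneg x
  simp only [star_trivial, sub_mulVec, smul_mulVec, one_mulVec, dotProduct_sub,
    dotProduct_smul, smul_eq_mul] at this
  linarith

open scoped MatrixOrder in
theorem psdSqrt_posSemidef (A : Matrix (Fin n) (Fin n) ℝ) : (psdSqrt A).PosSemidef :=
  (CFC.sqrt_nonneg A).posSemidef

open scoped MatrixOrder in
theorem psdSqrt_mul_self (hA : A.PosSemidef) : psdSqrt A * psdSqrt A = A :=
  CFC.sqrt_mul_sqrt_self A hA.nonneg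

/-- A lower bound for the square of a positive semidefinite matrix gives one for the matrix. -/
theorem Matrix.PosSemidef.mul_dotProduct_le_of_sq (hR : R.PosSemidef) {c : ℝ} (hc : 0 ≤ c)
    (h : ∀ x : Fin n → ℝ, c ^ 2 * (x ⬝ᵥ x) ≤ x ⬝ᵥ (R * R) *ᵥ x) (x : Fin n → ℝ) :
    c * (x ⬝ᵥ x) ≤ x ⬝ᵥ R *ᵥ x := by
  have h : (R - c • 1).PosSemidef := by
    refine IsHermitian.posSemidef_of_eigenpairs (hR.1.sub (by simp [IsHermitian])) ?_
    intro μ y hy hμ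
    have h1 : R *ᵥ y = (μ + c) • y := by
      rw [sub_mulVec, smul_mulVec, one_mulVec, sub_eq_iff_eq_add] at hμ
      rw [hμ, add_smul]
    have hpos : 0 < y ⬝ᵥ y := by
      rw [← norm_toLp_sq]
      have : WithLp.toLp 2 y ≠ 0 := fun h0 => hy (by simpa using h0)
      positivity
    have h2 := hR.dotProduct_mulVec_nonneg y
    have h3 := h y
    rw [← mulVec_mulVec, h1, mulVec_smul, h1, dotProduct_smul, dotProduct_smul] at h3
    rw [star_trivial, h1, dotProduct_smul] at h2
    simp only [smul_eq_mul] at h2 h3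
    have h4 : 0 ≤ μ + c := nonneg_of_mul_nonneg_left h2 hpos
    have h5 : c ^ 2 ≤ (μ + c) ^ 2 := by
      rw [← mul_assoc] at h3
      have := le_of_mul_le_mul_right h3 hpos
      linarith
    have h6 := (pow_le_pow_iff_left₀ hc h4 two_ne_zero).1 h5
    linarith
  have := h.dotProduct_mulVec_nonneg x
  simp only [star_trivial, sub_mulVec, smul_mulVec, one_mulVec, dotProduct_sub,
    dotProduct_smul, smul_eq_mul] at this
  linarith

/-- Norm bound for the solution `Z` of a Sylvester equation `Z R + S Z = B`. -/
theorem Matrix.IsHermitian.mul_opNorm_le_sylvester (hZ : Z.IsHermitian) {σ : ℝ} (hσ : 0 < σ)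
    (h : ∀ x : Fin n → ℝ, σ * (x ⬝ᵥ x) ≤ x ⬝ᵥ R *ᵥ x + x ⬝ᵥ S *ᵥ x) :
    σ * ‖Z‖ ≤ ‖Z * R + S * Z‖ := by
  rw [← le_div_iff₀' hσ]
  refine hZ.opNorm_le_of_eigenpairs (by positivity) fun c x hx hc => ?_
  have hpos : 0 < ‖WithLp.toLp 2 x‖ := by
    have : WithLp.toLp 2 x ≠ 0 := fun h0 => hx (by simpa using h0)
    positivity
  -- On an eigenvector of the symmetric matrix Z both products see the same scalar c, so the
  -- quadratic form of the right-hand side is c times that of R + S.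
  have e1 : x ⬝ᵥ (Z * R + S * Z) *ᵥ x = c * (x ⬝ᵥ R *ᵥ x + x ⬝ᵥ S *ᵥ x) := by
    rw [add_mulVec, dotProduct_add, ← mulVec_mulVec, ← mulVec_mulVec, hc,
      hZ.dotProduct_mulVec_comm, hc, mulVec_smul, dotProduct_smul, smul_dotProduct]
    simp only [smul_eq_mul]; ring
  have e2 : |x ⬝ᵥ (Z * R + S * Z) *ᵥ x| ≤ ‖Z * R + S * Z‖ * (x ⬝ᵥ x) := by
    have h1 := abs_real_inner_le_norm (WithLp.toLp 2 ((Z * R + S * Z) *ᵥ x)) (WithLp.toLp 2 x)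
    rw [EuclideanSpace.inner_toLp_toLp, star_trivial] at h1
    refine h1.trans ?_
    rw [← norm_toLp_sq, sq, ← mul_assoc]
    gcongr
    exact norm_toLp_mulVec_le _ _
  rw [e1, abs_mul] at e2
  rw [le_div_iff₀ hσ]
  have hxx : 0 < x ⬝ᵥ x := by rw [← norm_toLp_sq]; positivity
  have h3 := (h x).trans (le_abs_self _)
  have : |c| * (σ * (x ⬝ᵥ x)) ≤ ‖Z * R + S * Z‖ * (x ⬝ᵥ x) :=
    (mul_le_mul_of_nonneg_left h3 (abs_nonneg c)).trans e2
  rw [← mul_assoc] at this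
  exact le_of_mul_le_mul_right this hxx

/-- If R x = μx, the equation makes Z x satisfy R(Zx) = -μ(Zx) with μ > 0, which coercivity of R
allows only for Zx = 0. Symmetry of Z is not assumed: the lemma also serves to prove that solutions
are symmetric. -/
theorem sylvester_injective (hR : R.IsHermitian) {σ : ℝ} (hσ : 0 < σ)
    (h : ∀ x : Fin n → ℝ, σ * (x ⬝ᵥ x) ≤ x ⬝ᵥ R *ᵥ x) (hZ : Z * R + R * Z = 0) : Z = 0 := by
  have key : ∀ i, Z *ᵥ (hR.eigenvectorBasis i) = 0 := by
    intro i
    set x : Fin n → ℝ := (hR.eigenvectorBasis i).ofLp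
    have hx : R *ᵥ x = hR.eigenvalues i • x := (hR.exists_eigenpair i).2
    have hx0 : 0 < x ⬝ᵥ x := by
      rw [← norm_toLp_sq]
      have := (hR.exists_eigenpair i).1
      exact pow_pos (norm_pos_iff.2 this) 2
    have hμ : 0 < hR.eigenvalues i := by
      have := h x
      rw [hx, dotProduct_smul, smul_eq_mul] at this
      exact hσ.trans_le (le_of_mul_le_mul_right this hx0)
    have e : R *ᵥ (Z *ᵥ x) = -(hR.eigenvalues i • (Z *ᵥ x)) := by
      have := congrArg (· *ᵥ x) hZ
      simp only [add_mulVec, ← mulVec_mulVec, hx, mulVec_smul, zero_mulVec] at this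
      exact eq_neg_of_add_eq_zero_right this
    have h1 := h (Z *ᵥ x)
    rw [e, dotProduct_neg, dotProduct_smul, smul_eq_mul] at h1
    have h2 : 0 ≤ (Z *ᵥ x) ⬝ᵥ (Z *ᵥ x) := by rw [← norm_toLp_sq]; positivity
    have h3 : (Z *ᵥ x) ⬝ᵥ (Z *ᵥ x) = 0 := by nlinarith
    exact dotProduct_self_eq_zero.1 h3
  have : Matrix.toEuclideanLin Z = 0 := by
    refine hR.eigenvectorBasis.toBasis.ext fun i => ?_
    simpa [Matrix.toLpLin_apply] using congrArg (WithLp.toLp 2) (key i)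
  simpa using this

/-- Differentiability of the positive semidefinite square root along a curve. -/
theorem exists_hasDerivAt_sqrt {R Q : ℝ → Matrix (Fin n) (Fin n) ℝ}
    {Q' : Matrix (Fin n) (Fin n) ℝ} {s σ : ℝ} (hσ : 0 < σ) (hR : ∀ u, (R u).PosSemidef)
    (hRQ : ∀ u, R u * R u = Q u)
    (hlow : ∀ x : Fin n → ℝ, σ * (x ⬝ᵥ x) ≤ x ⬝ᵥ R s *ᵥ x) (hQ' : Q'.IsHermitian)
    (hQ : HasDerivAt Q Q' s) :
    ∃ R', HasDerivAt R R' s ∧ σ * ‖R'‖ ≤ ‖Q'‖ := by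
  -- The differential of R ↦ R² at R s. It is injective on a finite-dimensional space, hence
  -- invertible; its inverse E applied to Q' is the derivative sought.
  let L : Matrix (Fin n) (Fin n) ℝ →ₗ[ℝ] Matrix (Fin n) (Fin n) ℝ :=
    LinearMap.mulRight ℝ (R s) + LinearMap.mulLeft ℝ (R s)
  have hL : ∀ Z, L Z = Z * R s + R s * Z := fun Z => rfl
  have hinj : Function.Injective L := by
    rw [← LinearMap.ker_eq_bot, LinearMap.ker_eq_bot']
    exact fun Z hZ => sylvester_injective (hR s).1 hσ hlow hZ
  let e := (LinearEquiv.ofInjectiveEndo L hinj).toContinuousLinearEquiv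
  have he : ∀ Z, e Z = Z * R s + R s * Z := fun Z => rfl
  let E : Matrix (Fin n) (Fin n) ℝ →L[ℝ] Matrix (Fin n) (Fin n) ℝ := e.symm
  have hE : ∀ Z, E (Z * R s + R s * Z) = Z := fun Z => by
    rw [← he]; exact e.symm_apply_apply Z
  have hE' : ∀ Z, E Z * R s + R s * E Z = Z := fun Z => by
    rw [← he]; exact e.apply_symm_apply Z
  -- A Lipschitz bound obtained before any differentiability of R is known. Coercivity is needed at
  -- s alone; of R u only positivity is used.
  have hlip : ∀ u, σ * ‖R u - R s‖ ≤ ‖Q u - Q s‖ := by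
    intro u
    have h1 : Q u - Q s = (R u - R s) * R s + R u * (R u - R s) := by
      rw [← hRQ, ← hRQ]; noncomm_ring
    rw [h1]
    refine ((hR u).1.sub (hR s).1).mul_opNorm_le_sylvester hσ fun x => ?_
    have := (hR u).dotProduct_mulVec_nonneg x
    rw [star_trivial] at this
    linarith [hlow x]
  -- Exact expansion of the square root: a term linear in Q u - Q s and a quadratic remainder, which
  -- is o(u - s) by the Lipschitz bound.
  have hdec : ∀ u, R u = R s + E (Q u - Q s) - E ((R u - R s) * (R u - R s)) := by
    intro u
    have h1 : Q u - Q s - (R u - R s) * (R u - R s)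
        = (R u - R s) * R s + R s * (R u - R s) := by
      rw [← hRQ, ← hRQ]; noncomm_ring
    rw [add_sub_assoc, ← map_sub, h1, hE]; abel
  have hsmall : HasDerivAt (fun u => E ((R u - R s) * (R u - R s))) 0 s := by
    rw [hasDerivAt_iff_isLittleO]
    simp only [sub_self, mul_zero, map_zero, sub_zero, smul_zero]
    have hO : (fun u => R u - R s) =O[𝓝 s] fun u => u - s := by
      refine Asymptotics.IsBigO.trans ?_ hQ.isBigO_sub
      refine Asymptotics.IsBigO.of_bound (1 / σ) (Eventually.of_forall fun u => ?_)
      rw [one_div, ← div_eq_inv_mul, le_div_iff₀' hσ]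
      exact hlip u
    have ho : (fun u => R u - R s) =o[𝓝 s] fun _ => (1 : ℝ) := by
      rw [Asymptotics.isLittleO_one_iff]
      refine hO.trans_tendsto ?_
      have : Tendsto (fun u : ℝ => u - s) (𝓝 s) (𝓝 (s - s)) :=
        (continuous_id.sub continuous_const).tendsto s
      simpa using this
    have := hO.mul_isLittleO ho
    simp only [mul_one] at this
    exact (E.isBigO_comp _ _).trans_isLittleO this
  refine ⟨E Q', ?_, ?_⟩
  · have h1 : HasDerivAt (fun u => R s + E (Q u - Q s) - E ((R u - R s) * (R u - R s)))
        (E Q' - 0) s :=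
      ((E.hasFDerivAt.comp_hasDerivAt s (hQ.sub_const (Q s))).const_add (R s)).sub hsmall
    rw [sub_zero] at h1
    exact h1.congr_of_eventuallyEq (Eventually.of_forall hdec)
  -- The norm bound for Sylvester equations needs a symmetric solution. The transpose of E Q' solves
  -- the same equation, so uniqueness gives symmetry.
  · have hEH : (E Q').IsHermitian := by
      have hT : ((E Q')ᵀ - E Q') * R s + R s * ((E Q')ᵀ - E Q') = 0 := by
        have h1 := congrArg Matrix.transpose (hE' Q')
        have hRs : (R s)ᵀ = R s := by simpa using (hR s).1.eq
        have hQs : Q'ᵀ = Q' := by simpa using hQ'.eq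
        rw [transpose_add, transpose_mul, transpose_mul, hRs, hQs] at h1
        have h2 := hE' Q'
        calc _ = (R s * (E Q')ᵀ + (E Q')ᵀ * R s) - (E Q' * R s + R s * E Q') := by noncomm_ring
          _ = 0 := by rw [h1, h2, sub_self]
      have := sub_eq_zero.1 (sylvester_injective (hR s).1 hσ hlow hT)
      rw [IsHermitian, conjTranspose_eq_transpose_of_trivial, this]
    have := hEH.mul_opNorm_le_sylvester (R := R s) (S := R s) hσ (fun x => by
      have := (hR s).dotProduct_mulVec_nonneg x
      rw [star_trivial] at this
      linarith [hlow x])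
    rwa [hE'] at this

end SymmetricMatrices

/-! ### Weighted means and weighted scatter: derivatives and size. -/

section WeightedMeans

variable {ι : Type*} [Fintype ι]

/-- The mean of `a` with respect to the weights `w`. -/
noncomputable def wmean (w a : ι → ℝ) : ℝ := (∑ i, w i * a i) / ∑ i, w i

/-- The weighted sum of products of the deviations from the weighted means. -/
noncomputable def wcov (w a b : ι → ℝ) : ℝ :=
  ∑ i, w i * ((a i - wmean w a) * (b i - wmean w b))

theorem sum_mul_sub_wmean {w : ι → ℝ} (a : ι → ℝ) (hW : ∑ i, w i ≠ 0) :
    ∑ i, w i * (a i - wmean w a) = 0 := by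
  simp only [mul_sub, Finset.sum_sub_distrib, ← Finset.sum_mul]
  rw [wmean]; field_simp; ring

theorem wcov_eq_sum_sub {w : ι → ℝ} (a b : ι → ℝ) (hW : ∑ i, w i ≠ 0) :
    wcov w a b = ∑ i, w i * a i * b i - (∑ i, w i * a i) * (∑ i, w i * b i) / ∑ i, w i := by
  have h1 : wcov w a b = ∑ i, w i * a i * b i - wmean w b * ∑ i, w i * a i
      - wmean w a * ∑ i, w i * (b i - wmean w b) := by
    rw [wcov, Finset.mul_sum, Finset.mul_sum, ← Finset.sum_sub_distrib, ← Finset.sum_sub_distrib]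
    exact Finset.sum_congr rfl fun i _ => by ring
  rw [h1, sum_mul_sub_wmean b hW, wmean]
  ring

theorem hasDerivAt_sum_mul {w : ℝ → ι → ℝ} {w' a a' : ι → ℝ} {b : ℝ → ι → ℝ} {s : ℝ}
    (hw : ∀ i, HasDerivAt (fun u => w u i) (w' i) s)
    (hb : ∀ i, HasDerivAt (fun u => b u i) (a' i) s) (ha : a = b s) :
    HasDerivAt (fun u => ∑ i, w u i * b u i) (∑ i, (w' i * a i + w s i * a' i)) s := by
  subst ha
  exact HasDerivAt.fun_sum fun i _ => (hw i).mul (hb i)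

/-- In this form w' is paired only with deviations from the mean, whose w-weighted sum vanishes. A
multiple of w may thus be subtracted from w' at no cost. -/
theorem hasDerivAt_wmean {w : ℝ → ι → ℝ} {w' : ι → ℝ} {b : ℝ → ι → ℝ} {b' : ι → ℝ} {s : ℝ}
    (hw : ∀ i, HasDerivAt (fun u => w u i) (w' i) s)
    (hb : ∀ i, HasDerivAt (fun u => b u i) (b' i) s) (hW : ∑ i, w s i ≠ 0) :
    HasDerivAt (fun u => wmean (w u) (b u))
      (wmean (w s) b' + (∑ i, w' i * (b s i - wmean (w s) (b s))) / ∑ i, w s i) s := by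
  have h1 := hasDerivAt_sum_mul hw hb rfl
  have h2 : HasDerivAt (fun u => ∑ i, w u i) (∑ i, w' i) s :=
    HasDerivAt.fun_sum fun i _ => hw i
  convert! h1.div h2 hW using 1
  simp only [wmean, mul_sub, Finset.sum_sub_distrib, Finset.sum_add_distrib, ← Finset.sum_mul]
  field_simp
  ring

/-- The motion of the two weighted means contributes nothing at first order, because the weighted
deviations sum to zero; only the explicit weight is differentiated. -/
theorem hasDerivAt_wcov {w : ℝ → ι → ℝ} {w' : ι → ℝ} (a b : ι → ℝ) {s : ℝ}
    (hw : ∀ i, HasDerivAt (fun u => w u i) (w' i) s) (hW : ∀ u, ∑ i, w u i ≠ 0) :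
    HasDerivAt (fun u => wcov (w u) a b) 
      (∑ i, w' i * ((a i - wmean (w s) a) * (b i - wmean (w s) b))) s := by
  have h0 : HasDerivAt (fun u => ∑ i, w u i) (∑ i, w' i) s :=
    HasDerivAt.fun_sum fun i _ => hw i
  have h1 : HasDerivAt (fun u => ∑ i, w u i * a i) (∑ i, w' i * a i) s :=
    HasDerivAt.fun_sum fun i _ => (hw i).mul_const _
  have h2 : HasDerivAt (fun u => ∑ i, w u i * b i) (∑ i, w' i * b i) s :=
    HasDerivAt.fun_sum fun i _ => (hw i).mul_const _
  have h3 : HasDerivAt (fun u => ∑ i, w u i * a i * b i) (∑ i, w' i * a i * b i) s :=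
    HasDerivAt.fun_sum fun i _ => ((hw i).mul_const _).mul_const _
  have h4 := h3.sub ((h1.mul h2).div h0 (hW s))
  refine (h4.congr_of_eventuallyEq
    (Eventually.of_forall fun u => wcov_eq_sum_sub a b (hW u))).congr_deriv ?_
  have e : ∑ i, w' i * ((a i - wmean (w s) a) * (b i - wmean (w s) b)) =
      ∑ i, w' i * a i * b i - wmean (w s) b * ∑ i, w' i * a i - wmean (w s) a * ∑ i, w' i * b i
        + wmean (w s) a * wmean (w s) b * ∑ i, w' i := by
    simp only [Finset.mul_sum, ← Finset.sum_sub_distrib, ← Finset.sum_add_distrib]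
    exact Finset.sum_congr rfl fun i _ => by ring
  rw [e, wmean, wmean]
  have := hW s
  simp only [Pi.mul_apply]
  field_simp
  ring

theorem abs_sum_mul_le_sqrt (a b : ι → ℝ) :
    |∑ i, a i * b i| ≤ √(∑ i, a i ^ 2) * √(∑ i, b i ^ 2) := by
  rw [← Real.sqrt_mul (Finset.sum_nonneg fun i _ => sq_nonneg _), ← Real.sqrt_sq_eq_abs]
  exact Real.sqrt_le_sqrt (Finset.sum_mul_sq_le_sq_mul_sq _ _ _)

/-- Weighted means with comparable weights are bounded by root mean squares. -/
theorem card_mul_wmean_sq_le {w : ι → ℝ} {K : ℝ} (hw : ∀ i, 0 ≤ w i) (hW : 0 < ∑ i, w i)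
    (hK : ∀ i, Fintype.card ι * w i ≤ K * ∑ j, w j) (a : ι → ℝ) :
    Fintype.card ι * wmean w a ^ 2 ≤ K * ∑ i, a i ^ 2 := by
  have h1 : (∑ i, w i * a i) ^ 2 ≤ (∑ i, w i) * ∑ i, w i * a i ^ 2 := by
    refine Finset.sum_sq_le_sum_mul_sum_of_sq_le_mul _ (fun i _ => hw i)
      (fun i _ => mul_nonneg (hw i) (sq_nonneg _)) fun i _ => le_of_eq (by ring)
  have h2 : Fintype.card ι * ∑ i, w i * a i ^ 2 ≤ K * (∑ i, w i) * ∑ i, a i ^ 2 := by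
    rw [Finset.mul_sum, Finset.mul_sum]
    refine Finset.sum_le_sum fun i _ => ?_
    rw [← mul_assoc]
    exact mul_le_mul_of_nonneg_right (hK i) (sq_nonneg _)
  rw [wmean, div_pow, ← mul_div_assoc, div_le_iff₀ (by positivity)]
  calc (Fintype.card ι : ℝ) * (∑ i, w i * a i) ^ 2
      ≤ Fintype.card ι * ((∑ i, w i) * ∑ i, w i * a i ^ 2) := by gcongr
    _ = (∑ i, w i) * (Fintype.card ι * ∑ i, w i * a i ^ 2) := by ring
    _ ≤ (∑ i, w i) * (K * (∑ i, w i) * ∑ i, a i ^ 2) := by gcongr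
    _ = _ := by ring

theorem sum_sub_wmean_sq_le {w : ι → ℝ} {K : ℝ} (hK1 : 1 ≤ K) (hw : ∀ i, 0 ≤ w i)
    (hW : 0 < ∑ i, w i) (hK : ∀ i, Fintype.card ι * w i ≤ K * ∑ j, w j) (a : ι → ℝ) :
    ∑ i, (a i - wmean w a) ^ 2 ≤ 4 * K * ∑ i, a i ^ 2 := by
  have h1 : ∑ i, (a i - wmean w a) ^ 2 ≤ ∑ i, (2 * a i ^ 2 + 2 * wmean w a ^ 2) :=
    Finset.sum_le_sum fun i _ => by nlinarith [sq_nonneg (a i + wmean w a)]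
  have h2 := card_mul_wmean_sq_le hw hW hK a
  rw [Finset.sum_add_distrib, ← Finset.mul_sum, Finset.sum_const, nsmul_eq_mul,
    Finset.card_univ] at h1
  have h3 : 0 ≤ ∑ i, a i ^ 2 := Finset.sum_nonneg fun i _ => sq_nonneg _
  nlinarith

/-- Bound for weighted sums of products of deviations, for any further weights bounded by `c`. -/
theorem abs_sum_dev_mul_dev_le {w v : ι → ℝ} {K c : ℝ} (hK1 : 1 ≤ K) (hw : ∀ i, 0 ≤ w i)
    (hW : 0 < ∑ i, w i) (hK : ∀ i, Fintype.card ι * w i ≤ K * ∑ j, w j) (hc : 0 ≤ c)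
    (hv : ∀ i, |v i| ≤ c) (a b : ι → ℝ) :
    |∑ i, v i * ((a i - wmean w a) * (b i - wmean w b))|
      ≤ 4 * K * c * (√(∑ i, a i ^ 2) * √(∑ i, b i ^ 2)) := by
  have h1 : |∑ i, v i * ((a i - wmean w a) * (b i - wmean w b))| ≤
      ∑ i, |a i - wmean w a| * (c * |b i - wmean w b|) := by
    refine (Finset.abs_sum_le_sum_abs _ _).trans (Finset.sum_le_sum fun i _ => ?_)
    rw [abs_mul, abs_mul]
    have := mul_le_mul_of_nonneg_right (hv i)
      (mul_nonneg (abs_nonneg (a i - wmean w a)) (abs_nonneg (b i - wmean w b)))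
    linarith
  have h2 : ∑ i, |a i - wmean w a| * |b i - wmean w b| ≤
      √(∑ i, (a i - wmean w a) ^ 2) * √(∑ i, (b i - wmean w b) ^ 2) := by
    have := abs_sum_mul_le_sqrt (fun i => |a i - wmean w a|) (fun i => |b i - wmean w b|)
    simp only [sq_abs] at this
    exact (le_abs_self _).trans this
  have h3 : ∀ a : ι → ℝ, √(∑ i, (a i - wmean w a) ^ 2) ≤ √(4 * K) * √(∑ i, a i ^ 2) := by
    intro a
    rw [← Real.sqrt_mul (by positivity)]
    exact Real.sqrt_le_sqrt (sum_sub_wmean_sq_le hK1 hw hW hK a)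
  have h4 : √(4 * K) * √(4 * K) = 4 * K := Real.mul_self_sqrt (by positivity)
  calc _ ≤ ∑ i, |a i - wmean w a| * (c * |b i - wmean w b|) := h1
    _ = c * ∑ i, |a i - wmean w a| * |b i - wmean w b| := by
        rw [Finset.mul_sum]; exact Finset.sum_congr rfl fun i _ => by ring
    _ ≤ c * ((√(4 * K) * √(∑ i, a i ^ 2)) * (√(4 * K) * √(∑ i, b i ^ 2))) := by
        gcongr
        exact h2.trans (mul_le_mul (h3 a) (h3 b) (by positivity) (by positivity))
    _ = c * ((√(4 * K) * √(4 * K)) * (√(∑ i, a i ^ 2) * √(∑ i, b i ^ 2))) := by ring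
    _ = _ := by rw [h4]; ring

end WeightedMeans

/-! ### Reduction of M, Q and the normal equations to weighted scatter of group means. -/

namespace MixedData

variable {q : ℕ} (D : MixedData q)

/-- The weight `r_i λ / t_i` of a group. -/
noncomputable def wt (lam tau : ℝ) (i : Fin q) : ℝ := D.r i * lam / D.t lam tau i

/-- The shrinkage factor `r_i τ / t_i` of a group. -/
noncomputable def shr (lam tau : ℝ) (i : Fin q) : ℝ := D.r i * tau / D.t lam tau i

/-- The group means of the covariates, as a matrix. -/
noncomputable def xbarMat : Matrix (Fin q) (Fin D.p) ℝ := Matrix.of D.xbar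

/-- The within-group scatter matrix of the covariates. -/
noncomputable def within : Matrix (Fin D.p) (Fin D.p) ℝ := D.Xᵀ * D.X - D.Xbarᵀ * D.Xbar

/-- The within-group cross products of covariates and responses. -/
noncomputable def withinY : Fin D.p → ℝ := D.Xᵀ *ᵥ D.Y - D.Xbarᵀ *ᵥ D.Ybar

/-- The matrix whose inverse is `Q`. -/
noncomputable def gram (lam tau : ℝ) : Matrix (Fin D.p) (Fin D.p) ℝ :=
  D.Xᵀ * D.X - D.Xbarᵀ * D.M lam tau * D.Xbar

/-- The right-hand side of the normal equations for `v / √q`. -/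
noncomputable def cross (lam tau : ℝ) : Fin D.p → ℝ :=
  D.Xᵀ *ᵥ D.Y - D.Xbarᵀ *ᵥ (D.M lam tau *ᵥ D.Ybar)

variable {D} {lam tau : ℝ}

theorem r_cast_pos (i : Fin q) : (0 : ℝ) < D.r i := Nat.cast_pos.2 (D.r_pos i)

theorem t_pos (hl : 0 < lam) (ht : 0 < tau) (i : Fin q) : 0 < D.t lam tau i := by
  have := r_cast_pos (D := D) i
  unfold t; positivity

theorem wt_pos (hl : 0 < lam) (ht : 0 < tau) (i : Fin q) : 0 < D.wt lam tau i := by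
  have := r_cast_pos (D := D) i
  have := t_pos (D := D) hl ht i
  unfold wt; positivity

theorem shr_pos (hl : 0 < lam) (ht : 0 < tau) (i : Fin q) : 0 < D.shr lam tau i := by
  have := r_cast_pos (D := D) i
  have := t_pos (D := D) hl ht i
  unfold shr; positivity

theorem one_sub_shr (hl : 0 < lam) (ht : 0 < tau) (i : Fin q) :
    1 - D.shr lam tau i = lam / D.t lam tau i := by
  have h := t_pos (D := D) hl ht i
  rw [shr, eq_div_iff h.ne', sub_mul, div_mul_cancel₀ _ h.ne', t]
  ring

theorem one_sub_shr_pos (hl : 0 < lam) (ht : 0 < tau) (i : Fin q) :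
    0 < 1 - D.shr lam tau i := by
  have h := t_pos (D := D) hl ht i
  rw [one_sub_shr hl ht]; positivity

theorem wt_eq (hl : 0 < lam) (ht : 0 < tau) (i : Fin q) :
    D.wt lam tau i = D.r i * (1 - D.shr lam tau i) := by
  rw [one_sub_shr hl ht, wt, mul_div_assoc]

theorem sum_wt_pos (hq : 0 < q) (hl : 0 < lam) (ht : 0 < tau) : 0 < ∑ i, D.wt lam tau i :=
  Finset.sum_pos (fun i _ => wt_pos hl ht i) ⟨⟨0, hq⟩, Finset.mem_univ _⟩

theorem sum_obs (g : Fin q → ℝ) : ∑ o : D.Obs, g o.1 = ∑ i, D.r i * g i := by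
  rw [Fintype.sum_sigma]
  simp

/-- The entries of (I - D_c)1 are 1 - d_i; summed over the r_i observations of a group they give the
weight w_i. The rank-one term of M therefore adds the remaining fraction 1 - d_i of the weighted
mean. -/
theorem M_mulVec (hl : 0 < lam) (ht : 0 < tau) (a : Fin q → ℝ) (o : D.Obs) :
    (D.M lam tau *ᵥ fun o => a o.1) o =
      D.shr lam tau o.1 * a o.1 + (1 - D.shr lam tau o.1) * wmean (D.wt lam tau) a := by
  have hdiag : (1 - D.Dc lam tau) = diagonal fun o : D.Obs => 1 - D.shr lam tau o.1 := by
    rw [Dc, ← diagonal_one, diagonal_sub]; rfl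
  have hs : (1 : D.Obs → ℝ) ⬝ᵥ ((1 - D.Dc lam tau) *ᵥ 1) = ∑ i, D.wt lam tau i := by
    rw [hdiag]
    simp only [dotProduct, mulVec_diagonal, Pi.one_apply, one_mul, mul_one]
    rw [sum_obs (fun i => 1 - D.shr lam tau i)]
    exact Finset.sum_congr rfl fun i _ => (wt_eq hl ht i).symm
  have hs2 : (1 : D.Obs → ℝ) ⬝ᵥ ((1 - D.Dc lam tau) *ᵥ fun o => a o.1) =
      ∑ i, D.wt lam tau i * a i := by
    rw [hdiag]
    simp only [dotProduct, mulVec_diagonal, Pi.one_apply, one_mul]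
    rw [sum_obs (fun i => (1 - D.shr lam tau i) * a i)]
    exact Finset.sum_congr rfl fun i _ => by rw [wt_eq hl ht i]; ring
  rw [M, add_mulVec, smul_mulVec, hs, ← mulVec_mulVec, ← mulVec_mulVec, vecMulVec_mulVec, hs2,
    hdiag, Dc]
  simp only [Pi.add_apply, Pi.smul_apply, mulVec_diagonal, smul_eq_mul, wmean, shr,
    MulOpposite.smul_eq_mul_unop, MulOpposite.unop_op, Pi.one_apply]
  ring

theorem sum_xbar_mul_M_mulVec (hq : 0 < q) (hl : 0 < lam) (ht : 0 < tau) (a b : Fin q → ℝ) :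
    ∑ o : D.Obs, b o.1 * (D.M lam tau *ᵥ fun o => a o.1) o =
      ∑ o : D.Obs, b o.1 * a o.1 - wcov (D.wt lam tau) b a := by
  have hW := (sum_wt_pos (D := D) hq hl ht).ne'
  have h1 : wcov (D.wt lam tau) b a = ∑ i, D.wt lam tau i * (b i * (a i - wmean (D.wt lam tau) a))
      - wmean (D.wt lam tau) b * ∑ i, D.wt lam tau i * (a i - wmean (D.wt lam tau) a) := by
    rw [wcov, Finset.mul_sum, ← Finset.sum_sub_distrib]
    exact Finset.sum_congr rfl fun i _ => by ring
  rw [sum_mul_sub_wmean a hW, mul_zero, sub_zero] at h1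
  simp only [M_mulVec hl ht]
  rw [h1, sum_obs (fun i => b i * a i), sum_obs (fun i => b i * (D.shr lam tau i * a i +
    (1 - D.shr lam tau i) * wmean (D.wt lam tau) a)), ← Finset.sum_sub_distrib]
  exact Finset.sum_congr rfl fun i _ => by rw [wt_eq hl ht i]; ring

/-- The first summand does not involve the precisions and the second is positive semidefinite. This
gives coercivity uniform in the precisions and confines their influence to the weights. -/
theorem gram_apply (hq : 0 < q) (hl : 0 < lam) (ht : 0 < tau) (k l : Fin D.p) :
    D.gram lam tau k l = D.within k l +
      wcov (D.wt lam tau) (fun i => D.xbar i k) (fun i => D.xbar i l) := by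
  have h := sum_xbar_mul_M_mulVec (D := D) hq hl ht (fun i => D.xbar i l) (fun i => D.xbar i k)
  rw [gram, within, Matrix.mul_assoc, Matrix.sub_apply, Matrix.sub_apply]
  have e1 : (D.Xbarᵀ * (D.M lam tau * D.Xbar)) k l =
      ∑ o : D.Obs, D.xbar o.1 k * (D.M lam tau *ᵥ fun o => D.xbar o.1 l) o := rfl
  have e2 : (D.Xbarᵀ * D.Xbar) k l = ∑ o : D.Obs, D.xbar o.1 k * D.xbar o.1 l := rfl
  rw [e1, e2, h]; ring

theorem cross_apply (hq : 0 < q) (hl : 0 < lam) (ht : 0 < tau) (k : Fin D.p) :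
    D.cross lam tau k = D.withinY k + wcov (D.wt lam tau) (fun i => D.xbar i k) D.ybar := by
  have h := sum_xbar_mul_M_mulVec (D := D) hq hl ht D.ybar (fun i => D.xbar i k)
  rw [cross, withinY, Pi.sub_apply, Pi.sub_apply]
  have e1 : (D.Xbarᵀ *ᵥ (D.M lam tau *ᵥ D.Ybar)) k =
      ∑ o : D.Obs, D.xbar o.1 k * (D.M lam tau *ᵥ fun o => D.ybar o.1) o := rfl
  have e2 : (D.Xbarᵀ *ᵥ D.Ybar) k = ∑ o : D.Obs, D.xbar o.1 k * D.ybar o.1 := rfl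
  rw [e1, e2, h]; ring

theorem wmean_xbarMat_mulVec (w : Fin q → ℝ) (x : Fin D.p → ℝ) :
    wmean w (D.xbarMat *ᵥ x) = ∑ k, wmean w (fun i => D.xbar i k) * x k := by
  simp only [wmean, mulVec, dotProduct, xbarMat, Matrix.of_apply, Finset.mul_sum,
    div_mul_eq_mul_div, Finset.sum_mul, ← Finset.sum_div]
  rw [Finset.sum_comm]
  simp only [mul_assoc]

theorem sum_sub_wmean_mul (w : Fin q → ℝ) (x : Fin D.p → ℝ) (i : Fin q) :
    ∑ k, (D.xbar i k - wmean w (fun i => D.xbar i k)) * x k =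
      (D.xbarMat *ᵥ x) i - wmean w (D.xbarMat *ᵥ x) := by
  rw [wmean_xbarMat_mulVec]
  simp only [sub_mul, Finset.sum_sub_distrib]
  rfl

theorem dotProduct_scatter (w v : Fin q → ℝ) (b : Fin q → ℝ) (x : Fin D.p → ℝ) :
    x ⬝ᵥ (fun k => ∑ i, v i * ((D.xbar i k - wmean w (fun i => D.xbar i k)) * b i)) =
      ∑ i, v i * (((D.xbarMat *ᵥ x) i - wmean w (D.xbarMat *ᵥ x)) * b i) := by
  simp only [← sum_sub_wmean_mul, dotProduct, Finset.mul_sum, Finset.sum_mul]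
  rw [Finset.sum_comm]
  exact Finset.sum_congr rfl fun i _ => Finset.sum_congr rfl fun k _ => by ring

/-- The weights v of the sum are kept apart from the weights w of the means: v = w gives the scatter
itself, v = w' its derivative. -/
theorem dotProduct_scatterMat_mulVec (w v : Fin q → ℝ) (x z : Fin D.p → ℝ) :
    x ⬝ᵥ (Matrix.of fun k l => ∑ i, v i * ((D.xbar i k - wmean w (fun i => D.xbar i k)) *
      (D.xbar i l - wmean w (fun i => D.xbar i l)))) *ᵥ z =
      ∑ i, v i * (((D.xbarMat *ᵥ x) i - wmean w (D.xbarMat *ᵥ x)) *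
        ((D.xbarMat *ᵥ z) i - wmean w (D.xbarMat *ᵥ z))) := by
  rw [← dotProduct_scatter]
  congr 1
  ext k
  simp only [mulVec, dotProduct, Matrix.of_apply, Finset.sum_mul]
  rw [Finset.sum_comm]
  refine Finset.sum_congr rfl fun i _ => ?_
  have := sum_sub_wmean_mul w z i
  simp only [mulVec, dotProduct] at this
  rw [← this, Finset.mul_sum, Finset.mul_sum]
  exact Finset.sum_congr rfl fun l _ => by ring

theorem dotProduct_gram_mulVec (hq : 0 < q) (hl : 0 < lam) (ht : 0 < tau) (x z : Fin D.p → ℝ) :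
    x ⬝ᵥ D.gram lam tau *ᵥ z = x ⬝ᵥ D.within *ᵥ z +
      wcov (D.wt lam tau) (D.xbarMat *ᵥ x) (D.xbarMat *ᵥ z) := by
  have h : D.gram lam tau = D.within + Matrix.of fun k l => wcov (D.wt lam tau)
      (fun i => D.xbar i k) (fun i => D.xbar i l) := by
    ext k l; exact gram_apply hq hl ht k l
  rw [h, add_mulVec, dotProduct_add]
  congr 1
  exact dotProduct_scatterMat_mulVec _ _ _ _

theorem dotProduct_cross (hq : 0 < q) (hl : 0 < lam) (ht : 0 < tau) (x : Fin D.p → ℝ) :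
    x ⬝ᵥ D.cross lam tau = x ⬝ᵥ D.withinY + wcov (D.wt lam tau) (D.xbarMat *ᵥ x) D.ybar := by
  have h : D.cross lam tau = D.withinY + fun k => wcov (D.wt lam tau)
      (fun i => D.xbar i k) D.ybar := by
    ext k; exact cross_apply hq hl ht k
  rw [h, dotProduct_add]
  congr 1
  exact dotProduct_scatter _ _ _ _

theorem sum_sub_mean {r : ℕ} (hr : 0 < r) (a b : Fin r → ℝ) :
    ∑ j, (a j - (∑ j, a j) / r) * (b j - (∑ j, b j) / r) =
      ∑ j, a j * b j - r * ((∑ j, a j) / r * ((∑ j, b j) / r)) := by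
  have : (r : ℝ) ≠ 0 := by positivity
  simp only [sub_mul, mul_sub, Finset.sum_sub_distrib, ← Finset.sum_mul, ← Finset.mul_sum,
    Finset.sum_const, Finset.card_univ, Fintype.card_fin, nsmul_eq_mul]
  field_simp
  ring

theorem sum_mul_xbar (i : Fin q) (x : Fin D.p → ℝ) :
    (D.xbarMat *ᵥ x) i = (∑ j, ∑ k, D.x i j k * x k) / D.r i := by
  simp only [xbarMat, mulVec, dotProduct, Matrix.of_apply, xbar, div_mul_eq_mul_div,
    Finset.sum_mul, ← Finset.sum_div]
  rw [Finset.sum_comm]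

theorem dotProduct_within_mulVec (x z : Fin D.p → ℝ) :
    x ⬝ᵥ D.within *ᵥ z = ∑ i, ∑ j, (∑ k, D.x i j k * x k - (D.xbarMat *ᵥ x) i) *
      (∑ k, D.x i j k * z k - (D.xbarMat *ᵥ z) i) := by
  have e1 : ∀ A : Matrix D.Obs (Fin D.p) ℝ, x ⬝ᵥ (Aᵀ * A) *ᵥ z = (A *ᵥ x) ⬝ᵥ (A *ᵥ z) := by
    intro A
    rw [← mulVec_mulVec, dotProduct_mulVec, vecMul_transpose]
  rw [within, sub_mulVec, dotProduct_sub, e1, e1]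
  simp only [dotProduct, Fintype.sum_sigma]
  rw [← Finset.sum_sub_distrib]
  refine Finset.sum_congr rfl fun i _ => ?_
  simp only [sum_mul_xbar]
  rw [sum_sub_mean (D.r_pos i), ← sum_mul_xbar, ← sum_mul_xbar]
  congr 1
  exact (Finset.sum_const ((D.xbarMat *ᵥ x) i * (D.xbarMat *ᵥ z) i)).trans (by simp)

theorem dotProduct_withinY (x : Fin D.p → ℝ) :
    x ⬝ᵥ D.withinY = ∑ i, ∑ j, (∑ k, D.x i j k * x k - (D.xbarMat *ᵥ x) i) *
      (D.y i j - D.ybar i) := by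
  rw [withinY, dotProduct_sub, dotProduct_mulVec, dotProduct_mulVec, vecMul_transpose,
    vecMul_transpose]
  simp only [dotProduct, Fintype.sum_sigma]
  rw [← Finset.sum_sub_distrib]
  refine Finset.sum_congr rfl fun i _ => ?_
  simp only [sum_mul_xbar, ybar]
  rw [sum_sub_mean (D.r_pos i), ← sum_mul_xbar]
  congr 1
  exact (Finset.sum_const ((D.xbarMat *ᵥ x) i * D.ybar i)).trans (by simp [ybar])

theorem dotProduct_gramX_mulVec (x : Fin D.p → ℝ) :
    x ⬝ᵥ (D.Xᵀ * D.X) *ᵥ x = ∑ i, ∑ j, (∑ k, D.x i j k * x k) ^ 2 := by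
  rw [← mulVec_mulVec, dotProduct_mulVec, vecMul_transpose]
  simp only [dotProduct, Fintype.sum_sigma, sq]
  rfl

end MixedData

/-! ### The Euclidean norm on plain functions. -/

section EuclideanNorm

variable {ι : Type*} [Fintype ι]

/-- The Euclidean norm of a vector. -/
noncomputable def vnorm (x : ι → ℝ) : ℝ := ‖WithLp.toLp 2 x‖

theorem vnorm_nonneg (x : ι → ℝ) : 0 ≤ vnorm x := norm_nonneg _

theorem vnorm_eq_sqrt (x : ι → ℝ) : vnorm x = √(∑ i, x i ^ 2) := by
  rw [vnorm, EuclideanSpace.norm_eq]; simp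

theorem vnorm_sq (x : ι → ℝ) : vnorm x ^ 2 = ∑ i, x i ^ 2 := by
  rw [vnorm_eq_sqrt, Real.sq_sqrt (Finset.sum_nonneg fun i _ => sq_nonneg _)]

theorem vnorm_sq' (x : ι → ℝ) : vnorm x ^ 2 = x ⬝ᵥ x := norm_toLp_sq x

theorem vnorm_add_le (x y : ι → ℝ) : vnorm (x + y) ≤ vnorm x + vnorm y :=
  norm_add_le (WithLp.toLp 2 x) (WithLp.toLp 2 y)

theorem vnorm_sub_le (x y : ι → ℝ) : vnorm (x - y) ≤ vnorm x + vnorm y :=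
  norm_sub_le (WithLp.toLp 2 x) (WithLp.toLp 2 y)

theorem vnorm_smul (c : ℝ) (x : ι → ℝ) : vnorm (c • x) = |c| * vnorm x :=
  norm_smul c (WithLp.toLp 2 x)

theorem abs_dotProduct_le (x y : ι → ℝ) : |x ⬝ᵥ y| ≤ vnorm x * vnorm y := by
  rw [vnorm_eq_sqrt, vnorm_eq_sqrt]; exact abs_sum_mul_le_sqrt x y

theorem vnorm_le_of_sq_le {x : ι → ℝ} {c : ℝ} (hc : 0 ≤ c) (h : ∑ i, x i ^ 2 ≤ c ^ 2) :
    vnorm x ≤ c := by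
  rw [← vnorm_sq] at h
  exact (pow_le_pow_iff_left₀ (vnorm_nonneg x) hc two_ne_zero).1 h

theorem vnorm_mono {x y : ι → ℝ} (h : ∀ i, |x i| ≤ |y i|) : vnorm x ≤ vnorm y := by
  rw [vnorm_eq_sqrt, vnorm_eq_sqrt]
  exact Real.sqrt_le_sqrt (Finset.sum_le_sum fun i _ => sq_le_sq.2 (h i))

theorem vnorm_mul_le {c : ℝ} {d x : ι → ℝ} (h : ∀ i, |d i| ≤ c) :
    vnorm (fun i => d i * x i) ≤ c * vnorm x := by
  have h0 : vnorm (fun i => d i * x i) ≤ vnorm (fun i => c * x i) := by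
    refine vnorm_mono fun i => ?_
    rw [abs_mul, abs_mul]
    exact mul_le_mul_of_nonneg_right ((h i).trans (le_abs_self c)) (abs_nonneg _)
  rcases isEmpty_or_nonempty ι with hι | ⟨⟨i⟩⟩
  · simp [vnorm_eq_sqrt]
  · have hc : 0 ≤ c := (abs_nonneg _).trans (h i)
    refine h0.trans (le_of_eq ?_)
    have := vnorm_smul c x
    rwa [abs_of_nonneg hc] at this

theorem vnorm_const (c : ℝ) : vnorm (fun _ : ι => c) = √(Fintype.card ι) * |c| := by
  rw [vnorm_eq_sqrt, Finset.sum_const, nsmul_eq_mul, Real.sqrt_mul (by positivity),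
    Real.sqrt_sq_eq_abs, Finset.card_univ]

theorem vnorm_le_of_forall_dotProduct {x : ι → ℝ} {c : ℝ} (hc : 0 ≤ c)
    (h : ∀ z : ι → ℝ, |z ⬝ᵥ x| ≤ c * vnorm z) : vnorm x ≤ c := by
  have h1 := (le_abs_self _).trans (h x)
  rw [← vnorm_sq', sq] at h1
  rcases (vnorm_nonneg x).eq_or_lt with h0 | h0
  · rwa [← h0]
  · exact le_of_mul_le_mul_right h1 h0

end EuclideanNorm

/-! ### Derivatives of matrix curves, and inverses of coercive matrices. -/

section MatrixCurves

open scoped Matrix.Norms.L2Operator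

variable {n : ℕ}

theorem vnorm_mulVec_le (A : Matrix (Fin n) (Fin n) ℝ) (x : Fin n → ℝ) :
    vnorm (A *ᵥ x) ≤ ‖A‖ * vnorm x := norm_toLp_mulVec_le A x

theorem opNorm_le_of_forall_dotProduct {A : Matrix (Fin n) (Fin n) ℝ} {c : ℝ} (hc : 0 ≤ c)
    (h : ∀ x z : Fin n → ℝ, |x ⬝ᵥ A *ᵥ z| ≤ c * (vnorm x * vnorm z)) : ‖A‖ ≤ c := by
  refine opNorm_le_of_forall_mulVec hc fun z => ?_
  rw [← vnorm_sq', ← vnorm_sq', ← mul_pow]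
  have : vnorm (A *ᵥ z) ≤ c * vnorm z :=
    vnorm_le_of_forall_dotProduct (mul_nonneg hc (vnorm_nonneg z)) fun x =>
      (h x z).trans (le_of_eq (by ring))
  exact pow_le_pow_left₀ (vnorm_nonneg _) this 2

/-- The operator norm is not an entrywise norm; expanding in matrix units makes the curve a finite
sum of scalar curves times constant matrices. -/
theorem hasDerivAt_matrix {A : ℝ → Matrix (Fin n) (Fin n) ℝ} {A' : Matrix (Fin n) (Fin n) ℝ}
    {s : ℝ} (h : ∀ i j, HasDerivAt (fun u => A u i j) (A' i j) s) : HasDerivAt A A' s := by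
  have h1 : ∀ B : Matrix (Fin n) (Fin n) ℝ, B = ∑ i, ∑ j, B i j • single i j (1 : ℝ) := by
    intro B
    conv_lhs => rw [matrix_eq_sum_single B]
    simp
  rw [h1 A']
  refine HasDerivAt.congr_of_eventuallyEq ?_ (Eventually.of_forall fun u => h1 (A u))
  exact HasDerivAt.fun_sum fun i _ => HasDerivAt.fun_sum fun j _ => (h i j).smul_const _

theorem HasDerivAt.matrix_apply {A : ℝ → Matrix (Fin n) (Fin n) ℝ}
    {A' : Matrix (Fin n) (Fin n) ℝ} {s : ℝ} (h : HasDerivAt A A' s) (i j : Fin n) :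
    HasDerivAt (fun u => A u i j) (A' i j) s :=
  (LinearMap.toContinuousLinearMap (entryLinearMap ℝ ℝ i j)).hasFDerivAt.comp_hasDerivAt s h

theorem HasDerivAt.matrix_mulVec {A : ℝ → Matrix (Fin n) (Fin n) ℝ}
    {A' : Matrix (Fin n) (Fin n) ℝ} {c : ℝ → Fin n → ℝ} {c' : Fin n → ℝ} {s : ℝ}
    (h : HasDerivAt A A' s) (hc : ∀ k, HasDerivAt (fun u => c u k) (c' k) s) (k : Fin n) :
    HasDerivAt (fun u => (A u *ᵥ c u) k) ((A' *ᵥ c s + A s *ᵥ c') k) s := by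
  have h1 : HasDerivAt (fun u => ∑ l, A u k l * c u l)
      (∑ l, (A' k l * c s l + A s k l * c' l)) s :=
    HasDerivAt.fun_sum fun l _ => (h.matrix_apply k l).mul (hc l)
  rw [Finset.sum_add_distrib] at h1
  exact h1

theorem hasDerivAt_matrix_inv {G : ℝ → Matrix (Fin n) (Fin n) ℝ}
    {G' : Matrix (Fin n) (Fin n) ℝ} {s : ℝ} (hG : HasDerivAt G G' s) (hu : IsUnit (G s)) :
    HasDerivAt (fun u => (G u)⁻¹) (-((G s)⁻¹ * G' * (G s)⁻¹)) s := by
  obtain ⟨U, hU⟩ := hu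
  have h1 := hasFDerivAt_ringInverse (𝕜 := ℝ) U
  rw [hU] at h1
  have h2 := h1.comp_hasDerivAt s hG
  have e : (↑U⁻¹ : Matrix (Fin n) (Fin n) ℝ) = (G s)⁻¹ := by
    rw [← hU, coe_units_inv]
  simp only [_root_.neg_apply, ContinuousLinearMap.mulLeftRight_apply, e] at h2
  refine h2.congr_of_eventuallyEq (Eventually.of_forall fun u => ?_)
  exact nonsing_inv_eq_ringInverse _

theorem isUnit_of_coercive {G : Matrix (Fin n) (Fin n) ℝ} {c : ℝ} (hc : 0 < c)
    (h : ∀ x : Fin n → ℝ, c * (x ⬝ᵥ x) ≤ x ⬝ᵥ G *ᵥ x) : IsUnit G := by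
  rw [← mulVec_injective_iff_isUnit]
  intro x y hxy
  have h1 : G *ᵥ (x - y) = 0 := by rw [mulVec_sub, sub_eq_zero]; exact hxy
  have h2 := h (x - y)
  rw [h1, dotProduct_zero, ← vnorm_sq'] at h2
  have h3 : vnorm (x - y) ^ 2 = 0 := by
    have := sq_nonneg (vnorm (x - y))
    nlinarith
  rw [vnorm_sq'] at h3
  exact sub_eq_zero.1 (dotProduct_self_eq_zero.1 h3)

theorem opNorm_inv_le_of_coercive {G : Matrix (Fin n) (Fin n) ℝ} {c : ℝ} (hc : 0 < c)
    (h : ∀ x : Fin n → ℝ, c * (x ⬝ᵥ x) ≤ x ⬝ᵥ G *ᵥ x) : ‖G⁻¹‖ ≤ c⁻¹ := by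
  have hu := isUnit_of_coercive hc h
  refine opNorm_le_of_forall_mulVec (by positivity) fun x => ?_
  set y := G⁻¹ *ᵥ x
  have hy : G *ᵥ y = x := by
    rw [mulVec_mulVec, mul_nonsing_inv _ ((isUnit_iff_isUnit_det _).1 hu), one_mulVec]
  have h1 := h y
  rw [hy, ← vnorm_sq'] at h1
  have h2 := (le_abs_self _).trans (abs_dotProduct_le y x)
  rw [← vnorm_sq', ← vnorm_sq', ← mul_pow]
  refine pow_le_pow_left₀ (vnorm_nonneg _) ?_ 2
  rw [inv_mul_eq_div, le_div_iff₀' hc]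
  rcases (vnorm_nonneg y).eq_or_lt with h0 | h0
  · rw [← h0, mul_zero]; exact vnorm_nonneg x
  · have h3 : (c * vnorm y) * vnorm y ≤ vnorm x * vnorm y := by nlinarith
    exact le_of_mul_le_mul_right h3 h0

/-- Coercivity of the inverse of a bounded coercive matrix. -/
theorem coercive_inv {G : Matrix (Fin n) (Fin n) ℝ} {c L : ℝ} (hc : 0 < c) (hL : 0 < L)
    (h : ∀ x : Fin n → ℝ, c * (x ⬝ᵥ x) ≤ x ⬝ᵥ G *ᵥ x) (hG : ‖G‖ ≤ L) (x : Fin n → ℝ) :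
    c / L ^ 2 * (x ⬝ᵥ x) ≤ x ⬝ᵥ G⁻¹ *ᵥ x := by
  have hu := isUnit_of_coercive hc h
  set y := G⁻¹ *ᵥ x
  have hy : G *ᵥ y = x := by
    rw [mulVec_mulVec, mul_nonsing_inv _ ((isUnit_iff_isUnit_det _).1 hu), one_mulVec]
  have h1 := h y
  rw [hy, dotProduct_comm y x] at h1
  refine le_trans ?_ h1
  have h2 : vnorm x ≤ L * vnorm y := by
    rw [← hy]
    exact (vnorm_mulVec_le G y).trans (mul_le_mul_of_nonneg_right hG (vnorm_nonneg y))
  rw [← vnorm_sq', ← vnorm_sq', div_mul_eq_mul_div, div_le_iff₀ (by positivity)]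
  have h3 := pow_le_pow_left₀ (vnorm_nonneg x) h2 2
  calc c * vnorm x ^ 2 ≤ c * (L * vnorm y) ^ 2 := by gcongr
    _ = _ := by ring

end MatrixCurves

/-! ### Bounds for Q, its root and the normal equations, uniform in the precisions. -/

namespace MixedData

variable {q : ℕ}

/-- Quantitative regularity of a data set, with a single constant `K`. -/
structure Regular (D : MixedData q) (K : ℝ) : Prop where
  one_le : 1 ≤ K
  q_pos : 0 < q
  r_le : ∀ i, (D.r i : ℝ) ≤ K * D.rbar
  rbar_le : ∀ i, D.rbar ≤ K * D.r i
  within_ge : ∀ x, D.rbar * q * (x ⬝ᵥ x) ≤ K * (x ⬝ᵥ D.within *ᵥ x)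
  gram_le : ∀ x, x ⬝ᵥ (D.Xᵀ * D.X) *ᵥ x ≤ K * (D.rbar * q) * (x ⬝ᵥ x)
  resp_le : ∑ i, ∑ j, D.y i j ^ 2 ≤ K * (D.rbar * q)

/-- Positive curves of precisions with logarithmic derivatives `α`, `β` at `s`. -/
structure PrecisionCurve (lam tau : ℝ → ℝ) (s α β : ℝ) : Prop where
  lam_pos : ∀ u, 0 < lam u
  tau_pos : ∀ u, 0 < tau u
  deriv_lam : HasDerivAt lam (α * lam s) s
  deriv_tau : HasDerivAt tau (β * tau s) s

variable {D : MixedData q} {K : ℝ}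

namespace Regular

theorem K_pos (h : D.Regular K) : 0 < K := one_pos.trans_le h.one_le

theorem q_cast_pos (h : D.Regular K) : (0 : ℝ) < q := Nat.cast_pos.2 h.q_pos

theorem rbar_pos (h : D.Regular K) : 0 < D.rbar := by
  have h1 := h.r_le ⟨0, h.q_pos⟩
  have h2 := r_cast_pos (D := D) ⟨0, h.q_pos⟩
  exact pos_of_mul_pos_right (h2.trans_le h1) h.K_pos.le

theorem N_pos (h : D.Regular K) : 0 < D.rbar * q := mul_pos h.rbar_pos h.q_cast_pos

/-- Between-group sums of squares are at most total sums of squares, the difference being the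
within-group part. -/
theorem sum_xbarMat_sq_le (h : D.Regular K) (x : Fin D.p → ℝ) :
    ∑ i, D.r i * (D.xbarMat *ᵥ x) i ^ 2 ≤ K * (D.rbar * q) * vnorm x ^ 2 := by
  refine le_trans ?_ ((h.gram_le x).trans (le_of_eq (by rw [vnorm_sq'])))
  rw [dotProduct_gramX_mulVec]
  refine Finset.sum_le_sum fun i _ => ?_
  rw [sum_mul_xbar]
  have h1 := sum_sub_mean (D.r_pos i) (fun j => ∑ k, D.x i j k * x k)
    (fun j => ∑ k, D.x i j k * x k)
  have h2 : 0 ≤ ∑ j, (∑ k, D.x i j k * x k - (∑ j, ∑ k, D.x i j k * x k) / D.r i) *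
    (∑ k, D.x i j k * x k - (∑ j, ∑ k, D.x i j k * x k) / D.r i) :=
    Finset.sum_nonneg fun j _ => mul_self_nonneg _
  simp only [← sq] at h1 h2
  linarith

theorem sum_ybar_sq_le' (h : D.Regular K) :
    ∑ i, D.r i * D.ybar i ^ 2 ≤ K * (D.rbar * q) := by
  refine le_trans (Finset.sum_le_sum fun i _ => ?_) h.resp_le
  have h1 := sum_sub_mean (D.r_pos i) (D.y i) (D.y i)
  have h2 : 0 ≤ ∑ j, (D.y i j - (∑ j, D.y i j) / D.r i) *
    (D.y i j - (∑ j, D.y i j) / D.r i) := Finset.sum_nonneg fun j _ => mul_self_nonneg _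
  simp only [← sq] at h1 h2
  rw [ybar]
  linarith

theorem vnorm_le_of_weighted (h : D.Regular K) {a : Fin q → ℝ} {c : ℝ} (hc : 0 ≤ c)
    (ha : ∑ i, D.r i * a i ^ 2 ≤ K * (D.rbar * q) * c ^ 2) : vnorm a ≤ K * √q * c := by
  have hK := h.K_pos
  refine vnorm_le_of_sq_le (by positivity) ?_
  have h1 : D.rbar * ∑ i, a i ^ 2 ≤ K * ∑ i, D.r i * a i ^ 2 := by
    rw [Finset.mul_sum, Finset.mul_sum]
    refine Finset.sum_le_sum fun i _ => ?_
    rw [← mul_assoc]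
    exact mul_le_mul_of_nonneg_right (h.rbar_le i) (sq_nonneg _)
  have h2 : D.rbar * ∑ i, a i ^ 2 ≤ D.rbar * (K ^ 2 * q * c ^ 2) :=
    h1.trans ((mul_le_mul_of_nonneg_left ha hK.le).trans (le_of_eq (by ring)))
  refine (le_of_mul_le_mul_left h2 h.rbar_pos).trans (le_of_eq ?_)
  rw [mul_pow, mul_pow, Real.sq_sqrt (by positivity)]

theorem vnorm_xbarMat_mulVec_le (h : D.Regular K) (x : Fin D.p → ℝ) :
    vnorm (D.xbarMat *ᵥ x) ≤ K * √q * vnorm x :=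
  h.vnorm_le_of_weighted (vnorm_nonneg x) (h.sum_xbarMat_sq_le x)

theorem vnorm_ybar_le (h : D.Regular K) : vnorm D.ybar ≤ K * √q := by
  have := h.vnorm_le_of_weighted (a := D.ybar) zero_le_one (by simpa using h.sum_ybar_sq_le')
  simpa using this

/-- The form is the inner product of two fitted vectors centred within groups, and centring does not
increase the norm. -/
theorem abs_within_le (h : D.Regular K) (x z : Fin D.p → ℝ) :
    |x ⬝ᵥ D.within *ᵥ z| ≤ K * (D.rbar * q) * (vnorm x * vnorm z) := by
  have hN := h.N_pos
  have hq := h.q_cast_pos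
  have hr := h.rbar_pos
  have hK := h.K_pos
  let dev : (Fin D.p → ℝ) → D.Obs → ℝ := fun x o =>
    ∑ k, D.x o.1 o.2 k * x k - (D.xbarMat *ᵥ x) o.1
  have h1 : x ⬝ᵥ D.within *ᵥ z = dev x ⬝ᵥ dev z := by
    rw [dotProduct_within_mulVec, dotProduct, Fintype.sum_sigma]
  have h2 : ∀ x, vnorm (dev x) ≤ √(K * (D.rbar * q)) * vnorm x := by
    intro x
    refine vnorm_le_of_sq_le (mul_nonneg (Real.sqrt_nonneg _) (vnorm_nonneg x)) ?_
    rw [mul_pow, Real.sq_sqrt (by positivity), vnorm_sq']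
    refine le_trans ?_ (h.gram_le x)
    rw [dotProduct_gramX_mulVec, Fintype.sum_sigma]
    refine Finset.sum_le_sum fun i _ => ?_
    have h3 := sum_sub_mean (D.r_pos i) (fun j => ∑ k, D.x i j k * x k)
      (fun j => ∑ k, D.x i j k * x k)
    simp only [dev, sum_mul_xbar]
    simp only [← sq] at h3
    rw [h3]
    have : (0 : ℝ) ≤ D.r i * ((∑ j, ∑ k, D.x i j k * x k) / D.r i) ^ 2 := by positivity
    linarith
  rw [h1]
  calc _ ≤ vnorm (dev x) * vnorm (dev z) := abs_dotProduct_le _ _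
    _ ≤ (√(K * (D.rbar * q)) * vnorm x) * (√(K * (D.rbar * q)) * vnorm z) :=
        mul_le_mul (h2 x) (h2 z) (vnorm_nonneg _)
          (mul_nonneg (Real.sqrt_nonneg _) (vnorm_nonneg x))
    _ = (√(K * (D.rbar * q)) * √(K * (D.rbar * q))) * (vnorm x * vnorm z) := by ring
    _ = _ := by rw [Real.mul_self_sqrt (by positivity)]

theorem abs_withinY_le (h : D.Regular K) (x : Fin D.p → ℝ) :
    |x ⬝ᵥ D.withinY| ≤ K * (D.rbar * q) * vnorm x := by
  have hN := h.N_pos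
  have hq := h.q_cast_pos
  have hr := h.rbar_pos
  have hK := h.K_pos
  let dev : D.Obs → ℝ := fun o => ∑ k, D.x o.1 o.2 k * x k - (D.xbarMat *ᵥ x) o.1
  let devY : D.Obs → ℝ := fun o => D.y o.1 o.2 - D.ybar o.1
  have h1 : x ⬝ᵥ D.withinY = dev ⬝ᵥ devY := by
    rw [dotProduct_withinY, dotProduct, Fintype.sum_sigma]
  have h2 : vnorm dev ≤ √(K * (D.rbar * q)) * vnorm x := by
    refine vnorm_le_of_sq_le (mul_nonneg (Real.sqrt_nonneg _) (vnorm_nonneg x)) ?_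
    rw [mul_pow, Real.sq_sqrt (by positivity)]
    have h3 := (le_abs_self _).trans (h.abs_within_le x x)
    rw [dotProduct_within_mulVec] at h3
    rw [Fintype.sum_sigma, sq (vnorm x)]
    simpa only [dev, sq] using h3
  have h3 : vnorm devY ≤ √(K * (D.rbar * q)) := by
    refine vnorm_le_of_sq_le (Real.sqrt_nonneg _) ?_
    rw [Real.sq_sqrt (by positivity)]
    refine le_trans ?_ h.resp_le
    rw [Fintype.sum_sigma]
    refine Finset.sum_le_sum fun i _ => ?_
    have h3 := sum_sub_mean (D.r_pos i) (D.y i) (D.y i)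
    simp only [devY, ybar]
    simp only [← sq] at h3
    rw [h3]
    have : (0 : ℝ) ≤ D.r i * ((∑ j, D.y i j) / D.r i) ^ 2 := by positivity
    linarith
  rw [h1]
  calc _ ≤ vnorm dev * vnorm devY := abs_dotProduct_le _ _
    _ ≤ (√(K * (D.rbar * q)) * vnorm x) * √(K * (D.rbar * q)) :=
        mul_le_mul h2 h3 (vnorm_nonneg _) (mul_nonneg (Real.sqrt_nonneg _) (vnorm_nonneg x))
    _ = (√(K * (D.rbar * q)) * √(K * (D.rbar * q))) * vnorm x := by ring
    _ = _ := by rw [Real.mul_self_sqrt (by positivity)]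

variable {l τ : ℝ}

/-- The function r ↦ rλ/(rτ + λ) is increasing and grows at most linearly, so w_i/w_j is bounded by
the bound K² for r_i/r_j, whatever the precisions. -/
theorem card_mul_wt_le (h : D.Regular K) (hl : 0 < l) (ht : 0 < τ) (i : Fin q) :
    (Fintype.card (Fin q) : ℝ) * D.wt l τ i ≤ K ^ 2 * ∑ j, D.wt l τ j := by
  have hK := h.one_le
  have h1 : ∀ j, D.wt l τ i ≤ K ^ 2 * D.wt l τ j := by
    intro j
    have hi := r_cast_pos (D := D) i
    have hj := r_cast_pos (D := D) j
    have hr : (D.r i : ℝ) ≤ K ^ 2 * D.r j := by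
      calc (D.r i : ℝ) ≤ K * D.rbar := h.r_le i
        _ ≤ K * (K * D.r j) := by have := h.rbar_le j; gcongr
        _ = _ := by ring
    have hK2 : 1 ≤ K ^ 2 := one_le_pow₀ hK
    rw [wt, wt, t, t, ← mul_div_assoc, div_le_div_iff₀ (by positivity) (by positivity)]
    have e1 : (D.r i : ℝ) * D.r j ≤ K ^ 2 * (D.r i * D.r j) :=
      le_mul_of_one_le_left (by positivity) hK2
    calc (D.r i : ℝ) * l * (D.r j * τ + l) = l * (τ * (D.r i * D.r j) + D.r i * l) := by ring
      _ ≤ l * (τ * (K ^ 2 * (D.r i * D.r j)) + K ^ 2 * D.r j * l) := by gcongr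
      _ = _ := by ring
  rw [Finset.mul_sum, ← nsmul_eq_mul, ← Finset.card_univ, ← Finset.sum_const]
  exact Finset.sum_le_sum fun j _ => h1 j

theorem abs_scatter_le (h : D.Regular K) (hl : 0 < l) (ht : 0 < τ) {v : Fin q → ℝ} {c : ℝ}
    (hc : 0 ≤ c) (hv : ∀ i, |v i| ≤ c) (a b : Fin q → ℝ) :
    |∑ i, v i * ((a i - wmean (D.wt l τ) a) * (b i - wmean (D.wt l τ) b))| ≤
      4 * K ^ 2 * c * (vnorm a * vnorm b) := by
  rw [vnorm_eq_sqrt, vnorm_eq_sqrt]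
  exact abs_sum_dev_mul_dev_le (one_le_pow₀ h.one_le) (fun i => (wt_pos hl ht i).le)
    (sum_wt_pos h.q_pos hl ht) (h.card_mul_wt_le hl ht) hc hv a b

theorem abs_scatter_xbar_le (h : D.Regular K) (hl : 0 < l) (ht : 0 < τ) {v : Fin q → ℝ} {c : ℝ}
    (hc : 0 ≤ c) (hv : ∀ i, |v i| ≤ c) (x z : Fin D.p → ℝ) :
    |∑ i, v i * (((D.xbarMat *ᵥ x) i - wmean (D.wt l τ) (D.xbarMat *ᵥ x)) *
        ((D.xbarMat *ᵥ z) i - wmean (D.wt l τ) (D.xbarMat *ᵥ z)))| ≤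
      4 * K ^ 4 * (c * q) * (vnorm x * vnorm z) := by
  have hK := h.K_pos
  refine (h.abs_scatter_le hl ht hc hv _ _).trans ?_
  calc _ ≤ 4 * K ^ 2 * c * ((K * √q * vnorm x) * (K * √q * vnorm z)) := by
        have := vnorm_nonneg x
        exact mul_le_mul_of_nonneg_left (mul_le_mul (h.vnorm_xbarMat_mulVec_le x)
          (h.vnorm_xbarMat_mulVec_le z) (vnorm_nonneg _) (by positivity)) (by positivity)
    _ = 4 * K ^ 4 * (c * (√q * √q)) * (vnorm x * vnorm z) := by ring
    _ = _ := by rw [Real.mul_self_sqrt (by positivity)]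

theorem abs_scatter_ybar_le (h : D.Regular K) (hl : 0 < l) (ht : 0 < τ) {v : Fin q → ℝ} {c : ℝ}
    (hc : 0 ≤ c) (hv : ∀ i, |v i| ≤ c) (x : Fin D.p → ℝ) :
    |∑ i, v i * (((D.xbarMat *ᵥ x) i - wmean (D.wt l τ) (D.xbarMat *ᵥ x)) *
        (D.ybar i - wmean (D.wt l τ) D.ybar))| ≤ 4 * K ^ 4 * (c * q) * vnorm x := by
  have hK := h.K_pos
  refine (h.abs_scatter_le hl ht hc hv _ _).trans ?_
  calc _ ≤ 4 * K ^ 2 * c * ((K * √q * vnorm x) * (K * √q)) := by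
        have := vnorm_nonneg x
        exact mul_le_mul_of_nonneg_left (mul_le_mul (h.vnorm_xbarMat_mulVec_le x)
          h.vnorm_ybar_le (vnorm_nonneg _) (by positivity)) (by positivity)
    _ = 4 * K ^ 4 * (c * (√q * √q)) * vnorm x := by ring
    _ = _ := by rw [Real.mul_self_sqrt (by positivity)]

theorem abs_wt_le (h : D.Regular K) (hl : 0 < l) (ht : 0 < τ) (i : Fin q) :
    |D.wt l τ i| ≤ K * D.rbar := by
  rw [abs_of_pos (wt_pos hl ht i), wt_eq hl ht]
  have h1 := shr_pos (D := D) hl ht i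
  have h2 := r_cast_pos (D := D) i
  exact (mul_le_of_le_one_right h2.le (by linarith)).trans (h.r_le i)

theorem gram_coercive (h : D.Regular K) (hl : 0 < l) (ht : 0 < τ) (x : Fin D.p → ℝ) :
    D.rbar * q / K * (x ⬝ᵥ x) ≤ x ⬝ᵥ D.gram l τ *ᵥ x := by
  rw [dotProduct_gram_mulVec h.q_pos hl ht, div_mul_eq_mul_div, div_le_iff₀ h.K_pos]
  have h1 := h.within_ge x
  have h2 : 0 ≤ wcov (D.wt l τ) (D.xbarMat *ᵥ x) (D.xbarMat *ᵥ x) :=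
    Finset.sum_nonneg fun i _ => mul_nonneg (wt_pos hl ht i).le (mul_self_nonneg _)
  have := h.K_pos
  nlinarith

theorem isUnit_gram (h : D.Regular K) (hl : 0 < l) (ht : 0 < τ) : IsUnit (D.gram l τ) :=
  isUnit_of_coercive (div_pos h.N_pos h.K_pos) (h.gram_coercive hl ht)

open scoped Matrix.Norms.L2Operator

theorem opNorm_gram_le (h : D.Regular K) (hl : 0 < l) (ht : 0 < τ) :
    ‖D.gram l τ‖ ≤ 5 * K ^ 5 * (D.rbar * q) := by
  have hK := h.K_pos
  have hN := h.N_pos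
  have hq := h.q_cast_pos
  have hr := h.rbar_pos
  refine opNorm_le_of_forall_dotProduct (by positivity) fun x z => ?_
  rw [dotProduct_gram_mulVec h.q_pos hl ht]
  have h1 := h.abs_within_le x z
  have h2 := h.abs_scatter_xbar_le hl ht (by positivity) (h.abs_wt_le hl ht) x z
  refine (abs_add_le _ _).trans ((add_le_add h1 h2).trans ?_)
  have h3 : K ≤ K ^ 5 := le_self_pow₀ h.one_le (by norm_num)
  have h4 : 0 ≤ vnorm x * vnorm z := mul_nonneg (vnorm_nonneg x) (vnorm_nonneg z)
  calc _ = (K + 4 * K ^ 5) * (D.rbar * q) * (vnorm x * vnorm z) := by ring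
    _ ≤ (K ^ 5 + 4 * K ^ 5) * (D.rbar * q) * (vnorm x * vnorm z) := by gcongr
    _ = _ := by ring

theorem vnorm_cross_le (h : D.Regular K) (hl : 0 < l) (ht : 0 < τ) :
    vnorm (D.cross l τ) ≤ 5 * K ^ 5 * (D.rbar * q) := by
  have hK := h.K_pos
  have hN := h.N_pos
  have hq := h.q_cast_pos
  have hr := h.rbar_pos
  refine vnorm_le_of_forall_dotProduct (by positivity) fun x => ?_
  rw [dotProduct_cross h.q_pos hl ht]
  have h1 := h.abs_withinY_le x
  have h2 := h.abs_scatter_ybar_le hl ht (by positivity) (h.abs_wt_le hl ht) x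
  refine (abs_add_le _ _).trans ((add_le_add h1 h2).trans ?_)
  have h3 : K ≤ K ^ 5 := le_self_pow₀ h.one_le (by norm_num)
  have h4 : 0 ≤ vnorm x := vnorm_nonneg x
  calc _ = (K + 4 * K ^ 5) * (D.rbar * q) * vnorm x := by ring
    _ ≤ (K ^ 5 + 4 * K ^ 5) * (D.rbar * q) * vnorm x := by gcongr
    _ = _ := by ring

theorem opNorm_Q_le (h : D.Regular K) (hl : 0 < l) (ht : 0 < τ) :
    ‖D.Q l τ‖ ≤ K / (D.rbar * q) := by
  have := opNorm_inv_le_of_coercive (div_pos h.N_pos h.K_pos) (h.gram_coercive hl ht)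
  rwa [inv_div] at this

theorem vnorm_Q_mulVec_cross_le (h : D.Regular K) (hl : 0 < l) (ht : 0 < τ) :
    vnorm (D.Q l τ *ᵥ D.cross l τ) ≤ 5 * K ^ 6 := by
  have hN := h.N_pos
  have hq := h.q_cast_pos
  have hr := h.rbar_pos
  have hK := h.K_pos
  calc _ ≤ ‖D.Q l τ‖ * vnorm (D.cross l τ) := vnorm_mulVec_le _ _
    _ ≤ K / (D.rbar * q) * (5 * K ^ 5 * (D.rbar * q)) :=
        mul_le_mul (h.opNorm_Q_le hl ht) (h.vnorm_cross_le hl ht) (vnorm_nonneg _) (by positivity)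
    _ = _ := by field_simp

theorem isHermitian_gram (h : D.Regular K) (hl : 0 < l) (ht : 0 < τ) :
    (D.gram l τ).IsHermitian := by
  ext k m
  rw [conjTranspose_apply, star_trivial, gram_apply h.q_pos hl ht, gram_apply h.q_pos hl ht,
    wcov, wcov]
  congr 1
  · simp only [within, Matrix.sub_apply, mul_apply, transpose_apply, mul_comm]
  · exact Finset.sum_congr rfl fun i _ => by ring

theorem posSemidef_Q (h : D.Regular K) (hl : 0 < l) (ht : 0 < τ) : (D.Q l τ).PosSemidef := by
  refine PosSemidef.inv (PosSemidef.of_dotProduct_mulVec_nonneg (h.isHermitian_gram hl ht) ?_)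
  intro x
  refine le_trans ?_ (h.gram_coercive hl ht x)
  rw [← vnorm_sq']
  have := h.N_pos
  have := h.K_pos
  positivity

theorem vnorm_sqrt_mulVec_le (h : D.Regular K) (hl : 0 < l) (ht : 0 < τ) (x : Fin D.p → ℝ) :
    vnorm (psdSqrt (D.Q l τ) *ᵥ x) ≤ K / √(D.rbar * q) * vnorm x := by
  have hN := h.N_pos
  have hq := h.q_cast_pos
  have hr := h.rbar_pos
  have hK := h.K_pos
  have hx := vnorm_nonneg x
  have hR := psdSqrt_posSemidef (D.Q l τ)
  refine vnorm_le_of_sq_le (by positivity) ?_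
  rw [← vnorm_sq, vnorm_sq', ← hR.1.dotProduct_mulVec_comm, mulVec_mulVec,
    psdSqrt_mul_self (h.posSemidef_Q hl ht)]
  refine (le_abs_self _).trans ((abs_dotProduct_le _ _).trans ?_)
  calc vnorm x * vnorm (D.Q l τ *ᵥ x) ≤ vnorm x * (K / (D.rbar * q) * vnorm x) := by
        have := (vnorm_mulVec_le (D.Q l τ) x).trans
          (mul_le_mul_of_nonneg_right (h.opNorm_Q_le hl ht) hx)
        gcongr
    _ ≤ vnorm x * (K ^ 2 / (D.rbar * q) * vnorm x) := by
        have : K ≤ K ^ 2 := le_self_pow₀ h.one_le (by norm_num)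
        gcongr
    _ = _ := by rw [mul_pow, div_pow, Real.sq_sqrt hN.le]; ring

/-- With N = r̄q, the Gram matrix is coercive with constant N/K and has norm at most 5K⁵N. Hence Q ≥
(N/K)/(5K⁵N)² = 1/(25K¹¹N), which dominates the square of the stated constant. -/
theorem sqrt_coercive (h : D.Regular K) (hl : 0 < l) (ht : 0 < τ) (x : Fin D.p → ℝ) :
    (5 * K ^ 6 * √(D.rbar * q))⁻¹ * (x ⬝ᵥ x) ≤ x ⬝ᵥ psdSqrt (D.Q l τ) *ᵥ x := by
  have hN := h.N_pos
  have hq := h.q_cast_pos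
  have hr := h.rbar_pos
  have hK := h.K_pos
  refine (psdSqrt_posSemidef _).mul_dotProduct_le_of_sq (by positivity) (fun x => ?_) x
  rw [psdSqrt_mul_self (h.posSemidef_Q hl ht)]
  refine le_trans ?_ (coercive_inv (div_pos hN hK) (by positivity) (h.gram_coercive hl ht)
    (h.opNorm_gram_le hl ht) x)
  rw [← vnorm_sq']
  refine mul_le_mul_of_nonneg_right ?_ (sq_nonneg _)
  have h1 : K ^ 11 ≤ K ^ 12 := pow_le_pow_right₀ h.one_le (by norm_num)
  rw [inv_pow, mul_pow, Real.sq_sqrt hN.le, div_div, inv_le_comm₀ (by positivity) (by positivity),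
    inv_div]
  calc K * (5 * K ^ 5 * (D.rbar * q)) ^ 2 / (D.rbar * q) = 25 * K ^ 11 * (D.rbar * q) := by
        field_simp; ring
    _ ≤ 25 * K ^ 12 * (D.rbar * q) := by gcongr
    _ = _ := by ring

end Regular

/-! ### Derivatives of Q, its root and the normal equations along a curve of precisions. -/

section Curves

variable {lam tau : ℝ → ℝ} {s α β κ : ℝ}

/-- The shrinkage factor is the logistic function of log(r_iτ/λ), whose derivative along the curve
is β - α. -/
theorem PrecisionCurve.hasDerivAt_shr (hc : PrecisionCurve lam tau s α β) (i : Fin q) :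
    HasDerivAt (fun u => D.shr (lam u) (tau u) i)
      (-(α - β) * (D.shr (lam s) (tau s) i * (1 - D.shr (lam s) (tau s) i))) s := by
  have ht := t_pos (D := D) (hc.lam_pos s) (hc.tau_pos s) i
  have h1 : HasDerivAt (fun u => D.r i * tau u) (D.r i * (β * tau s)) s :=
    hc.deriv_tau.const_mul _
  have h2 := h1.div (h1.add hc.deriv_lam) (by simpa [t] using ht.ne')
  refine h2.congr_deriv ?_
  rw [one_sub_shr (hc.lam_pos s) (hc.tau_pos s), shr]
  simp only [Pi.add_apply]
  rw [show D.t (lam s) (tau s) i = D.r i * tau s + lam s from rfl] at ht ⊢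
  field_simp
  ring

theorem PrecisionCurve.hasDerivAt_wt (hc : PrecisionCurve lam tau s α β) (i : Fin q) :
    HasDerivAt (fun u => D.wt (lam u) (tau u) i)
      (D.r i * ((α - β) * (D.shr (lam s) (tau s) i * (1 - D.shr (lam s) (tau s) i)))) s := by
  have h1 := ((hc.hasDerivAt_shr (D := D) i).const_sub 1).const_mul (D.r i : ℝ)
  refine (h1.congr_of_eventuallyEq (Eventually.of_forall fun u =>
    wt_eq (hc.lam_pos u) (hc.tau_pos u) i)).congr_deriv (by ring)

open scoped Matrix.Norms.L2Operator

/-- Here only the diagonal i = j of the bound by κ matters; the off-diagonal pairs serve to bound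
differences of shrinkage factors in `abs_shr_sub_le`. -/
theorem abs_deriv_wt_le (h : D.Regular K) (hc : PrecisionCurve lam tau s α β)
    (hκ : ∀ i j, D.shr (lam s) (tau s) i * (1 - D.shr (lam s) (tau s) j) ≤ κ) (i : Fin q) :
    |D.r i * ((α - β) * (D.shr (lam s) (tau s) i * (1 - D.shr (lam s) (tau s) i)))| ≤
      K * D.rbar * (|α - β| * κ) := by
  have h1 := shr_pos (D := D) (hc.lam_pos s) (hc.tau_pos s) i
  have h2 := one_sub_shr_pos (D := D) (hc.lam_pos s) (hc.tau_pos s) i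
  rw [abs_mul, abs_mul, abs_of_pos (mul_pos h1 h2), Nat.abs_cast]
  have := h.r_le i
  have := hκ i i
  have := h.K_pos
  have := h.rbar_pos
  gcongr

theorem exists_hasDerivAt_gram (h : D.Regular K) (hc : PrecisionCurve lam tau s α β)
    (hκ : ∀ i j, D.shr (lam s) (tau s) i * (1 - D.shr (lam s) (tau s) j) ≤ κ) (hκ0 : 0 ≤ κ) :
    ∃ G' : Matrix (Fin D.p) (Fin D.p) ℝ,
      HasDerivAt (fun u => D.gram (lam u) (tau u)) G' s ∧ G'.IsHermitian ∧
      ‖G'‖ ≤ 4 * K ^ 5 * (D.rbar * q) * (|α - β| * κ) := by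
  have hK := h.K_pos
  have hN := h.N_pos
  have hq := h.q_cast_pos
  have hr := h.rbar_pos
  refine ⟨Matrix.of fun k l => ∑ i, D.r i * ((α - β) * (D.shr (lam s) (tau s) i *
    (1 - D.shr (lam s) (tau s) i))) * ((D.xbar i k - wmean (D.wt (lam s) (tau s))
      (fun i => D.xbar i k)) * (D.xbar i l - wmean (D.wt (lam s) (tau s)) (fun i => D.xbar i l))),
    hasDerivAt_matrix fun k l => ?_, ?_, ?_⟩
  · have h1 := hasDerivAt_wcov (fun i => D.xbar i k) (fun i => D.xbar i l)
      (fun i => hc.hasDerivAt_wt (D := D) i)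
      (fun u => (sum_wt_pos h.q_pos (hc.lam_pos u) (hc.tau_pos u)).ne')
    exact (h1.const_add (D.within k l)).congr_of_eventuallyEq (Eventually.of_forall fun u =>
      gram_apply h.q_pos (hc.lam_pos u) (hc.tau_pos u) k l)
  · ext k l
    rw [conjTranspose_apply, star_trivial, of_apply, of_apply]
    exact Finset.sum_congr rfl fun i _ => by ring
  · refine opNorm_le_of_forall_dotProduct (by positivity) fun x z => ?_
    rw [dotProduct_scatterMat_mulVec]
    refine (h.abs_scatter_xbar_le (hc.lam_pos s) (hc.tau_pos s) (by positivity)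
      (abs_deriv_wt_le h hc hκ) x z).trans (le_of_eq (by ring))

theorem exists_hasDerivAt_cross (h : D.Regular K) (hc : PrecisionCurve lam tau s α β)
    (hκ : ∀ i j, D.shr (lam s) (tau s) i * (1 - D.shr (lam s) (tau s) j) ≤ κ) (hκ0 : 0 ≤ κ) :
    ∃ c' : Fin D.p → ℝ, (∀ k, HasDerivAt (fun u => D.cross (lam u) (tau u) k) (c' k) s) ∧
      vnorm c' ≤ 4 * K ^ 5 * (D.rbar * q) * (|α - β| * κ) := by
  have hK := h.K_pos
  have hN := h.N_pos
  have hq := h.q_cast_pos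
  have hr := h.rbar_pos
  refine ⟨fun k => ∑ i, D.r i * ((α - β) * (D.shr (lam s) (tau s) i *
    (1 - D.shr (lam s) (tau s) i))) * ((D.xbar i k - wmean (D.wt (lam s) (tau s))
      (fun i => D.xbar i k)) * (D.ybar i - wmean (D.wt (lam s) (tau s)) D.ybar)),
    fun k => ?_, ?_⟩
  · have h1 := hasDerivAt_wcov (fun i => D.xbar i k) D.ybar
      (fun i => hc.hasDerivAt_wt (D := D) i)
      (fun u => (sum_wt_pos h.q_pos (hc.lam_pos u) (hc.tau_pos u)).ne')
    exact (h1.const_add (D.withinY k)).congr_of_eventuallyEq (Eventually.of_forall fun u =>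
      cross_apply h.q_pos (hc.lam_pos u) (hc.tau_pos u) k)
  · refine vnorm_le_of_forall_dotProduct (by positivity) fun x => ?_
    rw [dotProduct_scatter]
    refine (h.abs_scatter_ybar_le (hc.lam_pos s) (hc.tau_pos s) (by positivity)
      (abs_deriv_wt_le h hc hκ) x).trans (le_of_eq (by ring))

theorem exists_hasDerivAt_Q (h : D.Regular K) (hc : PrecisionCurve lam tau s α β)
    (hκ : ∀ i j, D.shr (lam s) (tau s) i * (1 - D.shr (lam s) (tau s) j) ≤ κ) (hκ0 : 0 ≤ κ) :
    ∃ Q' : Matrix (Fin D.p) (Fin D.p) ℝ,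
      HasDerivAt (fun u => D.Q (lam u) (tau u)) Q' s ∧ Q'.IsHermitian ∧
      ‖Q'‖ ≤ 4 * K ^ 7 / (D.rbar * q) * (|α - β| * κ) := by
  have hK := h.K_pos
  have hN := h.N_pos
  have hq := h.q_cast_pos
  have hr := h.rbar_pos
  have hl := hc.lam_pos s
  have ht := hc.tau_pos s
  obtain ⟨G', hG, hGH, hGn⟩ := exists_hasDerivAt_gram h hc hκ hκ0
  refine ⟨-(D.Q (lam s) (tau s) * G' * D.Q (lam s) (tau s)),
    hasDerivAt_matrix_inv hG (h.isUnit_gram hl ht), ?_, ?_⟩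
  · have h1 : (D.Q (lam s) (tau s)).IsHermitian := (h.isHermitian_gram hl ht).inv
    refine IsHermitian.neg ?_
    rw [IsHermitian, conjTranspose_mul, conjTranspose_mul, h1.eq, hGH.eq, Matrix.mul_assoc]
  · rw [norm_neg]
    have h1 : ‖D.Q (lam s) (tau s)‖ ≤ K / (D.rbar * q) := h.opNorm_Q_le hl ht
    calc _ ≤ ‖D.Q (lam s) (tau s)‖ * ‖G'‖ * ‖D.Q (lam s) (tau s)‖ := norm_mul₃_le
      _ ≤ K / (D.rbar * q) * (4 * K ^ 5 * (D.rbar * q) * (|α - β| * κ)) * (K / (D.rbar * q)) := by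
          gcongr
      _ = _ := by field_simp

theorem exists_hasDerivAt_Q_mulVec_cross (h : D.Regular K) (hc : PrecisionCurve lam tau s α β)
    (hκ : ∀ i j, D.shr (lam s) (tau s) i * (1 - D.shr (lam s) (tau s) j) ≤ κ) (hκ0 : 0 ≤ κ) :
    ∃ b' : Fin D.p → ℝ,
      (∀ k, HasDerivAt (fun u => (D.Q (lam u) (tau u) *ᵥ D.cross (lam u) (tau u)) k) (b' k) s) ∧
      vnorm b' ≤ 24 * K ^ 12 * (|α - β| * κ) := by
  have hK := h.K_pos
  have hN := h.N_pos
  have hq := h.q_cast_pos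
  have hr := h.rbar_pos
  have hl := hc.lam_pos s
  have ht := hc.tau_pos s
  obtain ⟨Q', hQ, -, hQn⟩ := exists_hasDerivAt_Q h hc hκ hκ0
  obtain ⟨c', hc', hcn⟩ := exists_hasDerivAt_cross h hc hκ hκ0
  refine ⟨_, hQ.matrix_mulVec hc', ?_⟩
  have h1 : vnorm (Q' *ᵥ D.cross (lam s) (tau s)) ≤ 20 * K ^ 12 * (|α - β| * κ) := by
    calc _ ≤ ‖Q'‖ * vnorm (D.cross (lam s) (tau s)) := vnorm_mulVec_le _ _
      _ ≤ (4 * K ^ 7 / (D.rbar * q) * (|α - β| * κ)) * (5 * K ^ 5 * (D.rbar * q)) :=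
          mul_le_mul hQn (h.vnorm_cross_le hl ht) (vnorm_nonneg _) (by positivity)
      _ = _ := by field_simp; ring
  have h2 : vnorm (D.Q (lam s) (tau s) *ᵥ c') ≤ 4 * K ^ 6 * (|α - β| * κ) := by
    calc _ ≤ ‖D.Q (lam s) (tau s)‖ * vnorm c' := vnorm_mulVec_le _ _
      _ ≤ (K / (D.rbar * q)) * (4 * K ^ 5 * (D.rbar * q) * (|α - β| * κ)) :=
          mul_le_mul (h.opNorm_Q_le hl ht) hcn (vnorm_nonneg _) (by positivity)
      _ = _ := by field_simp
  have h3 : K ^ 6 ≤ K ^ 12 := pow_le_pow_right₀ h.one_le (by norm_num)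
  calc _ ≤ _ := vnorm_add_le _ _
    _ ≤ 20 * K ^ 12 * (|α - β| * κ) + 4 * K ^ 6 * (|α - β| * κ) := add_le_add h1 h2
    _ ≤ 20 * K ^ 12 * (|α - β| * κ) + 4 * K ^ 12 * (|α - β| * κ) := by gcongr
    _ = _ := by ring

theorem exists_hasDerivAt_sqrt_mulVec (h : D.Regular K) (hc : PrecisionCurve lam tau s α β)
    (hκ : ∀ i j, D.shr (lam s) (tau s) i * (1 - D.shr (lam s) (tau s) j) ≤ κ) (hκ0 : 0 ≤ κ)
    (x : Fin D.p → ℝ) :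
    ∃ z' : Fin D.p → ℝ,
      (∀ k, HasDerivAt (fun u => (psdSqrt (D.Q (lam u) (tau u)) *ᵥ x) k) (z' k) s) ∧
      vnorm z' ≤ 20 * K ^ 13 * (|α - β| * κ) * (vnorm x / √(D.rbar * q)) := by
  have hK := h.K_pos
  have hN := h.N_pos
  have hq := h.q_cast_pos
  have hr := h.rbar_pos
  have hl := hc.lam_pos s
  have ht := hc.tau_pos s
  obtain ⟨Q', hQ, hQH, hQn⟩ := exists_hasDerivAt_Q h hc hκ hκ0
  obtain ⟨R', hR, hRn⟩ := exists_hasDerivAt_sqrt (σ := (5 * K ^ 6 * √(D.rbar * q))⁻¹)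
    (R := fun u => psdSqrt (D.Q (lam u) (tau u))) (by positivity)
    (fun u => psdSqrt_posSemidef _)
    (fun u => psdSqrt_mul_self (h.posSemidef_Q (hc.lam_pos u) (hc.tau_pos u)))
    (h.sqrt_coercive hl ht) hQH hQ
  refine ⟨R' *ᵥ x, fun k => ?_, ?_⟩
  · have := hR.matrix_mulVec (c := fun _ => x) (c' := 0) (fun k => hasDerivAt_const _ _) k
    simpa using this
  · have h1 : ‖R'‖ ≤ 20 * K ^ 13 * (|α - β| * κ) / √(D.rbar * q) := by
      have h2 := hRn.trans hQn
      rw [inv_mul_le_iff₀ (by positivity)] at h2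
      refine h2.trans (le_of_eq ?_)
      have h3 : D.rbar * q = √(D.rbar * q) * √(D.rbar * q) := (Real.mul_self_sqrt hN.le).symm
      have h4 : 0 < √(D.rbar * q) := by positivity
      generalize √(D.rbar * q) = y at h3 h4 ⊢
      rw [h3]
      field_simp
      ring
    calc _ ≤ ‖R'‖ * vnorm x := vnorm_mulVec_le _ _
      _ ≤ 20 * K ^ 13 * (|α - β| * κ) / √(D.rbar * q) * vnorm x :=
          mul_le_mul_of_nonneg_right h1 (vnorm_nonneg x)
      _ = _ := by ring

end Curves

end MixedData

/-! ### The next state in rescaled coordinates, and the derivative of its regression coefficients.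
-/

namespace MixedData

variable {q : ℕ}

/-- The new value of `η₀₀ / √q`, given the precisions. -/
noncomputable def coef (D : MixedData q) (x : Fin D.p → ℝ) (l τ : ℝ) : Fin D.p → ℝ :=
  D.Q l τ *ᵥ D.cross l τ + (√τ)⁻¹ • (psdSqrt (D.Q l τ) *ᵥ x)

/-- The group mean residuals for the coefficients `coef`. -/
noncomputable def res (D : MixedData q) (x : Fin D.p → ℝ) (l τ : ℝ) (i : Fin q) : ℝ :=
  D.ybar i - (D.xbarMat *ᵥ D.coef x l τ) i

/-- The new value of `η₀ / √q`, given the precisions. -/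
noncomputable def center (D : MixedData q) (x : Fin D.p → ℝ) (n0 l τ : ℝ) : ℝ :=
  wmean (D.wt l τ) (D.res x l τ) + (√(τ * ∑ i, D.wt l τ i))⁻¹ * n0

variable {D : MixedData q} {K : ℝ} {l τ : ℝ}

theorem next00_eq (n00 : EuclideanSpace ℝ (Fin D.p)) :
    D.next00 n00 l τ = √(q : ℝ) • D.coef (fun k => n00 k) l τ := by
  rw [next00, coef, smul_add, smul_smul, Real.sqrt_div (by positivity), div_eq_mul_inv]
  rfl

theorem resid_sqrt_smul (hq : 0 < q) (x : Fin D.p → ℝ) (i : Fin q) :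
    D.resid (√(q : ℝ) • x) i = D.ybar i - (D.xbarMat *ᵥ x) i := by
  have : 0 < √(q : ℝ) := Real.sqrt_pos.2 (Nat.cast_pos.2 hq)
  rw [resid]
  congr 1
  simp only [Pi.smul_apply, smul_eq_mul, mulVec, dotProduct, xbarMat, Matrix.of_apply,
    Finset.sum_div]
  exact Finset.sum_congr rfl fun k _ => by field_simp

theorem one_div_z (i : Fin q) : 1 / D.z l τ i = τ * D.wt l τ i := by
  rw [z, wt, one_div_div]; ring

theorem next0_eq (hq : 0 < q) (hl : 0 < l) (ht : 0 < τ) (x : Fin D.p → ℝ) (n0 : ℝ) :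
    D.next0 n0 l τ (√(q : ℝ) • D.coef x l τ) = √(q : ℝ) * D.center x n0 l τ := by
  have hW := sum_wt_pos (D := D) hq hl ht
  have h1 : ∑ i, 1 / D.z l τ i = τ * ∑ i, D.wt l τ i := by
    rw [Finset.mul_sum]; exact Finset.sum_congr rfl fun i _ => one_div_z i
  have h2 : ∑ i, D.resid (√(q : ℝ) • D.coef x l τ) i / D.z l τ i =
      τ * ∑ i, D.wt l τ i * D.res x l τ i := by
    rw [Finset.mul_sum]
    refine Finset.sum_congr rfl fun i _ => ?_
    rw [resid_sqrt_smul hq, div_eq_mul_one_div, one_div_z, res]; ring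
  rw [next0, h1, h2, center, wmean, mul_div_mul_left _ _ ht.ne', Real.sqrt_div (by positivity)]
  ring

theorem nextGroup_eq (hq : 0 < q) (hl : 0 < l) (ht : 0 < τ) (x : Fin D.p → ℝ) (ni e : ℝ)
    (i : Fin q) :
    D.nextGroup ni l τ (√(q : ℝ) • D.coef x l τ) (√(q : ℝ) * e) i =
      (1 - D.shr l τ i) * e + D.shr l τ i * D.res x l τ i + (√(D.t l τ i))⁻¹ * ni := by
  have : 0 < √(q : ℝ) := Real.sqrt_pos.2 (Nat.cast_pos.2 hq)
  rw [nextGroup, resid_sqrt_smul hq, one_sub_shr hl ht, mul_div_cancel_left₀ _ this.ne',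
    one_div, Real.sqrt_inv]
  rfl

theorem next_eq (hq : 0 < q) (hl : 0 < l) (ht : 0 < τ) (n00 : EuclideanSpace ℝ (Fin D.p))
    (n : Fin (q + 1) → ℝ) :
    D.next n00 n l τ = WithLp.toLp 2 (Sum.elim (√(q : ℝ) • D.coef (fun k => n00 k) l τ)
      (Fin.cons (√(q : ℝ) * D.center (fun k => n00 k) (n 0) l τ) fun i =>
        (1 - D.shr l τ i) * D.center (fun k => n00 k) (n 0) l τ +
          D.shr l τ i * D.res (fun k => n00 k) l τ i + (√(D.t l τ i))⁻¹ * n i.succ)) := by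
  rw [next]
  simp only [next00_eq, next0_eq hq hl ht, nextGroup_eq hq hl ht]

namespace Regular

theorem vnorm_coef_le (h : D.Regular K) (hl : 0 < l) (ht : 0 < τ) (x : Fin D.p → ℝ) :
    vnorm (D.coef x l τ) ≤ 5 * K ^ 6 * (1 + vnorm x / (√τ * √(D.rbar * q))) := by
  have hN := h.N_pos
  have hK := h.K_pos
  have hx := vnorm_nonneg x
  have h1 := h.vnorm_Q_mulVec_cross_le hl ht
  have h2 : vnorm ((√τ)⁻¹ • (psdSqrt (D.Q l τ) *ᵥ x)) ≤
      K * (vnorm x / (√τ * √(D.rbar * q))) := by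
    rw [vnorm_smul, abs_of_nonneg (by positivity)]
    calc _ ≤ (√τ)⁻¹ * (K / √(D.rbar * q) * vnorm x) :=
          mul_le_mul_of_nonneg_left (h.vnorm_sqrt_mulVec_le hl ht x) (by positivity)
      _ = _ := by field_simp
  have h3 : K ≤ K ^ 6 := le_self_pow₀ h.one_le (by norm_num)
  have h4 : 0 ≤ vnorm x / (√τ * √(D.rbar * q)) := by positivity
  calc _ ≤ _ := vnorm_add_le _ _
    _ ≤ 5 * K ^ 6 + K * (vnorm x / (√τ * √(D.rbar * q))) := add_le_add h1 h2
    _ ≤ 5 * K ^ 6 + 5 * K ^ 6 * (vnorm x / (√τ * √(D.rbar * q))) := by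
        gcongr
        linarith [pow_pos hK 6]
    _ = _ := by ring

theorem vnorm_res_le (h : D.Regular K) (hl : 0 < l) (ht : 0 < τ) (x : Fin D.p → ℝ) :
    vnorm (D.res x l τ) ≤ 6 * K ^ 7 * √q * (1 + vnorm x / (√τ * √(D.rbar * q))) := by
  have hN := h.N_pos
  have hK := h.K_pos
  have hx := vnorm_nonneg x
  have h1 := h.vnorm_ybar_le
  have h2 := (h.vnorm_xbarMat_mulVec_le (D.coef x l τ)).trans
    (mul_le_mul_of_nonneg_left (h.vnorm_coef_le hl ht x) (by positivity))
  have h3 : K ≤ K ^ 7 := le_self_pow₀ h.one_le (by norm_num)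
  have h4 : 0 ≤ vnorm x / (√τ * √(D.rbar * q)) := by positivity
  have h5 : K * √q ≤ K ^ 7 * √q * (1 + vnorm x / (√τ * √(D.rbar * q))) := by
    calc K * √q ≤ K ^ 7 * √q := by gcongr
      _ ≤ _ := le_mul_of_one_le_right (by positivity) (by linarith)
  calc _ ≤ _ := vnorm_sub_le D.ybar (D.xbarMat *ᵥ D.coef x l τ)
    _ ≤ K ^ 7 * √q * (1 + vnorm x / (√τ * √(D.rbar * q))) +
        K * √q * (5 * K ^ 6 * (1 + vnorm x / (√τ * √(D.rbar * q)))) :=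
        add_le_add (h1.trans h5) h2
    _ = _ := by ring

theorem abs_wmean_le (h : D.Regular K) (hl : 0 < l) (ht : 0 < τ) (a : Fin q → ℝ) :
    |wmean (D.wt l τ) a| ≤ K * vnorm a / √q := by
  have hK := h.K_pos
  have hq := h.q_cast_pos
  have h1 := card_mul_wmean_sq_le (fun i => (wt_pos hl ht i).le) (sum_wt_pos h.q_pos hl ht)
    (h.card_mul_wt_le hl ht) a
  rw [← vnorm_sq, Fintype.card_fin] at h1
  rw [le_div_iff₀ (by positivity)]
  refine (pow_le_pow_iff_left₀ (by positivity)
    (mul_nonneg hK.le (vnorm_nonneg a)) two_ne_zero).1 ?_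
  rw [mul_pow, mul_pow, sq_abs, Real.sq_sqrt hq.le]
  linarith

theorem vnorm_sub_wmean_le (h : D.Regular K) (hl : 0 < l) (ht : 0 < τ) (a : Fin q → ℝ) :
    vnorm (fun i => a i - wmean (D.wt l τ) a) ≤ 2 * K * vnorm a := by
  have hK := h.K_pos
  refine vnorm_le_of_sq_le (mul_nonneg (by positivity) (vnorm_nonneg a)) ?_
  refine (sum_sub_wmean_sq_le (one_le_pow₀ h.one_le) (fun i => (wt_pos hl ht i).le)
    (sum_wt_pos h.q_pos hl ht) (h.card_mul_wt_le hl ht) a).trans (le_of_eq ?_)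
  rw [mul_pow, vnorm_sq]; ring

theorem inv_sqrt_r_mul_le (h : D.Regular K) (ht : 0 < τ) (i : Fin q) :
    (√(D.r i * τ))⁻¹ ≤ K * (√(D.rbar * τ))⁻¹ := by
  have hK := h.K_pos
  have hr := h.rbar_pos
  have hi := r_cast_pos (D := D) i
  rw [← div_eq_mul_inv, le_div_iff₀ (by positivity), inv_mul_le_iff₀ (by positivity)]
  have h1 : √(D.rbar * τ) ≤ √(K * (D.r i * τ)) := by
    apply Real.sqrt_le_sqrt
    rw [← mul_assoc]
    exact mul_le_mul_of_nonneg_right (h.rbar_le i) ht.le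
  have h2 : √K ≤ K := by
    rw [Real.sqrt_le_left hK.le]
    exact le_self_pow₀ h.one_le (by norm_num)
  rw [Real.sqrt_mul hK.le] at h1
  calc _ ≤ √K * √(D.r i * τ) := h1
    _ ≤ K * √(D.r i * τ) := by gcongr
    _ = _ := by ring

/-- The scale of the noise in the new `η₀`, against the shrinkage factors of a group. -/
theorem inv_sqrt_sum_wt_mul_shr_le (h : D.Regular K) (hl : 0 < l) (ht : 0 < τ) (i : Fin q) :
    (√(τ * ∑ j, D.wt l τ j))⁻¹ * D.shr l τ i ≤ K ^ 2 / √q * (√l)⁻¹ ∧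
    (√(τ * ∑ j, D.wt l τ j))⁻¹ * (1 - D.shr l τ i) ≤ K ^ 2 / √q * (√(D.rbar * τ))⁻¹ := by
  have hK := h.K_pos
  have hq := h.q_cast_pos
  have hr := h.rbar_pos
  have hi := r_cast_pos (D := D) i
  have hd := shr_pos (D := D) hl ht i
  have hd' := one_sub_shr_pos (D := D) hl ht i
  have hw := wt_pos (D := D) hl ht i
  have hW := sum_wt_pos (D := D) h.q_pos hl ht
  have htt := t_pos (D := D) hl ht i
  have h1 : (√(τ * ∑ j, D.wt l τ j))⁻¹ ≤ K / √q * (√(τ * D.wt l τ i))⁻¹ := by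
    rw [← div_eq_mul_inv, div_div, inv_le_comm₀ (by positivity) (by positivity), inv_div,
      div_le_iff₀ hK, ← Real.sqrt_mul hq.le]
    have := h.card_mul_wt_le hl ht i
    rw [Fintype.card_fin] at this
    have h2 : √(q * (τ * D.wt l τ i)) ≤ √(K ^ 2 * (τ * ∑ j, D.wt l τ j)) := by
      apply Real.sqrt_le_sqrt
      calc _ = τ * (q * D.wt l τ i) := by ring
        _ ≤ τ * (K ^ 2 * ∑ j, D.wt l τ j) := by gcongr
        _ = _ := by ring
    rw [Real.sqrt_mul (sq_nonneg K), Real.sqrt_sq hK.le] at h2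
    linarith
  -- Two factorizations of the same quantity. Each exposes the shrinkage factor that is to be
  -- absorbed, since d/√(cd) = √(d/c) ≤ 1/√c for d ≤ 1.
  have e1 : τ * D.wt l τ i = l * D.shr l τ i := by rw [wt, shr]; ring
  have e2 : τ * D.wt l τ i = D.r i * τ * (1 - D.shr l τ i) := by rw [wt_eq hl ht]; ring
  have e3 : ∀ {c d : ℝ}, 0 < c → 0 < d → d ≤ 1 → (√(c * d))⁻¹ * d ≤ (√c)⁻¹ := by
    intro c d hc hd hd1
    rw [Real.sqrt_mul hc.le, mul_inv, mul_assoc]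
    refine mul_le_of_le_one_right (by positivity) ?_
    rw [inv_mul_le_iff₀ (by positivity), mul_one]
    exact Real.le_sqrt_of_sq_le (by nlinarith)
  have hKK : K ≤ K ^ 2 := le_self_pow₀ h.one_le (by norm_num)
  constructor
  · calc _ ≤ K / √q * (√(τ * D.wt l τ i))⁻¹ * D.shr l τ i := by gcongr
      _ = K / √q * ((√(l * D.shr l τ i))⁻¹ * D.shr l τ i) := by rw [e1]; ring
      _ ≤ K ^ 2 / √q * (√l)⁻¹ := by
          have := e3 hl hd (by linarith)
          gcongr
  · calc _ ≤ K / √q * (√(τ * D.wt l τ i))⁻¹ * (1 - D.shr l τ i) := by gcongr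
      _ = K / √q * ((√(D.r i * τ * (1 - D.shr l τ i)))⁻¹ * (1 - D.shr l τ i)) := by rw [e2]; ring
      _ ≤ K / √q * (K * (√(D.rbar * τ))⁻¹) := by
          have := (e3 (by positivity) hd' (by linarith)).trans (h.inv_sqrt_r_mul_le ht i)
          gcongr
      _ = _ := by ring

end Regular

section Curves

variable {lam tau : ℝ → ℝ} {s α β κ : ℝ}

theorem hasDerivAt_inv_sqrt {g : ℝ → ℝ} {g' s : ℝ} (hg : HasDerivAt g g' s) (h : 0 < g s) :
    HasDerivAt (fun u => (√(g u))⁻¹) (-(1 / 2) * (√(g s))⁻¹ * (g' / g s)) s := by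
  refine ((hg.sqrt h.ne').inv (Real.sqrt_pos.2 h).ne').congr_deriv ?_
  have h1 : g s = √(g s) * √(g s) := (Real.mul_self_sqrt h.le).symm
  have h2 := Real.sqrt_pos.2 h
  generalize √(g s) = y at *
  rw [h1]
  field_simp

theorem exists_hasDerivAt_coef (h : D.Regular K) (hc : PrecisionCurve lam tau s α β)
    (hκ : ∀ i j, D.shr (lam s) (tau s) i * (1 - D.shr (lam s) (tau s) j) ≤ κ) (hκ0 : 0 ≤ κ)
    (x : Fin D.p → ℝ) :
    ∃ c' : Fin D.p → ℝ, (∀ k, HasDerivAt (fun u => D.coef x (lam u) (tau u) k) (c' k) s) ∧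
      vnorm c' ≤ 24 * K ^ 13 * (|α - β| * κ * (1 + vnorm x / (√(tau s) * √(D.rbar * q))) +
        |β| * (vnorm x / (√(tau s) * √(D.rbar * q)))) := by
  have hK := h.K_pos
  have hN := h.N_pos
  have hl := hc.lam_pos s
  have ht := hc.tau_pos s
  have hx := vnorm_nonneg x
  obtain ⟨b', hb, hbn⟩ := exists_hasDerivAt_Q_mulVec_cross h hc hκ hκ0
  obtain ⟨z', hz, hzn⟩ := exists_hasDerivAt_sqrt_mulVec h hc hκ hκ0 x
  have hτ := hasDerivAt_inv_sqrt hc.deriv_tau ht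
  rw [mul_div_cancel_right₀ _ ht.ne'] at hτ
  refine ⟨b' + ((-(1 / 2) * (√(tau s))⁻¹ * β) • (psdSqrt (D.Q (lam s) (tau s)) *ᵥ x) +
    (√(tau s))⁻¹ • z'), fun k => (hb k).add (hτ.mul (hz k)), ?_⟩
  set g := vnorm x / (√(tau s) * √(D.rbar * q)) with hg
  have hg0 : 0 ≤ g := by positivity
  have h1 : vnorm ((-(1 / 2) * (√(tau s))⁻¹ * β) • (psdSqrt (D.Q (lam s) (tau s)) *ᵥ x)) ≤
      K * (|β| * g) := by
    rw [vnorm_smul, abs_mul, abs_mul, abs_inv, abs_of_nonneg (Real.sqrt_nonneg _)]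
    have e : |(-(1 / 2) : ℝ)| = 1 / 2 := by norm_num
    rw [e]
    calc _ ≤ 1 / 2 * (√(tau s))⁻¹ * |β| * (K / √(D.rbar * q) * vnorm x) :=
          mul_le_mul_of_nonneg_left (h.vnorm_sqrt_mulVec_le hl ht x) (by positivity)
      _ = 1 / 2 * (K * (|β| * g)) := by rw [hg]; field_simp
      _ ≤ K * (|β| * g) := by
          have : 0 ≤ K * (|β| * g) := by positivity
          linarith
  have h2 : vnorm ((√(tau s))⁻¹ • z') ≤ 20 * K ^ 13 * (|α - β| * κ) * g := by
    rw [vnorm_smul, abs_inv, abs_of_nonneg (Real.sqrt_nonneg _)]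
    calc _ ≤ (√(tau s))⁻¹ * (20 * K ^ 13 * (|α - β| * κ) * (vnorm x / √(D.rbar * q))) :=
          mul_le_mul_of_nonneg_left hzn (by positivity)
      _ = _ := by rw [hg]; field_simp
  have hK1 : K ≤ K ^ 13 := le_self_pow₀ h.one_le (by norm_num)
  have hK2 : K ^ 12 ≤ K ^ 13 := pow_le_pow_right₀ h.one_le (by norm_num)
  have hp := pow_pos hK 13
  calc _ ≤ vnorm b' + (vnorm ((-(1 / 2) * (√(tau s))⁻¹ * β) •
          (psdSqrt (D.Q (lam s) (tau s)) *ᵥ x)) + vnorm ((√(tau s))⁻¹ • z')) :=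
        (vnorm_add_le _ _).trans (by gcongr; exact vnorm_add_le _ _)
    _ ≤ 24 * K ^ 12 * (|α - β| * κ) + (K * (|β| * g) + 20 * K ^ 13 * (|α - β| * κ) * g) := by
        gcongr
    _ ≤ 24 * K ^ 13 * (|α - β| * κ) + (24 * K ^ 13 * (|β| * g) +
          24 * K ^ 13 * (|α - β| * κ) * g) := by
        gcongr
        · linarith
        · norm_num
    _ = _ := by ring

end Curves

end MixedData

theorem abs_wmean_le_of_forall {ι : Type*} [Fintype ι] {w a : ι → ℝ} {c : ℝ}
    (hw : ∀ i, 0 ≤ w i) (hW : 0 < ∑ i, w i) (h : ∀ i, |a i| ≤ c) : |wmean w a| ≤ c := by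
  rw [wmean, abs_div, abs_of_pos hW, div_le_iff₀ hW, Finset.mul_sum]
  refine (Finset.abs_sum_le_sum_abs _ _).trans (Finset.sum_le_sum fun i _ => ?_)
  rw [abs_mul, abs_of_nonneg (hw i), mul_comm]
  exact mul_le_mul_of_nonneg_right (h i) (hw i)

theorem norm_toLp_sum_elim_cons_le {p q : ℕ} (a : Fin p → ℝ) (b : ℝ) (c : Fin q → ℝ) :
    ‖(WithLp.toLp 2 (Sum.elim a (Fin.cons b c : Fin (q + 1) → ℝ)) :
      EuclideanSpace ℝ (Fin p ⊕ Fin (q + 1)))‖ ≤ vnorm a + |b| + vnorm c := by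
  have ha := vnorm_nonneg a
  have hc := vnorm_nonneg c
  refine vnorm_le_of_sq_le (by positivity) ?_
  rw [Fintype.sum_sum_type]
  simp only [Sum.elim_inl, Sum.elim_inr, Fin.sum_univ_succ, Fin.cons_zero, Fin.cons_succ]
  rw [← vnorm_sq, ← vnorm_sq, ← sq_abs b]
  nlinarith [mul_nonneg ha hc, mul_nonneg ha (abs_nonneg b), mul_nonneg (abs_nonneg b) hc]

theorem hasDerivAt_toLp {ι : Type*} [Fintype ι] {g : ℝ → ι → ℝ} {g' : ι → ℝ} {s : ℝ}
    (h : ∀ i, HasDerivAt (fun u => g u i) (g' i) s) :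
    HasDerivAt (fun u => (WithLp.toLp 2 (g u) : EuclideanSpace ℝ ι)) (WithLp.toLp 2 g') s :=
  (EuclideanSpace.equiv ι ℝ).symm.hasFDerivAt.comp_hasDerivAt s (hasDerivAt_pi.2 h)

/-! ### Derivatives of the new centre, of the new group effects and of the whole next state. -/

namespace MixedData

variable {q : ℕ} {D : MixedData q} {K : ℝ} {lam tau : ℝ → ℝ} {s α β κ : ℝ}

/-- The difference equals d_i(1 - d_j) - d_j(1 - d_i), a difference of two numbers between 0 and κ.
-/
theorem abs_shr_sub_le {l τ : ℝ} (hl : 0 < l) (ht : 0 < τ)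
    (hκ : ∀ i j, D.shr l τ i * (1 - D.shr l τ j) ≤ κ) (i j : Fin q) :
    |D.shr l τ i - D.shr l τ j| ≤ κ := by
  have h1 := shr_pos (D := D) hl ht i
  have h2 := shr_pos (D := D) hl ht j
  have h3 := one_sub_shr_pos (D := D) hl ht i
  have h4 := one_sub_shr_pos (D := D) hl ht j
  have h5 := hκ i j
  have h6 := hκ j i
  rw [abs_le]
  constructor
  · nlinarith [mul_pos h1 h4]
  · nlinarith [mul_pos h2 h3]

theorem hasDerivAt_res {x c' : Fin D.p → ℝ}
    (hc' : ∀ k, HasDerivAt (fun u => D.coef x (lam u) (tau u) k) (c' k) s) (i : Fin q) :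
    HasDerivAt (fun u => D.res x (lam u) (tau u) i) (-(D.xbarMat *ᵥ c') i) s := by
  have : HasDerivAt (fun u => ∑ k, D.xbarMat i k * D.coef x (lam u) (tau u) k)
      (∑ k, D.xbarMat i k * c' k) s := HasDerivAt.fun_sum fun k _ => (hc' k).const_mul _
  exact this.const_sub (D.ybar i)

/-- The weights satisfy w_i' = (α - β)d_i w_i, and d_i itself need not be small. As the weighted
deviations sum to zero, d_i may be replaced by its difference from the factor of one fixed group,
which is at most κ. -/
theorem abs_deriv_wmean_le (h : D.Regular K) (hc : PrecisionCurve lam tau s α β)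
    (hκ : ∀ i j, D.shr (lam s) (tau s) i * (1 - D.shr (lam s) (tau s) j) ≤ κ) (a : Fin q → ℝ) :
    |(∑ i, D.r i * ((α - β) * (D.shr (lam s) (tau s) i * (1 - D.shr (lam s) (tau s) i))) *
      (a i - wmean (D.wt (lam s) (tau s)) a)) / ∑ i, D.wt (lam s) (tau s) i| ≤
      2 * K ^ 2 * (|α - β| * κ) * (vnorm a / √q) := by
  have hK := h.K_pos
  have hl := hc.lam_pos s
  have ht := hc.tau_pos s
  have hW := sum_wt_pos (D := D) h.q_pos hl ht
  set w := D.wt (lam s) (tau s)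
  set d := D.shr (lam s) (tau s)
  let i₀ : Fin q := ⟨0, h.q_pos⟩
  have e : (∑ i, D.r i * ((α - β) * (d i * (1 - d i))) * (a i - wmean w a)) / ∑ i, w i =
      (α - β) * wmean w (fun i => (d i - d i₀) * (a i - wmean w a)) := by
    rw [show wmean w (fun i => (d i - d i₀) * (a i - wmean w a)) =
      (∑ i, w i * ((d i - d i₀) * (a i - wmean w a))) / ∑ i, w i from rfl, ← mul_div_assoc]
    congr 1
    have e1 : ∀ i, D.r i * ((α - β) * (d i * (1 - d i))) * (a i - wmean w a) =
        (α - β) * (w i * ((d i - d i₀) * (a i - wmean w a))) +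
          (α - β) * d i₀ * (w i * (a i - wmean w a)) := by
      intro i
      rw [show w i = D.r i * (1 - d i) from wt_eq hl ht i]; ring
    simp only [e1]
    rw [Finset.sum_add_distrib, ← Finset.mul_sum, ← Finset.mul_sum, sum_mul_sub_wmean a hW.ne',
      mul_zero, add_zero]
  rw [e, abs_mul]
  have h1 : vnorm (fun i => (d i - d i₀) * (a i - wmean w a)) ≤ κ * (2 * K * vnorm a) :=
    (vnorm_mul_le fun i => abs_shr_sub_le hl ht hκ i i₀).trans
      (mul_le_mul_of_nonneg_left (h.vnorm_sub_wmean_le hl ht a)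
        ((abs_nonneg _).trans (abs_shr_sub_le hl ht hκ i₀ i₀)))
  calc _ ≤ |α - β| * (K * (κ * (2 * K * vnorm a)) / √q) := by
        refine mul_le_mul_of_nonneg_left ((h.abs_wmean_le hl ht _).trans ?_) (abs_nonneg _)
        gcongr
    _ = _ := by ring

theorem abs_inv_sqrt_sum_wt_mul_le (h : D.Regular K) (hl : 0 < lam s) (ht : 0 < tau s)
    (i : Fin q) :
    |(√(tau s * ∑ j, D.wt (lam s) (tau s) j))⁻¹ * (α * D.shr (lam s) (tau s) i +
      β * (1 - D.shr (lam s) (tau s) i))| ≤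
      K ^ 2 / √q * (|α| * (√(lam s))⁻¹ + |β| * (√(D.rbar * tau s))⁻¹) := by
  obtain ⟨h1, h2⟩ := h.inv_sqrt_sum_wt_mul_shr_le hl ht i
  have hd := shr_pos (D := D) hl ht i
  have hd' := one_sub_shr_pos (D := D) hl ht i
  set S := (√(tau s * ∑ j, D.wt (lam s) (tau s) j))⁻¹
  have hS : 0 ≤ S := by positivity
  have e : S * (α * D.shr (lam s) (tau s) i + β * (1 - D.shr (lam s) (tau s) i)) =
      α * (S * D.shr (lam s) (tau s) i) + β * (S * (1 - D.shr (lam s) (tau s) i)) := by ring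
  rw [e]
  refine (abs_add_le _ _).trans ?_
  rw [abs_mul, abs_mul β, abs_of_nonneg (mul_nonneg hS hd.le),
    abs_of_nonneg (mul_nonneg hS hd'.le)]
  have h3 := mul_le_mul_of_nonneg_left h1 (abs_nonneg α)
  have h4 := mul_le_mul_of_nonneg_left h2 (abs_nonneg β)
  linarith

/-- The logarithmic derivative of τw_i is αd_i + β(1 - d_i), so that of the sum is the weighted mean
of these numbers. The prefactor is moved inside the mean, where each summand has a bound free of the
shrinkage factors. -/
theorem hasDerivAt_inv_sqrt_sum_wt (h : D.Regular K) (hc : PrecisionCurve lam tau s α β) :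
    ∃ S', HasDerivAt (fun u => (√(tau u * ∑ j, D.wt (lam u) (tau u) j))⁻¹) S' s ∧
      |S'| ≤ K ^ 2 / √q * (|α| * (√(lam s))⁻¹ + |β| * (√(D.rbar * tau s))⁻¹) := by
  have hl := hc.lam_pos s
  have ht := hc.tau_pos s
  have hW := sum_wt_pos (D := D) h.q_pos hl ht
  have h1 : HasDerivAt (fun u => ∑ j, D.wt (lam u) (tau u) j) _ s :=
    HasDerivAt.fun_sum fun j _ => hc.hasDerivAt_wt j
  have h2 := hasDerivAt_inv_sqrt (hc.deriv_tau.mul h1) (mul_pos ht hW)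
  refine ⟨_, h2, ?_⟩
  simp only [Pi.mul_apply]
  set w := D.wt (lam s) (tau s)
  set d := D.shr (lam s) (tau s)
  set S := (√(tau s * ∑ j, w j))⁻¹
  have e : (β * tau s * ∑ j, w j + tau s * ∑ i, D.r i * ((α - β) * (d i * (1 - d i)))) /
      (tau s * ∑ j, w j) = wmean w (fun i => α * d i + β * (1 - d i)) := by
    rw [wmean, mul_comm β, mul_assoc, ← mul_add, mul_div_mul_left _ _ ht.ne', Finset.mul_sum,
      ← Finset.sum_add_distrib]
    congr 1
    refine Finset.sum_congr rfl fun i _ => ?_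
    rw [show w i = D.r i * (1 - d i) from wt_eq hl ht i]; ring
  have e2 : S * wmean w (fun i => α * d i + β * (1 - d i)) =
      wmean w (fun i => S * (α * d i + β * (1 - d i))) := by
    rw [wmean, wmean, ← mul_div_assoc, Finset.mul_sum]
    congr 1
    exact Finset.sum_congr rfl fun i _ => by ring
  rw [e, mul_assoc, e2, abs_mul]
  have h3 := abs_wmean_le_of_forall (fun i => (wt_pos hl ht i).le) hW
    (fun i => abs_inv_sqrt_sum_wt_mul_le (α := α) (β := β) h hl ht i)
  refine le_trans ?_ h3
  have : |(-(1 / 2) : ℝ)| = 1 / 2 := by norm_num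
  rw [this]
  exact mul_le_of_le_one_left (abs_nonneg _) (by norm_num)

/-- The size of the relative change of the precisions, against that of the noise `x`. -/
noncomputable def drift (D : MixedData q) (x : Fin D.p → ℝ) (τ α β κ : ℝ) : ℝ :=
  |α - β| * κ * (1 + vnorm x / (√τ * √(D.rbar * q))) + |β| * (vnorm x / (√τ * √(D.rbar * q)))

theorem exists_hasDerivAt_center (h : D.Regular K) (hc : PrecisionCurve lam tau s α β)
    (hκ : ∀ i j, D.shr (lam s) (tau s) i * (1 - D.shr (lam s) (tau s) j) ≤ κ) (hκ0 : 0 ≤ κ)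
    {x c' : Fin D.p → ℝ} (n0 : ℝ)
    (hc' : ∀ k, HasDerivAt (fun u => D.coef x (lam u) (tau u) k) (c' k) s)
    (hcn : vnorm c' ≤ 24 * K ^ 13 * D.drift x (tau s) α β κ) :
    ∃ m', HasDerivAt (fun u => D.center x n0 (lam u) (tau u)) m' s ∧
      |m'| ≤ 36 * K ^ 15 * D.drift x (tau s) α β κ +
        K ^ 2 / √q * (|α| * (√(lam s))⁻¹ + |β| * (√(D.rbar * tau s))⁻¹) * |n0| := by
  have hK := h.K_pos
  have hN := h.N_pos
  have hl := hc.lam_pos s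
  have ht := hc.tau_pos s
  have hx := vnorm_nonneg x
  have hq : 0 < √(q : ℝ) := Real.sqrt_pos.2 h.q_cast_pos
  obtain ⟨S', hS, hSn⟩ := hasDerivAt_inv_sqrt_sum_wt h hc
  have h1 := hasDerivAt_wmean (fun i => hc.hasDerivAt_wt (D := D) i) (hasDerivAt_res hc')
    (sum_wt_pos h.q_pos hl ht).ne'
  refine ⟨_, h1.add (hS.mul_const n0), ?_⟩
  have h2 : |wmean (D.wt (lam s) (tau s)) fun i => -(D.xbarMat *ᵥ c') i| ≤
      24 * K ^ 15 * D.drift x (tau s) α β κ := by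
    refine (h.abs_wmean_le hl ht _).trans ?_
    rw [div_le_iff₀ hq]
    have e : vnorm (fun i => -(D.xbarMat *ᵥ c') i) = vnorm (D.xbarMat *ᵥ c') := by
      rw [vnorm_eq_sqrt, vnorm_eq_sqrt]; simp
    rw [e]
    calc _ ≤ K * (K * √q * (24 * K ^ 13 * D.drift x (tau s) α β κ)) := by
          have := (h.vnorm_xbarMat_mulVec_le c').trans
            (mul_le_mul_of_nonneg_left hcn (by positivity))
          gcongr
      _ = _ := by ring
  have h3 := (abs_deriv_wmean_le h hc hκ (D.res x (lam s) (tau s)))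
  have h4 : 2 * K ^ 2 * (|α - β| * κ) * (vnorm (D.res x (lam s) (tau s)) / √q) ≤
      12 * K ^ 15 * D.drift x (tau s) α β κ := by
    have h5 : vnorm (D.res x (lam s) (tau s)) / √q ≤
        6 * K ^ 7 * (1 + vnorm x / (√(tau s) * √(D.rbar * q))) := by
      rw [div_le_iff₀ hq]
      exact (h.vnorm_res_le hl ht x).trans (le_of_eq (by ring))
    have h6 : K ^ 9 ≤ K ^ 15 := pow_le_pow_right₀ h.one_le (by norm_num)
    calc _ ≤ 2 * K ^ 2 * (|α - β| * κ) *
          (6 * K ^ 7 * (1 + vnorm x / (√(tau s) * √(D.rbar * q)))) := by gcongr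
      _ = 12 * K ^ 9 * (|α - β| * κ * (1 + vnorm x / (√(tau s) * √(D.rbar * q)))) := by ring
      _ ≤ 12 * K ^ 15 * D.drift x (tau s) α β κ := by
          rw [drift]
          gcongr
          exact le_add_of_nonneg_right (by positivity)
  refine (abs_add_le _ _).trans (add_le_add ?_ ?_)
  · refine (abs_add_le _ _).trans ((add_le_add h2 (h3.trans h4)).trans (le_of_eq (by ring)))
  · rw [abs_mul]
    exact mul_le_mul_of_nonneg_right hSn (abs_nonneg _)

/-- Both t_i ≥ λ and t_i ≥ r_iτ are retained through the minimum: the first serves for arbitrary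
states, the second for states with small V. -/
theorem abs_inv_sqrt_t_mul_le (h : D.Regular K) (hl : 0 < lam s) (ht : 0 < tau s) (i : Fin q) :
    (√(D.t (lam s) (tau s) i))⁻¹ * |β * D.shr (lam s) (tau s) i +
        α * (1 - D.shr (lam s) (tau s) i)| ≤
      K * (|β| * (√(D.rbar * tau s))⁻¹ + |α| * min (√(lam s))⁻¹ (√(D.rbar * tau s))⁻¹) := by
  have hK := h.K_pos
  have hi := r_cast_pos (D := D) i
  have hd := shr_pos (D := D) hl ht i
  have hd' := one_sub_shr_pos (D := D) hl ht i
  have htt := t_pos (D := D) hl ht i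
  have h1 : (√(D.t (lam s) (tau s) i))⁻¹ ≤ K * (√(D.rbar * tau s))⁻¹ := by
    refine le_trans ?_ (h.inv_sqrt_r_mul_le ht i)
    have : √(D.r i * tau s) ≤ √(D.t (lam s) (tau s) i) :=
      Real.sqrt_le_sqrt (by rw [t]; linarith)
    gcongr
  have h2 : (√(D.t (lam s) (tau s) i))⁻¹ ≤ K * (√(lam s))⁻¹ := by
    have h3 : (√(D.t (lam s) (tau s) i))⁻¹ ≤ (√(lam s))⁻¹ := by
      have : √(lam s) ≤ √(D.t (lam s) (tau s) i) :=
        Real.sqrt_le_sqrt (by rw [t]; have := mul_pos hi ht; linarith)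
      gcongr
    exact h3.trans (le_mul_of_one_le_left (by positivity) h.one_le)
  have h3 : (√(D.t (lam s) (tau s) i))⁻¹ ≤ K * min (√(lam s))⁻¹ (√(D.rbar * tau s))⁻¹ := by
    rw [mul_min_of_nonneg _ _ hK.le]
    exact le_min h2 h1
  have h4 : |β * D.shr (lam s) (tau s) i + α * (1 - D.shr (lam s) (tau s) i)| ≤ |β| + |α| := by
    refine (abs_add_le _ _).trans ?_
    rw [abs_mul, abs_mul, abs_of_pos hd, abs_of_pos hd']
    exact add_le_add (mul_le_of_le_one_right (abs_nonneg _) (by linarith))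
      (mul_le_of_le_one_right (abs_nonneg _) (by linarith))
  calc _ ≤ (√(D.t (lam s) (tau s) i))⁻¹ * (|β| + |α|) := by gcongr
    _ = (√(D.t (lam s) (tau s) i))⁻¹ * |β| + (√(D.t (lam s) (tau s) i))⁻¹ * |α| := by ring
    _ ≤ K * (√(D.rbar * tau s))⁻¹ * |β| +
        K * min (√(lam s))⁻¹ (√(D.rbar * tau s))⁻¹ * |α| := by gcongr
    _ = _ := by ring

theorem PrecisionCurve.hasDerivAt_inv_sqrt_t (hc : PrecisionCurve lam tau s α β) (i : Fin q) :
    HasDerivAt (fun u => (√(D.t (lam u) (tau u) i))⁻¹)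
      (-(1 / 2) * ((√(D.t (lam s) (tau s) i))⁻¹ * (β * D.shr (lam s) (tau s) i +
        α * (1 - D.shr (lam s) (tau s) i)))) s := by
  have ht := t_pos (D := D) (hc.lam_pos s) (hc.tau_pos s) i
  have h1 : HasDerivAt (fun u => D.t (lam u) (tau u) i)
      (D.r i * (β * tau s) + α * lam s) s := (hc.deriv_tau.const_mul _).add hc.deriv_lam
  refine (hasDerivAt_inv_sqrt h1 ht).congr_deriv ?_
  rw [one_sub_shr (hc.lam_pos s) (hc.tau_pos s), shr]
  field_simp

/-- Derivatives of the new group effects, with a bound for their Euclidean norm. -/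
theorem exists_hasDerivAt_group (h : D.Regular K) (hc : PrecisionCurve lam tau s α β)
    (hκ : ∀ i j, D.shr (lam s) (tau s) i * (1 - D.shr (lam s) (tau s) j) ≤ κ) (hκ0 : 0 ≤ κ)
    {x c' : Fin D.p → ℝ} (n0 : ℝ) (n : Fin q → ℝ) {m' : ℝ}
    (hc' : ∀ k, HasDerivAt (fun u => D.coef x (lam u) (tau u) k) (c' k) s)
    (hcn : vnorm c' ≤ 24 * K ^ 13 * D.drift x (tau s) α β κ)
    (hm' : HasDerivAt (fun u => D.center x n0 (lam u) (tau u)) m' s)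
    (hmn : |m'| ≤ 36 * K ^ 15 * D.drift x (tau s) α β κ +
        K ^ 2 / √q * (|α| * (√(lam s))⁻¹ + |β| * (√(D.rbar * tau s))⁻¹) * |n0|) :
    ∃ e' : Fin q → ℝ, (∀ i, HasDerivAt (fun u => (1 - D.shr (lam u) (tau u) i) *
        D.center x n0 (lam u) (tau u) + D.shr (lam u) (tau u) i * D.res x (lam u) (tau u) i +
          (√(D.t (lam u) (tau u) i))⁻¹ * n i) (e' i) s) ∧
      vnorm e' ≤ 72 * K ^ 15 * (√q * D.drift x (tau s) α β κ) +
        2 * K ^ 2 * ((|α| * (√(lam s))⁻¹ + |β| * (√(D.rbar * tau s))⁻¹) * |n0|) +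
        K * ((|β| * (√(D.rbar * tau s))⁻¹ +
          |α| * min (√(lam s))⁻¹ (√(D.rbar * tau s))⁻¹) * vnorm n) := by
  have hK := h.K_pos
  have hN := h.N_pos
  have hl := hc.lam_pos s
  have ht := hc.tau_pos s
  have hx := vnorm_nonneg x
  have hq : 0 < √(q : ℝ) := Real.sqrt_pos.2 h.q_cast_pos
  have hd := fun i => shr_pos (D := D) hl ht i
  have hd' := fun i => one_sub_shr_pos (D := D) hl ht i
  set d := D.shr (lam s) (tau s) with hd_def
  set w := D.wt (lam s) (tau s) with hw_def
  set S := (√(tau s * ∑ j, D.wt (lam s) (tau s) j))⁻¹ with hS_def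
  set P := |α| * (√(lam s))⁻¹ + |β| * (√(D.rbar * tau s))⁻¹ with hP
  set P2 := |β| * (√(D.rbar * tau s))⁻¹ + |α| * min (√(lam s))⁻¹ (√(D.rbar * tau s))⁻¹ with hP2
  set E := D.drift x (tau s) α β κ with hE
  -- The product rule sorted by source: v₁ the motion of the centre, v₂ that of the residuals, v₅
  -- that of the noise scale. The motion of d_i multiplies residual minus centre, which splits into
  -- the deviation from the weighted mean (v₃) and the noise n0 in the centre (v₄).
  let v₁ : Fin q → ℝ := fun i => (1 - d i) * (fun _ => m') i
  let v₂ : Fin q → ℝ := fun i => -d i * (D.xbarMat *ᵥ c') i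
  let v₃ : Fin q → ℝ := fun i => (-(α - β) * (d i * (1 - d i))) *
    (D.res x (lam s) (tau s) i - wmean w (D.res x (lam s) (tau s)))
  let v₄ : Fin q → ℝ := fun i => ((1 - d i) * d i * (α - β) * S) * (fun _ => n0) i
  let v₅ : Fin q → ℝ := fun i => (-(1 / 2) * ((√(D.t (lam s) (tau s) i))⁻¹ *
    (β * d i + α * (1 - d i)))) * n i
  have b₁ : vnorm v₁ ≤ 36 * K ^ 15 * (√q * E) + K ^ 2 * (P * |n0|) := by
    have h1 : vnorm v₁ ≤ 1 * vnorm fun _ : Fin q => m' := by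
      refine vnorm_mul_le fun i => ?_
      rw [abs_of_pos (hd' i)]; linarith [hd i]
    rw [one_mul, vnorm_const, Fintype.card_fin] at h1
    calc _ ≤ √q * |m'| := h1
      _ ≤ √q * (36 * K ^ 15 * E + K ^ 2 / √q * P * |n0|) := by gcongr
      _ = _ := by field_simp
  have b₂ : vnorm v₂ ≤ 24 * K ^ 15 * (√q * E) := by
    have h1 : vnorm v₂ ≤ 1 * vnorm (D.xbarMat *ᵥ c') := by
      refine vnorm_mul_le fun i => ?_
      rw [abs_neg, abs_of_pos (hd i)]; linarith [hd' i]
    have hE0 : 0 ≤ E := by rw [hE, drift]; positivity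
    have h6 : K ^ 14 ≤ K ^ 15 := pow_le_pow_right₀ h.one_le (by norm_num)
    calc _ ≤ K * √q * vnorm c' := by
          rw [one_mul] at h1; exact h1.trans (h.vnorm_xbarMat_mulVec_le c')
      _ ≤ K * √q * (24 * K ^ 13 * E) := by gcongr
      _ = 24 * K ^ 14 * (√q * E) := by ring
      _ ≤ _ := by gcongr
  have b₃ : vnorm v₃ ≤ 12 * K ^ 15 * (√q * E) := by
    have h1 : vnorm v₃ ≤ |α - β| * κ *
        vnorm (fun i => D.res x (lam s) (tau s) i - wmean w (D.res x (lam s) (tau s))) := by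
      refine vnorm_mul_le fun i => ?_
      rw [abs_mul, abs_neg, abs_of_pos (mul_pos (hd i) (hd' i))]
      exact mul_le_mul_of_nonneg_left (hκ i i) (abs_nonneg _)
    have h6 : K ^ 8 ≤ K ^ 15 := pow_le_pow_right₀ h.one_le (by norm_num)
    calc _ ≤ |α - β| * κ * (2 * K * (6 * K ^ 7 * √q *
          (1 + vnorm x / (√(tau s) * √(D.rbar * q))))) := by
          refine h1.trans (mul_le_mul_of_nonneg_left ?_ (by positivity))
          exact (h.vnorm_sub_wmean_le hl ht _).trans
            (mul_le_mul_of_nonneg_left (h.vnorm_res_le hl ht x) (by positivity))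
      _ = 12 * K ^ 8 * (√q * (|α - β| * κ * (1 + vnorm x / (√(tau s) * √(D.rbar * q))))) := by
          ring
      _ ≤ 12 * K ^ 15 * (√q * E) := by
          rw [hE, drift]
          gcongr
          exact le_add_of_nonneg_right (by positivity)
  have b₄ : vnorm v₄ ≤ K ^ 2 * (P * |n0|) := by
    have h1 : vnorm v₄ ≤ K ^ 2 / √q * P * vnorm fun _ : Fin q => n0 := by
      refine vnorm_mul_le fun i => ?_
      have h2 := h.inv_sqrt_sum_wt_mul_shr_le hl ht i
      have hS0 : 0 ≤ S := by positivity
      have h3 : S * d i * (1 - d i) ≤ S * d i :=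
        mul_le_of_le_one_right (mul_nonneg hS0 (hd i).le) (by linarith [hd i])
      have h4 : S * (1 - d i) * d i ≤ S * (1 - d i) :=
        mul_le_of_le_one_right (mul_nonneg hS0 (hd' i).le) (by linarith [hd' i])
      have h5 : 0 ≤ (1 - d i) * d i * S := mul_nonneg (mul_nonneg (hd' i).le (hd i).le) hS0
      have e : (1 - d i) * d i * (α - β) * S = (α - β) * ((1 - d i) * d i * S) := by ring
      rw [e, abs_mul, abs_of_nonneg h5]
      calc |α - β| * ((1 - d i) * d i * S) ≤ (|α| + |β|) * ((1 - d i) * d i * S) := by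
            gcongr; exact abs_sub _ _
        _ = |α| * (S * d i * (1 - d i)) + |β| * (S * (1 - d i) * d i) := by ring
        _ ≤ |α| * (K ^ 2 / √q * (√(lam s))⁻¹) +
            |β| * (K ^ 2 / √q * (√(D.rbar * tau s))⁻¹) := by
            have := h3.trans h2.1
            have := h4.trans h2.2
            gcongr
        _ = _ := by rw [hP]; ring
    rw [vnorm_const, Fintype.card_fin] at h1
    refine h1.trans (le_of_eq ?_)
    field_simp
  have b₅ : vnorm v₅ ≤ K * P2 * vnorm n := by
    refine vnorm_mul_le fun i => ?_
    have h1 := abs_inv_sqrt_t_mul_le (α := α) (β := β) h hl ht i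
    rw [abs_mul, abs_mul (√(D.t (lam s) (tau s) i))⁻¹, abs_of_nonneg (a := (√_)⁻¹) (by positivity)]
    have : |(-(1 / 2) : ℝ)| = 1 / 2 := by norm_num
    rw [this]
    refine le_trans (mul_le_of_le_one_left ?_ (by norm_num)) h1
    positivity
  refine ⟨v₁ + v₂ + v₃ + v₄ + v₅, fun i => ?_, ?_⟩
  · have h1 := (hc.hasDerivAt_shr (D := D) i)
    have h2 := (((h1.const_sub 1).mul hm').add (h1.mul (hasDerivAt_res hc' i))).add
      ((hc.hasDerivAt_inv_sqrt_t (D := D) i).mul_const (n i))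
    refine h2.congr_deriv ?_
    simp only [Pi.add_apply, v₁, v₂, v₃, v₄, v₅, center]
    ring
  · have h1 := vnorm_add_le (v₁ + v₂ + v₃ + v₄) v₅
    have h2 := vnorm_add_le (v₁ + v₂ + v₃) v₄
    have h3 := vnorm_add_le (v₁ + v₂) v₃
    have h4 := vnorm_add_le v₁ v₂
    linarith

/-- The derivative of the next state along a curve of precisions. -/
theorem exists_hasDerivAt_next (h : D.Regular K) (hc : PrecisionCurve lam tau s α β)
    (hκ : ∀ i j, D.shr (lam s) (tau s) i * (1 - D.shr (lam s) (tau s) j) ≤ κ) (hκ0 : 0 ≤ κ)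
    (n00 : EuclideanSpace ℝ (Fin D.p)) (n : Fin (q + 1) → ℝ) :
    ∃ F' : D.State, HasDerivAt (fun u => D.next n00 n (lam u) (tau u)) F' s ∧
      ‖F'‖ ≤ 132 * K ^ 15 * (√q * D.drift (fun k => n00 k) (tau s) α β κ +
        (|α| * (√(lam s))⁻¹ + |β| * (√(D.rbar * tau s))⁻¹) * |n 0| +
        (|β| * (√(D.rbar * tau s))⁻¹ +
          |α| * min (√(lam s))⁻¹ (√(D.rbar * tau s))⁻¹) * vnorm (fun i : Fin q => n i.succ)) := by
  have hK := h.K_pos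
  have hN := h.N_pos
  have hl := hc.lam_pos s
  have ht := hc.tau_pos s
  have hx := vnorm_nonneg (fun k => n00 k)
  have hq : 0 < √(q : ℝ) := Real.sqrt_pos.2 h.q_cast_pos
  obtain ⟨c', hc', hcn⟩ := exists_hasDerivAt_coef h hc hκ hκ0 (fun k => n00 k)
  obtain ⟨m', hm', hmn⟩ := exists_hasDerivAt_center h hc hκ hκ0 (n 0) hc' hcn
  obtain ⟨e', he', hen⟩ := exists_hasDerivAt_group h hc hκ hκ0 (n 0) (fun i => n i.succ)
    hc' hcn hm' hmn
  refine ⟨WithLp.toLp 2 (Sum.elim (√(q : ℝ) • c') (Fin.cons (√(q : ℝ) * m') e')), ?_, ?_⟩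
  · refine HasDerivAt.congr_of_eventuallyEq ?_ (Eventually.of_forall fun u =>
      next_eq h.q_pos (hc.lam_pos u) (hc.tau_pos u) n00 n)
    refine hasDerivAt_toLp fun i => ?_
    rcases i with k | i
    · exact (hc' k).const_mul _
    · refine Fin.cases ?_ (fun i => ?_) i
      · exact hm'.const_mul _
      · exact he' i
  · set P := |α| * (√(lam s))⁻¹ + |β| * (√(D.rbar * tau s))⁻¹ with hP
    set P2 := |β| * (√(D.rbar * tau s))⁻¹ + |α| * min (√(lam s))⁻¹ (√(D.rbar * tau s))⁻¹ with hP2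
    set E := D.drift (fun k => n00 k) (tau s) α β κ with hE
    have hE0 : 0 ≤ E := by rw [hE, drift]; positivity
    have hP0 : 0 ≤ P := by positivity
    have hP20 : 0 ≤ P2 := by positivity
    have hn := vnorm_nonneg (fun i : Fin q => n i.succ)
    refine (norm_toLp_sum_elim_cons_le _ _ _).trans ?_
    rw [vnorm_smul, abs_mul, abs_of_pos hq]
    have k1 : K ^ 13 ≤ K ^ 15 := pow_le_pow_right₀ h.one_le (by norm_num)
    have k2 : K ^ 2 ≤ K ^ 15 := pow_le_pow_right₀ h.one_le (by norm_num)
    have k3 : K ≤ K ^ 15 := le_self_pow₀ h.one_le (by norm_num)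
    have h1 : √q * vnorm c' ≤ 24 * K ^ 15 * (√q * E) := by
      calc _ ≤ √q * (24 * K ^ 13 * E) := by gcongr; exact hcn
        _ ≤ √q * (24 * K ^ 15 * E) := by gcongr
        _ = _ := by ring
    have h2 : √q * |m'| ≤ 36 * K ^ 15 * (√q * E) + K ^ 15 * (P * |n 0|) := by
      calc _ ≤ √q * (36 * K ^ 15 * E + K ^ 2 / √q * P * |n 0|) := by gcongr
        _ = 36 * K ^ 15 * (√q * E) + K ^ 2 * (P * |n 0|) := by field_simp
        _ ≤ _ := by gcongr
    have h3 : vnorm e' ≤ 72 * K ^ 15 * (√q * E) + 2 * K ^ 15 * (P * |n 0|) +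
        K ^ 15 * (P2 * vnorm fun i : Fin q => n i.succ) := by
      refine hen.trans ?_
      gcongr
    have h4 : 0 ≤ K ^ 15 * (P * |n 0|) := by positivity
    have h5 : 0 ≤ K ^ 15 * (P2 * vnorm fun i : Fin q => n i.succ) := by positivity
    linarith

end MixedData

/-! ### Relative derivatives of reciprocals of quadratic functions. -/

section QuadraticCurves

variable {ι : Type*} [Fintype ι]

/-- Half the squared length of a vector moving on a line, shifted by `b`. -/
noncomputable def shiftedEnergy (b : ℝ) (a g : ι → ℝ) (u : ℝ) : ℝ :=
  b + 1 / 2 * ∑ i, (a i + u * g i) ^ 2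

theorem shiftedEnergy_pos {b : ℝ} (hb : 0 < b) (a g : ι → ℝ) (u : ℝ) :
    b ≤ shiftedEnergy b a g u ∧ 0 < shiftedEnergy b a g u := by
  have : 0 ≤ ∑ i, (a i + u * g i) ^ 2 := Finset.sum_nonneg fun i _ => sq_nonneg _
  constructor <;> (rw [shiftedEnergy]; linarith)

/-- The relative derivative is minus that of the energy. Cauchy–Schwarz bounds the derivative of the
energy by its square root times the length of g, so one factor of the inverse square root survives.
-/
theorem exists_hasDerivAt_div_shiftedEnergy {b : ℝ} (hb : 0 < b) (a g : ι → ℝ) (j s : ℝ) :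
    ∃ α, HasDerivAt (fun u => j / shiftedEnergy b a g u) (α * (j / shiftedEnergy b a g s)) s ∧
      |α| ≤ 2 * vnorm g / √(shiftedEnergy b a g s) := by
  obtain ⟨-, hA⟩ := shiftedEnergy_pos hb a g s
  have h1 : HasDerivAt (shiftedEnergy b a g) (∑ i, (a i + s * g i) * g i) s := by
    have h2 : HasDerivAt (fun u => ∑ i, (a i + u * g i) ^ 2)
        (∑ i, (2 : ℕ) * (a i + s * g i) ^ (2 - 1) * (1 * g i)) s :=
      HasDerivAt.fun_sum fun i _ => (((hasDerivAt_id s).mul_const (g i)).const_add (a i)).pow 2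
    refine ((h2.const_mul (1 / 2)).const_add b).congr_deriv ?_
    rw [Finset.mul_sum]
    exact Finset.sum_congr rfl fun i _ => by norm_num; ring
  refine ⟨-(∑ i, (a i + s * g i) * g i) / shiftedEnergy b a g s, ?_, ?_⟩
  · refine (((hasDerivAt_const s j).div h1 hA.ne')).congr_deriv ?_
    field_simp
    ring
  · have h2 := abs_dotProduct_le (fun i => a i + s * g i) g
    have h3 : vnorm (fun i => a i + s * g i) ≤ 2 * √(shiftedEnergy b a g s) := by
      refine vnorm_le_of_sq_le (by positivity) ?_
      rw [mul_pow, Real.sq_sqrt hA.le, shiftedEnergy]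
      have : 0 ≤ ∑ i, (a i + s * g i) ^ 2 := Finset.sum_nonneg fun i _ => sq_nonneg _
      linarith
    rw [abs_div, abs_neg, abs_of_pos hA, div_le_div_iff₀ hA (by positivity)]
    have h4 : √(shiftedEnergy b a g s) * √(shiftedEnergy b a g s) = shiftedEnergy b a g s :=
      Real.mul_self_sqrt hA.le
    calc _ ≤ (2 * √(shiftedEnergy b a g s) * vnorm g) * √(shiftedEnergy b a g s) := by
          gcongr
          exact h2.trans (mul_le_mul_of_nonneg_right h3 (vnorm_nonneg g))
      _ = 2 * vnorm g * (√(shiftedEnergy b a g s) * √(shiftedEnergy b a g s)) := by ring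
      _ = _ := by rw [h4]

end QuadraticCurves

/-! ### The precisions along a line in state space, and their relation to V. -/

namespace MixedData

variable {q : ℕ} {D : MixedData q} {K : ℝ}

/-- Deviations of the group effects from `η₀ / √q`. -/
noncomputable def groupDev (D : MixedData q) (η : D.State) (i : Fin q) : ℝ :=
  η (Sum.inr i.succ) - η (Sum.inr 0) / √(q : ℝ)

/-- The part of the observation residuals that is linear in the state. -/
noncomputable def fitted (D : MixedData q) (η : D.State) (o : D.Obs) : ℝ :=
  D.fit η o.1 o.2 + η (Sum.inr o.1.succ)

theorem fit_add_smul (η h : D.State) (u : ℝ) (i : Fin q) (j : Fin (D.r i)) :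
    D.fit (η + u • h) i j = D.fit η i j + u * D.fit h i j := by
  simp only [fit, PiLp.add_apply, PiLp.smul_apply, smul_eq_mul, mul_add, Finset.sum_add_distrib,
    add_div]
  congr 1
  rw [← mul_div_assoc, Finset.mul_sum]
  congr 1
  exact Finset.sum_congr rfl fun k _ => by ring

theorem lam_segment (b j : ℝ) (η h : D.State) (u : ℝ) :
    D.lam b j (η + u • h) = j / shiftedEnergy b (D.groupDev η) (D.groupDev h) u := by
  rw [lam, shiftedEnergy]
  congr 3
  refine Finset.sum_congr rfl fun i _ => ?_
  simp only [groupDev, PiLp.add_apply, PiLp.smul_apply, smul_eq_mul]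
  ring

theorem tau_segment (b j : ℝ) (η h : D.State) (u : ℝ) :
    D.tau b j (η + u • h) = j / shiftedEnergy b (fun o => D.Y o - D.fitted η o)
      (fun o => -D.fitted h o) u := by
  rw [tau, shiftedEnergy, Fintype.sum_sigma]
  congr 3
  refine Finset.sum_congr rfl fun i _ => Finset.sum_congr rfl fun j _ => ?_
  simp only [fitted, fit_add_smul, PiLp.add_apply, PiLp.smul_apply, smul_eq_mul, Y]
  ring

theorem state_norm_sq (h : D.State) :
    ‖h‖ ^ 2 = ∑ k, h (Sum.inl k) ^ 2 + (h (Sum.inr 0) ^ 2 + ∑ i : Fin q, h (Sum.inr i.succ) ^ 2) := by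
  rw [EuclideanSpace.norm_sq_eq, Fintype.sum_sum_type, Fin.sum_univ_succ]
  simp

theorem vnorm_groupDev_le (hq : 0 < q) (h : D.State) : vnorm (D.groupDev h) ≤ 2 * ‖h‖ := by
  refine vnorm_le_of_sq_le (by positivity) ?_
  have hq' : (0 : ℝ) < q := Nat.cast_pos.2 hq
  have h1 : ∑ i, D.groupDev h i ^ 2 ≤
      ∑ i : Fin q, (2 * h (Sum.inr i.succ) ^ 2 + 2 * (h (Sum.inr 0) ^ 2 / q)) := by
    refine Finset.sum_le_sum fun i _ => ?_
    have e : h (Sum.inr 0) ^ 2 / q = (h (Sum.inr 0) / √(q : ℝ)) ^ 2 := by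
      rw [div_pow, Real.sq_sqrt hq'.le]
    rw [e, groupDev]
    nlinarith [sq_nonneg (h (Sum.inr i.succ) + h (Sum.inr 0) / √(q : ℝ))]
  rw [Finset.sum_add_distrib, ← Finset.mul_sum, Finset.sum_const, nsmul_eq_mul, Finset.card_univ,
    Fintype.card_fin] at h1
  have h2 : (q : ℝ) * (2 * (h (Sum.inr 0) ^ 2 / q)) = 2 * h (Sum.inr 0) ^ 2 := by field_simp
  rw [h2] at h1
  rw [mul_pow, state_norm_sq]
  have h3 : 0 ≤ ∑ k, h (Sum.inl k) ^ 2 := Finset.sum_nonneg fun k _ => sq_nonneg _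
  have h4 : 0 ≤ ∑ i : Fin q, h (Sum.inr i.succ) ^ 2 := Finset.sum_nonneg fun k _ => sq_nonneg _
  nlinarith [sq_nonneg (h (Sum.inr 0))]

/-- The factor 1/√q in `fit` removes the q from `gram_le`, and each group effect occurs r_i ≤ K r̄
times; both parts thus have squared size of order r̄. -/
theorem Regular.vnorm_fitted_le (hD : D.Regular K) (h : D.State) :
    vnorm (fun o => -D.fitted h o) ≤ 2 * K * √D.rbar * ‖h‖ := by
  have hK := hD.K_pos
  have hr := hD.rbar_pos
  have hq := hD.q_cast_pos
  refine vnorm_le_of_sq_le (by positivity) ?_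
  have h1 : ∑ o, (-D.fitted h o) ^ 2 ≤
      ∑ i, ∑ j, (2 * D.fit h i j ^ 2 + 2 * h (Sum.inr i.succ) ^ 2) := by
    rw [Fintype.sum_sigma]
    refine Finset.sum_le_sum fun i _ => Finset.sum_le_sum fun j _ => ?_
    rw [fitted]
    nlinarith [sq_nonneg (D.fit h i j - h (Sum.inr i.succ))]
  have h2 : ∑ i, ∑ j, D.fit h i j ^ 2 ≤ K * D.rbar * ∑ k, h (Sum.inl k) ^ 2 := by
    have h3 := hD.gram_le fun k => h (Sum.inl k)
    rw [dotProduct_gramX_mulVec] at h3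
    have e : ∑ i, ∑ j, D.fit h i j ^ 2 =
        (∑ i, ∑ j, (∑ k, D.x i j k * h (Sum.inl k)) ^ 2) / q := by
      rw [Finset.sum_div]
      refine Finset.sum_congr rfl fun i _ => ?_
      rw [Finset.sum_div]
      exact Finset.sum_congr rfl fun j _ => by rw [fit, div_pow, Real.sq_sqrt hq.le]
    rw [e, div_le_iff₀ hq]
    refine h3.trans (le_of_eq ?_)
    rw [← vnorm_sq', vnorm_sq]; ring
  have h4 : ∑ i, ∑ _j : Fin (D.r i), h (Sum.inr i.succ) ^ 2 ≤
      K * D.rbar * ∑ i : Fin q, h (Sum.inr i.succ) ^ 2 := by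
    rw [Finset.mul_sum]
    refine Finset.sum_le_sum fun i _ => ?_
    rw [Finset.sum_const, nsmul_eq_mul, Finset.card_univ, Fintype.card_fin]
    exact mul_le_mul_of_nonneg_right (hD.r_le i) (sq_nonneg _)
  simp only [Finset.sum_add_distrib, ← Finset.mul_sum] at h1
  have h5 : K * D.rbar * (∑ k, h (Sum.inl k) ^ 2 + ∑ i : Fin q, h (Sum.inr i.succ) ^ 2) ≤
      K * D.rbar * ‖h‖ ^ 2 := by
    rw [state_norm_sq]
    gcongr
    linarith [sq_nonneg (h (Sum.inr 0))]
  have h6 : K * D.rbar * ‖h‖ ^ 2 ≤ K ^ 2 * D.rbar * ‖h‖ ^ 2 := by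
    have : K ≤ K ^ 2 := le_self_pow₀ hD.one_le (by norm_num)
    gcongr
  have h7 : 0 ≤ K ^ 2 * D.rbar * ‖h‖ ^ 2 := by positivity
  have e : (2 * K * √D.rbar * ‖h‖) ^ 2 = 4 * (K ^ 2 * D.rbar * ‖h‖ ^ 2) := by
    rw [mul_pow, mul_pow, mul_pow, Real.sq_sqrt hr.le]; ring
  rw [e]
  linarith

/-- V is a nonnegative combination of squares of affine functions, and the square of a convex
combination of a and b is at most a² + b². This carries the condition on the endpoints to the whole
segment. -/
theorem V_segment_le (hD : D.Regular K) (η η' : D.State) {s : ℝ} (hs : s ∈ Set.Icc (0 : ℝ) 1) :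
    D.V (η + s • (η' - η)) ≤ D.V η + D.V η' := by
  have hN := hD.N_pos
  have key : ∀ a b c : ℝ, c = a + s * (b - a) → c ^ 2 ≤ a ^ 2 + b ^ 2 := by
    rintro a b c rfl
    obtain ⟨h0, h1⟩ := hs
    nlinarith [mul_nonneg h0 (sub_nonneg.2 h1), sq_nonneg (a - b), sq_nonneg a, sq_nonneg b,
      mul_nonneg (mul_nonneg h0 (sub_nonneg.2 h1)) (sq_nonneg (a - b)),
      mul_nonneg h0 (sq_nonneg a), mul_nonneg (sub_nonneg.2 h1) (sq_nonneg b)]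
  have hfit : ∀ i j, D.fit (η + s • (η' - η)) i j =
      D.fit η i j + s * (D.fit η' i j - D.fit η i j) := by
    intro i j
    have h1 := fit_add_smul η (η' - η) s i j
    have h2 := fit_add_smul η (η' - η) 1 i j
    rw [one_smul, add_sub_cancel, one_mul] at h2
    rw [h1, h2]; ring
  have h1 : ∑ i, ∑ j, (D.ybarbar - D.fit (η + s • (η' - η)) i j) ^ 2 ≤
      ∑ i, ∑ j, (D.ybarbar - D.fit η i j) ^ 2 + ∑ i, ∑ j, (D.ybarbar - D.fit η' i j) ^ 2 := by
    simp only [← Finset.sum_add_distrib]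
    refine Finset.sum_le_sum fun i _ => Finset.sum_le_sum fun j _ => key _ _ _ ?_
    rw [hfit]; ring
  have h2 : (η + s • (η' - η)) (Sum.inr 0) ^ 2 / q ≤
      η (Sum.inr 0) ^ 2 / q + η' (Sum.inr 0) ^ 2 / q := by
    rw [← add_div]
    gcongr
    refine key _ _ _ ?_
    simp
  have h3 : ∑ i, (D.r i : ℝ) * ((η + s • (η' - η)) (Sum.inr i.succ) + D.ybarbar - D.ybar i) ^ 2 ≤
      ∑ i, (D.r i : ℝ) * (η (Sum.inr i.succ) + D.ybarbar - D.ybar i) ^ 2 +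
      ∑ i, (D.r i : ℝ) * (η' (Sum.inr i.succ) + D.ybarbar - D.ybar i) ^ 2 := by
    rw [← Finset.sum_add_distrib]
    refine Finset.sum_le_sum fun i _ => ?_
    rw [← mul_add]
    refine mul_le_mul_of_nonneg_left (key _ _ _ ?_) (Nat.cast_nonneg _)
    simp
    ring
  have hc : 0 ≤ 1 / (D.rbar * q) := by positivity
  have h1' := mul_le_mul_of_nonneg_left h1 hc
  have h3' := mul_le_mul_of_nonneg_left h3 hc
  rw [mul_add] at h1' h3'
  rw [V, V, V]
  linarith

/-- A residual splits as (ȳ - fit) - (η_i + ȳ - ȳ_i) + (y_ij - ȳ_i). The first two parts are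
controlled by V and the last by the bound on the responses; the factor 3 is from squaring a sum of
three terms. -/
theorem energy_le_V (hD : D.Regular K) (b : ℝ) (η h : D.State) (s : ℝ) :
    shiftedEnergy b (fun o => D.Y o - D.fitted η o) (fun o => -D.fitted h o) s ≤
      b + 3 / 2 * (D.rbar * q * (D.V (η + s • h) + K)) := by
  have hN := hD.N_pos
  have hq := hD.q_cast_pos
  set ζ := η + s • h with hζ
  have e : shiftedEnergy b (fun o => D.Y o - D.fitted η o) (fun o => -D.fitted h o) s =
      b + 1 / 2 * ∑ i, ∑ j, (D.y i j - D.fit ζ i j - ζ (Sum.inr i.succ)) ^ 2 := by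
    rw [shiftedEnergy, Fintype.sum_sigma]
    congr 2
    refine Finset.sum_congr rfl fun i _ => Finset.sum_congr rfl fun j _ => ?_
    simp only [hζ, fitted, fit_add_smul, PiLp.add_apply, PiLp.smul_apply, smul_eq_mul, Y]
    ring
  have h1 : ∑ i, ∑ j, (D.y i j - D.fit ζ i j - ζ (Sum.inr i.succ)) ^ 2 ≤
      ∑ i, ∑ j, (3 * (D.ybarbar - D.fit ζ i j) ^ 2 +
        3 * (ζ (Sum.inr i.succ) + D.ybarbar - D.ybar i) ^ 2 + 3 * (D.y i j - D.ybar i) ^ 2) := by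
    refine Finset.sum_le_sum fun i _ => Finset.sum_le_sum fun j _ => ?_
    have e : D.y i j - D.fit ζ i j - ζ (Sum.inr i.succ) = (D.ybarbar - D.fit ζ i j) -
      (ζ (Sum.inr i.succ) + D.ybarbar - D.ybar i) + (D.y i j - D.ybar i) := by ring
    rw [e]
    generalize D.ybarbar - D.fit ζ i j = a
    generalize ζ (Sum.inr i.succ) + D.ybarbar - D.ybar i = c
    generalize D.y i j - D.ybar i = d
    nlinarith [sq_nonneg (a + c), sq_nonneg (a - d), sq_nonneg (c + d)]
  have h2 : ∑ i, ∑ j, (D.y i j - D.ybar i) ^ 2 ≤ K * (D.rbar * q) := by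
    refine le_trans (Finset.sum_le_sum fun i _ => ?_) hD.resp_le
    have h3 := sum_sub_mean (D.r_pos i) (D.y i) (D.y i)
    simp only [← sq] at h3
    simp only [ybar]
    rw [h3]
    have : (0 : ℝ) ≤ D.r i * ((∑ j, D.y i j) / D.r i) ^ 2 := by positivity
    linarith
  have h3 : ∑ i, ∑ _j : Fin (D.r i), (ζ (Sum.inr i.succ) + D.ybarbar - D.ybar i) ^ 2 =
      ∑ i, (D.r i : ℝ) * (ζ (Sum.inr i.succ) + D.ybarbar - D.ybar i) ^ 2 := by simp
  have h4 : D.rbar * q * D.V ζ = ∑ i, ∑ j, (D.ybarbar - D.fit ζ i j) ^ 2 +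
      D.rbar * ζ (Sum.inr 0) ^ 2 +
      ∑ i, (D.r i : ℝ) * (ζ (Sum.inr i.succ) + D.ybarbar - D.ybar i) ^ 2 := by
    have hr := hD.rbar_pos
    rw [V]
    generalize ∑ i, ∑ j, (D.ybarbar - D.fit ζ i j) ^ 2 = a
    generalize ∑ i, (D.r i : ℝ) * (ζ (Sum.inr i.succ) + D.ybarbar - D.ybar i) ^ 2 = c
    field_simp
  have h5 : 0 ≤ D.rbar * ζ (Sum.inr 0) ^ 2 := by have := hD.rbar_pos; positivity
  simp only [Finset.sum_add_distrib, ← Finset.mul_sum] at h1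
  rw [e]
  linarith

/-- A common bound for the products of shrinkage factors, in terms of the precisions. -/
theorem Regular.exists_shr_mul_le (hD : D.Regular K) {l τ : ℝ} (hl : 0 < l) (ht : 0 < τ) :
    ∃ κ, 0 ≤ κ ∧ (∀ i j, D.shr l τ i * (1 - D.shr l τ j) ≤ κ) ∧ κ ≤ 1 ∧
      κ ≤ K * (√l / √(D.rbar * τ)) ∧ κ ≤ K * (√(D.rbar * τ) / √l) := by
  have hK := hD.K_pos
  have hr := hD.rbar_pos
  have hsK : √K ≤ K := by
    rw [Real.sqrt_le_left hK.le]
    exact le_self_pow₀ hD.one_le (by norm_num)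
  refine ⟨min 1 (min (K * (√l / √(D.rbar * τ))) (K * (√(D.rbar * τ) / √l))), by positivity,
    fun i j => ?_, min_le_left _ _, (min_le_right _ _).trans (min_le_left _ _),
    (min_le_right _ _).trans (min_le_right _ _)⟩
  have hd := shr_pos (D := D) hl ht i
  have hd' := one_sub_shr_pos (D := D) hl ht j
  have hdi : D.shr l τ i ≤ 1 := by linarith [one_sub_shr_pos (D := D) hl ht i]
  have hdj : 1 - D.shr l τ j ≤ 1 := by linarith [shr_pos (D := D) hl ht j]
  have hri := r_cast_pos (D := D) i
  have hrj := r_cast_pos (D := D) j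
  have hti := t_pos (D := D) hl ht i
  have htj := t_pos (D := D) hl ht j
  -- Since d² ≤ d for d in (0,1], a linear bound d ≤ Kc gives d ≤ √(Kc). The square root matches the
  -- scales √λ and √(r̄τ) of the noise terms.
  have key : ∀ {d c : ℝ}, 0 < d → d ≤ 1 → 0 ≤ c → d ≤ K * c → d ≤ K * √c := by
    intro d c h0 h1 hc h
    have h2 : d ≤ √(K * c) := Real.le_sqrt_of_sq_le (by nlinarith)
    rw [Real.sqrt_mul hK.le] at h2
    exact h2.trans (by gcongr)
  refine le_min ?_ (le_min ?_ ?_)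
  · exact mul_le_one₀ hdi hd'.le hdj
  · refine (mul_le_of_le_one_left hd'.le hdi).trans ?_
    rw [← Real.sqrt_div hl.le]
    refine key hd' hdj (by positivity) ?_
    rw [one_sub_shr hl ht, ← mul_div_assoc, div_le_div_iff₀ htj (by positivity), t]
    have h1 := mul_le_mul_of_nonneg_left (hD.rbar_le j) (mul_pos hl ht).le
    nlinarith [mul_pos hK (mul_pos hl hl)]
  · refine (mul_le_of_le_one_right hd.le hdj).trans ?_
    rw [← Real.sqrt_div (by positivity)]
    refine key hd hdi (by positivity) ?_
    rw [shr, ← mul_div_assoc, div_le_div_iff₀ hti hl, t]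
    have h1 := mul_le_mul_of_nonneg_left (hD.r_le i) (mul_pos hl ht).le
    nlinarith [mul_pos (mul_pos hK hr) (mul_pos ht (mul_pos hri ht))]

end MixedData

/-! ### Scalar inequalities that combine precisions and noise. -/

section ScalarBounds

-- Dictionary for the application: Q = √q, R = √r̄, p = √j1, r = √j2, x = √λ, y = √(r̄τ), a = |α|, b
-- = |β|, H the norm of the direction. The noise norms are G for N₀₀, n for N₀ and S for the
-- remaining N_i; Z is `noiseSize`.
variable {K c H Q R p r x y a b d κ G n S θ Z : ℝ}

theorem mul_le_add_sq (u v : ℝ) : u * v ≤ u ^ 2 + v ^ 2 := by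
  nlinarith [sq_nonneg (u - v), sq_nonneg u, sq_nonneg v]

theorem inv_sqrt_le (ha : 0 < a) : (√a)⁻¹ ≤ 1 + 1 / a := by
  have h : (√a)⁻¹ ^ 2 = 1 / a := by rw [inv_pow, Real.sq_sqrt ha.le, one_div]
  rw [← h]
  nlinarith [sq_nonneg ((√a)⁻¹ - 1), sq_nonneg ((√a)⁻¹)]

/-- The noise terms are controlled by the sum of their normalized squares. -/
theorem noise_quotients_le (hQ : 0 < Q) (hR : 0 < R) (hp : 0 < p) (hr : 0 < r)
    (hZ : Z = p ^ 2 / Q ^ 2 + R ^ 2 * Q ^ 2 / r ^ 2 + (G ^ 2 + (n ^ 2 + S ^ 2)) / Q ^ 2 +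
      Q ^ 2 / p ^ 2 + n ^ 2) :
    0 ≤ Z ∧ (p / r ≤ Z / R ∧ G / r ≤ Z / R ∧ S / r ≤ Z / R ∧ n / r ≤ Z / R) ∧
      G / p ≤ Z ∧ S / p ≤ Z ∧ n / p ≤ Z / Q := by
  have e : Z = (p / Q) ^ 2 + (R * Q / r) ^ 2 + ((G / Q) ^ 2 + (n / Q) ^ 2 + (S / Q) ^ 2) +
      (Q / p) ^ 2 + n ^ 2 := by rw [hZ]; field_simp; ring
  have s1 := sq_nonneg (p / Q)
  have s2 := sq_nonneg (R * Q / r)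
  have s3 := sq_nonneg (G / Q)
  have s4 := sq_nonneg (n / Q)
  have s5 := sq_nonneg (S / Q)
  have s6 := sq_nonneg (Q / p)
  have s7 := sq_nonneg n
  -- The quotient v/r is (v/Q)(RQ/r)/R, a product of two normalized variables whose squares both
  -- occur in Z.
  have over_r : ∀ v, (v / Q) ^ 2 + (R * Q / r) ^ 2 ≤ Z → v / r ≤ Z / R := by
    intro v hv
    rw [le_div_iff₀ hR]
    refine le_trans (le_of_eq ?_) ((mul_le_add_sq (v / Q) (R * Q / r)).trans hv)
    field_simp
  have over_p : ∀ v, (v / Q) ^ 2 + (Q / p) ^ 2 ≤ Z → v / p ≤ Z := by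
    intro v hv
    refine le_trans (le_of_eq ?_) ((mul_le_add_sq (v / Q) (Q / p)).trans hv)
    field_simp
  refine ⟨by linarith, ⟨over_r p (by linarith), over_r G (by linarith), over_r S (by linarith),
    over_r n (by linarith)⟩, over_p G (by linarith), over_p S (by linarith), ?_⟩
  rw [le_div_iff₀ hQ]
  refine le_trans (le_of_eq ?_) ((mul_le_add_sq n (Q / p)).trans (by linarith))
  field_simp

/-- Contributions of the relative change `b` of the residual precision. -/
theorem residual_precision_terms_le (hK : 1 ≤ K) (hH : 0 ≤ H) (hQ : 0 < Q)
    (hp : 0 < p) (hr : 0 < r) (hx : 0 < x) (hy : 0 < y) (hG : 0 ≤ G) (hc : 1 ≤ c)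
    (hκ0 : 0 ≤ κ) (hκ1 : κ ≤ 1) (hκ : κ ≤ K * (x / y)) (hb0 : 0 ≤ b)
    (hb : b ≤ 4 * K * H / r * y) (hxc : x ≤ p * c) (hn : 0 ≤ n) (hS : 0 ≤ S)
    (hpr : p / r ≤ Z / R) (hGr : G / r ≤ Z / R) (hSr : S / r ≤ Z / R) (hnr : n / r ≤ Z / R) :
    Q * (b * κ * (1 + G / (y * Q)) + b * (G / (y * Q))) + b * y⁻¹ * n + b * y⁻¹ * S ≤
      K ^ 2 * c * H * (4 * Q + 16) * (Z / R) := by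
  have hKp : 0 < K := by linarith
  -- The factor y in the bound for b cancels 1/y, so the energy behind τ drops out and no condition
  -- on V is needed.
  have hby : b * y⁻¹ ≤ 4 * K * H / r := by
    rw [← div_eq_mul_inv, div_le_iff₀ hy]; exact hb
  have hZ0 : 0 ≤ Z / R := le_trans (by positivity) hpr
  have h1 : Q * b * κ ≤ 4 * (K ^ 2 * c * H) * Q * (Z / R) := by
    calc Q * b * κ ≤ Q * (4 * K * H / r * y) * (K * (x / y)) := by gcongr
      _ = 4 * K ^ 2 * H * Q * (x / r) := by field_simp
      _ ≤ 4 * K ^ 2 * H * Q * (p * c / r) := by gcongr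
      _ = 4 * (K ^ 2 * c * H) * Q * (p / r) := by ring
      _ ≤ _ := by gcongr
  have hKc : K ≤ K ^ 2 * c := by nlinarith
  have h2 : Q * (b * (G / (y * Q))) ≤ 4 * (K ^ 2 * c * H) * (Z / R) := by
    calc _ = b * y⁻¹ * G := by field_simp
      _ ≤ 4 * K * H / r * G := by gcongr
      _ = 4 * (K * H) * (G / r) := by ring
      _ ≤ 4 * (K ^ 2 * c * H) * (Z / R) := by gcongr
  have h3 : Q * (b * κ * (G / (y * Q))) ≤ 4 * (K ^ 2 * c * H) * (Z / R) := by
    refine le_trans ?_ h2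
    have : 0 ≤ G / (y * Q) := by positivity
    have : b * κ ≤ b := mul_le_of_le_one_right hb0 hκ1
    gcongr
  have h4 : ∀ v, 0 ≤ v → v / r ≤ Z / R → b * y⁻¹ * v ≤ 4 * (K ^ 2 * c * H) * (Z / R) := by
    intro v hv hvr
    calc _ ≤ 4 * K * H / r * v := by gcongr
      _ = 4 * (K * H) * (v / r) := by ring
      _ ≤ 4 * (K ^ 2 * c * H) * (Z / R) := by gcongr
  have h5 := h4 n hn hnr
  have h6 := h4 S hS hSr
  linarith

/-- Contributions of the relative change `a` of the group precision, for small energies. -/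
theorem group_precision_terms_le_of_small (hK : 1 ≤ K) (hH : 0 ≤ H) (hQ : 0 < Q)
    (hp : 0 < p) (hr : 0 < r) (hx : 0 < x) (hy : 0 < y) (hG : 0 ≤ G) (hc : 1 ≤ c)
    (hκ0 : 0 ≤ κ) (hκ1 : κ ≤ 1) (hκ : κ ≤ K * (x / y)) (ha0 : 0 ≤ a)
    (ha : a ≤ 4 * H / p * x) (hac : a ≤ 4 * H * c) (hxc : x ≤ p * c)
    (hyc : y⁻¹ ≤ c * Q * θ / r) (hθ : 0 ≤ θ) (hn : 0 ≤ n) (hS : 0 ≤ S)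
    (hpr : p / r ≤ Z / R) (hGr : G / r ≤ Z / R) (hSr : S / r ≤ Z / R) (hnp : n / p ≤ Z / Q) :
    Q * (a * κ * (1 + G / (y * Q))) + a * x⁻¹ * n + a * min x⁻¹ y⁻¹ * S ≤
      K ^ 2 * c ^ 3 * H * (4 * (Q ^ 2 * θ) + 8 * (Q * θ)) * (Z / R) +
        K ^ 2 * c ^ 3 * H * 4 * (Z / Q) := by
  have hKp : 0 < K := by linarith
  have hcp : 0 < c := by linarith
  have hZ0 : 0 ≤ Z / R := le_trans (by positivity) hpr
  have hZ1 : 0 ≤ Z / Q := le_trans (by positivity) hnp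
  have hK1 : K ≤ K ^ 2 := le_self_pow₀ hK (by norm_num)
  have hK2 : 1 ≤ K ^ 2 := one_le_pow₀ hK
  have hc2 : c ^ 2 ≤ c ^ 3 := pow_le_pow_right₀ hc (by norm_num)
  have hc3 : 1 ≤ c ^ 3 := one_le_pow₀ hc
  -- The term that determines the rate: κ ≤ Kx/y with x of order p and 1/y of order Qθ/r leaves Q²θ
  -- p/r, hence qθ/√r̄.
  have h1 : Q * a * κ ≤ 4 * (K ^ 2 * c ^ 3 * H) * (Q ^ 2 * θ) * (Z / R) := by
    calc Q * a * κ ≤ Q * (4 * H * c) * (K * (x / y)) := by gcongr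
      _ = Q * (4 * H * c) * (K * (x * y⁻¹)) := by rw [div_eq_mul_inv]
      _ ≤ Q * (4 * H * c) * (K * ((p * c) * (c * Q * θ / r))) := by gcongr
      _ = 4 * (K * c ^ 3 * H) * (Q ^ 2 * θ) * (p / r) := by ring
      _ ≤ _ := by gcongr
  have h2 : ∀ v, 0 ≤ v → v / r ≤ Z / R →
      a * y⁻¹ * v ≤ 4 * (K ^ 2 * c ^ 3 * H) * (Q * θ) * (Z / R) := by
    intro v hv hvr
    calc a * y⁻¹ * v ≤ (4 * H * c) * (c * Q * θ / r) * v := by gcongr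
      _ = 4 * (1 * c ^ 2 * H) * (Q * θ) * (v / r) := by ring
      _ ≤ _ := by gcongr
  have h3 : Q * (a * κ * (G / (y * Q))) ≤ 4 * (K ^ 2 * c ^ 3 * H) * (Q * θ) * (Z / R) := by
    refine le_trans ?_ (h2 G hG hGr)
    calc _ ≤ Q * (a * 1 * (G / (y * Q))) := by gcongr
      _ = _ := by field_simp
  have h4 : a * min x⁻¹ y⁻¹ * S ≤ 4 * (K ^ 2 * c ^ 3 * H) * (Q * θ) * (Z / R) := by
    refine le_trans ?_ (h2 S hS hSr)
    gcongr
    exact min_le_right _ _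
  -- The only term without a factor 1/R. It comes from N₀ and is the source of the 1/√q in the rate.
  have h5 : a * x⁻¹ * n ≤ 4 * (K ^ 2 * c ^ 3 * H) * (Z / Q) := by
    have hax : a * x⁻¹ ≤ 4 * H / p := by
      rw [← div_eq_mul_inv, div_le_iff₀ hx]; exact ha
    calc _ ≤ 4 * H / p * n := by gcongr
      _ = 4 * (1 * 1 * H) * (n / p) := by ring
      _ ≤ _ := by gcongr
  linarith

/-- Contributions of the relative change `a` of the group precision, for all energies. -/
theorem group_precision_terms_le (hK : 1 ≤ K) (hH : 0 ≤ H) (hQ : 0 < Q)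
    (hp : 0 < p) (hx : 0 < x) (hy : 0 < y) (hG : 0 ≤ G) (hc : 1 ≤ c)
    (hκ0 : 0 ≤ κ) (hκ1 : κ ≤ 1) (hκ : κ ≤ K * (y / x)) (ha0 : 0 ≤ a)
    (ha : a ≤ 4 * H / p * x) (hac : a ≤ 4 * H * c) (hn : 0 ≤ n) (hS : 0 ≤ S)
    (hGp : G / p ≤ Z) (hSp : S / p ≤ Z) (hnp : n / p ≤ Z / Q) :
    Q * (a * κ * (1 + G / (y * Q))) + a * x⁻¹ * n + a * min x⁻¹ y⁻¹ * S ≤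
      K ^ 2 * c ^ 3 * H * (4 * Q + 8 * Z + 4 * (Z / Q)) := by
  have hKp : 0 < K := by linarith
  have hcp : 0 < c := by linarith
  have hZ0 : 0 ≤ Z := le_trans (by positivity) hGp
  have hK1 : K ≤ K ^ 2 := le_self_pow₀ hK (by norm_num)
  have hK2 : 1 ≤ K ^ 2 := one_le_pow₀ hK
  have hc1 : c ≤ c ^ 3 := le_self_pow₀ hc (by norm_num)
  have hc3 : 1 ≤ c ^ 3 := one_le_pow₀ hc
  have hax : a * x⁻¹ ≤ 4 * H / p := by
    rw [← div_eq_mul_inv, div_le_iff₀ hx]; exact ha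
  have h1 : Q * a * κ ≤ 4 * (K ^ 2 * c ^ 3 * H) * Q := by
    calc Q * a * κ ≤ Q * (4 * H * c) * 1 := by gcongr
      _ = 4 * (1 * c * H) * Q := by ring
      _ ≤ _ := by gcongr
  -- Without control of V, 1/y may be arbitrarily large; the bound κ ≤ Ky/x removes it.
  have h2 : Q * (a * κ * (G / (y * Q))) ≤ 4 * (K ^ 2 * c ^ 3 * H) * Z := by
    calc _ ≤ Q * (a * (K * (y / x)) * (G / (y * Q))) := by gcongr
      _ = K * (a * x⁻¹) * G := by field_simp
      _ ≤ K * (4 * H / p) * G := by gcongr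
      _ = 4 * (K * 1 * H) * (G / p) := by ring
      _ ≤ _ := by gcongr
  have h3 : ∀ v Y, 0 ≤ v → v / p ≤ Y → a * x⁻¹ * v ≤ 4 * (K ^ 2 * c ^ 3 * H) * Y := by
    intro v Y hv hvr
    have : 0 ≤ Y := le_trans (by positivity) hvr
    calc _ ≤ 4 * H / p * v := by gcongr
      _ = 4 * (1 * 1 * H) * (v / p) := by ring
      _ ≤ _ := by gcongr
  have h4 : a * min x⁻¹ y⁻¹ * S ≤ 4 * (K ^ 2 * c ^ 3 * H) * Z := by
    refine le_trans ?_ (h3 S Z hS hSp)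
    gcongr
    exact min_le_left _ _
  have h5 := h3 n (Z / Q) hn hnp
  linarith

end ScalarBounds

/-! ### The pathwise derivative bounds for the random mapping. -/

namespace MixedData

variable {q : ℕ} {D : MixedData q} {K b₁ b₂ j1 j2 : ℝ}

/-- The sum of the normalized squared sizes of the noise variables. -/
noncomputable def noiseSize (D : MixedData q) (n00 : EuclideanSpace ℝ (Fin D.p))
    (n : Fin (q + 1) → ℝ) (j1 j2 : ℝ) : ℝ :=
  j1 / q + D.rbar * q / j2 + (‖n00‖ ^ 2 + ∑ i, n i ^ 2) / q + q / j1 + n 0 ^ 2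

/-- The constant in the pathwise derivative bounds. -/
noncomputable def derivConst (K b₁ b₂ : ℝ) : ℝ :=
  132 * K ^ 15 * (36 * (K ^ 2 * (3 * K + 1 / b₁ + b₂) ^ 3))

theorem Regular.one_le_rbar (hD : D.Regular K) : 1 ≤ D.rbar := by
  have hq := hD.q_cast_pos
  rw [rbar, le_div_iff₀ hq, one_mul]
  calc (q : ℝ) = ∑ _i : Fin q, (1 : ℝ) := by simp
    _ ≤ _ := Finset.sum_le_sum fun i _ => Nat.one_le_cast.2 (D.r_pos i)

set_option maxHeartbeats 1000000 in
/-- Pathwise derivative of the random mapping along a line, with its bounds. -/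
theorem exists_hasDerivAt_f (hD : D.Regular K) (hb₁ : 0 < b₁) (hb₂ : 0 < b₂) (hj1 : 0 < j1)
    (hj2 : 0 < j2) (n00 : EuclideanSpace ℝ (Fin D.p)) (n : Fin (q + 1) → ℝ) (η h : D.State)
    (s : ℝ) :
    ∃ F' : D.State, HasDerivAt (fun u : ℝ => D.f b₁ b₂ n00 n j1 j2 (η + u • h)) F' s ∧
      ‖F'‖ ≤ derivConst K b₁ b₂ * ‖h‖ * (√q * (1 + D.noiseSize n00 n j1 j2)) ∧
      ∀ θ, 1 ≤ θ → D.V (η + s • h) ≤ θ ^ 2 →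
        ‖F'‖ ≤ derivConst K b₁ b₂ * ‖h‖ *
          ((q * θ / √D.rbar + 1 / √q) * D.noiseSize n00 n j1 j2) := by
  have hK := hD.K_pos
  have hN := hD.N_pos
  have hq := hD.q_cast_pos
  have hr := hD.rbar_pos
  have hr1 := hD.one_le_rbar
  have hq1 : (1 : ℝ) ≤ q := Nat.one_le_cast.2 hD.q_pos
  obtain ⟨α, hα, hαn⟩ := exists_hasDerivAt_div_shiftedEnergy hb₁ (D.groupDev η) (D.groupDev h) j1 s
  obtain ⟨β, hβ, hβn⟩ := exists_hasDerivAt_div_shiftedEnergy hb₂ (fun o => D.Y o - D.fitted η o)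
    (fun o => -D.fitted h o) j2 s
  have hA := shiftedEnergy_pos hb₁ (D.groupDev η) (D.groupDev h)
  have hB := shiftedEnergy_pos hb₂ (fun o => D.Y o - D.fitted η o) (fun o => -D.fitted h o)
  have hc : PrecisionCurve (fun u => D.lam b₁ j1 (η + u • h)) (fun u => D.tau b₂ j2 (η + u • h))
      s α β := by
    simp only [lam_segment, tau_segment]
    exact ⟨fun u => div_pos hj1 (hA u).2, fun u => div_pos hj2 (hB u).2, hα, hβ⟩
  have hl := hc.lam_pos s
  have ht := hc.tau_pos s
  obtain ⟨κ, hκ0, hκ, hκ1, hκx, hκy⟩ := hD.exists_shr_mul_le hl ht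
  obtain ⟨F', hF, hFn⟩ := exists_hasDerivAt_next hD hc hκ hκ0 n00 n
  refine ⟨F', hF, ?_⟩
  set A := shiftedEnergy b₁ (D.groupDev η) (D.groupDev h) s with hAdef
  set B := shiftedEnergy b₂ (fun o => D.Y o - D.fitted η o) (fun o => -D.fitted h o) s with hBdef
  have hlA : D.lam b₁ j1 (η + s • h) = j1 / A := lam_segment _ _ _ _ _
  have htB : D.tau b₂ j2 (η + s • h) = j2 / B := tau_segment _ _ _ _ _
  have hA0 : 0 < A := (hA s).2
  have hB0 : 0 < B := (hB s).2
  simp only [drift] at hFn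
  set x := √(D.lam b₁ j1 (η + s • h)) with hx
  set y := √(D.rbar * D.tau b₂ j2 (η + s • h)) with hy
  have hx0 : 0 < x := Real.sqrt_pos.2 hl
  have hy0 : 0 < y := Real.sqrt_pos.2 (mul_pos hr ht)
  have hyQ : √(D.tau b₂ j2 (η + s • h)) * √(D.rbar * q) = y * √q := by
    rw [hy, Real.sqrt_mul hr.le, Real.sqrt_mul hr.le]; ring
  rw [hyQ] at hFn
  have hxA : x = √j1 / √A := by rw [hx, hlA, Real.sqrt_div hj1.le]
  have hyB : y = √D.rbar * (√j2 / √B) := by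
    rw [hy, htB, Real.sqrt_mul hr.le, Real.sqrt_div hj2.le]
  set G := vnorm (fun k => n00 k) with hG
  have hG0 : 0 ≤ G := vnorm_nonneg _
  set S := vnorm (fun i : Fin q => n i.succ) with hS
  have hS0 : 0 ≤ S := vnorm_nonneg _
  set Z := D.noiseSize n00 n j1 j2 with hZ
  have hZeq : Z = √j1 ^ 2 / √(q : ℝ) ^ 2 + √D.rbar ^ 2 * √(q : ℝ) ^ 2 / √j2 ^ 2 +
      (G ^ 2 + (|n 0| ^ 2 + S ^ 2)) / √(q : ℝ) ^ 2 + √(q : ℝ) ^ 2 / √j1 ^ 2 + |n 0| ^ 2 := by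
    rw [Real.sq_sqrt hj1.le, Real.sq_sqrt hj2.le, Real.sq_sqrt hq.le, Real.sq_sqrt hr.le, sq_abs,
      hZ, noiseSize, Fin.sum_univ_succ, show S ^ 2 = ∑ i : Fin q, n i.succ ^ 2 from vnorm_sq _]
    rfl
  have hQ0 : 0 < √(q : ℝ) := Real.sqrt_pos.2 hq
  have hR0 : 0 < √D.rbar := Real.sqrt_pos.2 hr
  have hQ1 : 1 ≤ √(q : ℝ) := Real.one_le_sqrt.2 hq1
  have hR1 : 1 ≤ √D.rbar := Real.one_le_sqrt.2 hr1
  have hp0 : 0 < √j1 := Real.sqrt_pos.2 hj1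
  have hrr0 : 0 < √j2 := Real.sqrt_pos.2 hj2
  obtain ⟨hZ0, ⟨z1, z2, z3, z4⟩, z5, z6, z7⟩ := noise_quotients_le hQ0 hR0 hp0 hrr0 hZeq
  -- Chosen, with K ≥ 1, to dominate both 1/√A ≤ 1/√b₁ ≤ 1 + 1/b₁ and the constant b₂ + (3/2)(1 + K)
  -- in the bound for B.
  set c := 3 * K + 1 / b₁ + b₂ with hcdef
  have hib : 0 < 1 / b₁ := by positivity
  have hK1 := hD.one_le
  have hc1 : 1 ≤ c := by rw [hcdef]; linarith
  have hcA : (√A)⁻¹ ≤ c := by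
    have h1 : (√A)⁻¹ ≤ (√b₁)⁻¹ := by
      have := Real.sqrt_le_sqrt (hA s).1
      have : 0 < √b₁ := Real.sqrt_pos.2 hb₁
      gcongr
    have h2 := inv_sqrt_le hb₁
    rw [hcdef]; linarith
  have hH := norm_nonneg h
  have hxc : x ≤ √j1 * c := by
    rw [hxA, div_eq_mul_inv]; gcongr
  have haA : |α| ≤ 4 * ‖h‖ * (√A)⁻¹ := by
    refine hαn.trans ?_
    rw [div_eq_mul_inv]
    calc _ ≤ 2 * (2 * ‖h‖) * (√A)⁻¹ := by
          gcongr
          exact vnorm_groupDev_le hD.q_pos h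
      _ = _ := by ring
  -- Two forms of one estimate: 1/√A is either bounded by c or written as x/√j1, the latter in order
  -- to cancel a factor 1/x.
  have hac : |α| ≤ 4 * ‖h‖ * c := haA.trans (by gcongr)
  have ha : |α| ≤ 4 * ‖h‖ / √j1 * x := by
    refine haA.trans (le_of_eq ?_)
    rw [hxA]; field_simp
  have hb : |β| ≤ 4 * K * ‖h‖ / √j2 * y := by
    refine hβn.trans ?_
    have h1 := hD.vnorm_fitted_le h
    have hsB : 0 < √B := Real.sqrt_pos.2 hB0
    calc _ ≤ 2 * (2 * K * √D.rbar * ‖h‖) / √B := by gcongr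
      _ = _ := by rw [hyB]; field_simp; ring
  have hres := residual_precision_terms_le hK1 hH hQ0 hp0 hrr0 hx0 hy0 hG0 hc1 hκ0 hκ1 hκx
    (abs_nonneg β) hb hxc (abs_nonneg (n 0)) hS0 z1 z2 z3 z4
  have hsplit : √q * (|α - β| * κ * (1 + G / (y * √q)) + |β| * (G / (y * √q))) +
      (|α| * x⁻¹ + |β| * y⁻¹) * |n 0| + (|β| * y⁻¹ + |α| * min x⁻¹ y⁻¹) * S ≤
      (√q * (|β| * κ * (1 + G / (y * √q)) + |β| * (G / (y * √q))) + |β| * y⁻¹ * |n 0| +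
        |β| * y⁻¹ * S) +
      (√q * (|α| * κ * (1 + G / (y * √q))) + |α| * x⁻¹ * |n 0| + |α| * min x⁻¹ y⁻¹ * S) := by
    have h1 : √q * (|α - β| * κ * (1 + G / (y * √q))) ≤
        √q * ((|α| + |β|) * κ * (1 + G / (y * √q))) := by
      gcongr
      exact abs_sub _ _
    linarith
  set L := K ^ 2 * c ^ 3 * ‖h‖ with hL
  have hL0 : 0 ≤ L := by positivity
  have hresL : K ^ 2 * c * ‖h‖ * (4 * √q + 16) * (Z / √D.rbar) ≤
      L * (20 * √q) * (Z / √D.rbar) := by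
    have hcc : c ≤ c ^ 3 := le_self_pow₀ hc1 (by norm_num)
    have : 0 ≤ Z / √D.rbar := by positivity
    rw [hL]
    gcongr
    linarith
  have hderiv : derivConst K b₁ b₂ * ‖h‖ = 132 * K ^ 15 * (36 * L) := by
    rw [derivConst, hL]; ring
  rw [hderiv]
  constructor
  · have hgrp := group_precision_terms_le hK1 hH hQ0 hp0 hx0 hy0 hG0 hc1 hκ0 hκ1 hκy
      (abs_nonneg α) ha hac (abs_nonneg (n 0)) hS0 z5 z6 z7
    have h1 : Z / √D.rbar ≤ Z := div_le_self hZ0 hR1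
    have h2 : Z / √q ≤ √q * Z := (div_le_self hZ0 hQ1).trans (le_mul_of_one_le_left hZ0 hQ1)
    have h3 : Z ≤ √q * Z := le_mul_of_one_le_left hZ0 hQ1
    have h4 : L * (20 * √q) * (Z / √D.rbar) ≤ L * (20 * √q) * Z := by gcongr
    have h5 : L * (4 * √q + 8 * Z + 4 * (Z / √q)) ≤
        L * (4 * √q + 8 * (√q * Z) + 4 * (√q * Z)) := by gcongr
    have h6 : 0 ≤ L * √q := by positivity
    have h7 : 0 ≤ L * (√q * Z) := by positivity
    calc ‖F'‖ ≤ _ := hFn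
      _ ≤ 132 * K ^ 15 * (36 * L * (√q * (1 + Z))) := by
          refine mul_le_mul_of_nonneg_left ?_ (by positivity)
          linarith
      _ = _ := by ring
  · intro θ hθ hV
    -- Because r̄q ≥ 1 and θ ≥ 1, the additive constants in the energy bound are absorbed into
    -- r̄qθ². This bounds τ from below.
    have hB1 : B ≤ (c * √D.rbar * √q * θ) ^ 2 := by
      have h1 := energy_le_V hD b₂ η h s
      rw [mul_pow, mul_pow, mul_pow, Real.sq_sqrt hr.le, Real.sq_sqrt hq.le]
      have hN1 : 1 ≤ D.rbar * q := one_le_mul_of_one_le_of_one_le hr1 hq1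
      have hθ2 : 1 ≤ θ ^ 2 := one_le_pow₀ hθ
      have hNθ : 1 ≤ D.rbar * q * θ ^ 2 := one_le_mul_of_one_le_of_one_le hN1 hθ2
      have hcc : c ≤ c ^ 2 := le_self_pow₀ hc1 (by norm_num)
      have h2 : D.rbar * q * (D.V (η + s • h) + K) ≤ D.rbar * q * (θ ^ 2 + K * θ ^ 2) := by
        have : K ≤ K * θ ^ 2 := le_mul_of_one_le_right hK.le hθ2
        gcongr
      calc B ≤ b₂ + 3 / 2 * (D.rbar * q * (θ ^ 2 + K * θ ^ 2)) := by linarith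
        _ ≤ b₂ * (D.rbar * q * θ ^ 2) + 3 / 2 * (1 + K) * (D.rbar * q * θ ^ 2) := by
            have := le_mul_of_one_le_right hb₂.le hNθ
            linarith
        _ = (b₂ + 3 / 2 * (1 + K)) * (D.rbar * q * θ ^ 2) := by ring
        _ ≤ c ^ 2 * (D.rbar * q * θ ^ 2) := by
            gcongr
            refine le_trans ?_ hcc
            rw [hcdef]; linarith
        _ = _ := by ring
    have hBs : √B ≤ c * √D.rbar * √q * θ := by
      rw [← Real.sqrt_sq (show 0 ≤ c * √D.rbar * √q * θ by positivity)]
      exact Real.sqrt_le_sqrt hB1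
    have hyc : y⁻¹ ≤ c * √q * θ / √j2 := by
      have hsB : 0 < √B := Real.sqrt_pos.2 hB0
      rw [hyB]
      calc (√D.rbar * (√j2 / √B))⁻¹ = √B / (√D.rbar * √j2) := by field_simp
        _ ≤ (c * √D.rbar * √q * θ) / (√D.rbar * √j2) := by gcongr
        _ = _ := by field_simp
    have hgrp := group_precision_terms_le_of_small hK1 hH hQ0 hp0 hrr0 hx0 hy0 hG0 hc1 hκ0 hκ1
      hκx (abs_nonneg α) ha hac hxc hyc (by linarith) (abs_nonneg (n 0)) hS0 z1 z2 z3 z7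
    have hqq : (q : ℝ) = √(q : ℝ) ^ 2 := (Real.sq_sqrt hq.le).symm
    have hW : 0 ≤ Z / √D.rbar := by positivity
    have h1 : √(q : ℝ) ≤ √(q : ℝ) ^ 2 * θ := by
      rw [sq, mul_assoc]
      exact le_mul_of_one_le_right hQ0.le (one_le_mul_of_one_le_of_one_le hQ1 hθ)
    have h2 : √(q : ℝ) * θ ≤ √(q : ℝ) ^ 2 * θ := by
      have : √(q : ℝ) ≤ √(q : ℝ) ^ 2 := le_self_pow₀ hQ1 (by norm_num)
      gcongr
    have h3 : L * (20 * √q) * (Z / √D.rbar) ≤ L * (20 * (√(q : ℝ) ^ 2 * θ)) * (Z / √D.rbar) := by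
      gcongr
    have h4 : L * (4 * (√(q : ℝ) ^ 2 * θ) + 8 * (√q * θ)) * (Z / √D.rbar) ≤
        L * (4 * (√(q : ℝ) ^ 2 * θ) + 8 * (√(q : ℝ) ^ 2 * θ)) * (Z / √D.rbar) := by gcongr
    have h5 : 0 ≤ L * (√(q : ℝ) ^ 2 * θ) * (Z / √D.rbar) := by positivity
    have h6 : 0 ≤ L * (Z / √q) := by positivity
    calc ‖F'‖ ≤ _ := hFn
      _ ≤ 132 * K ^ 15 * (36 * L * (√(q : ℝ) ^ 2 * θ) * (Z / √D.rbar) + 36 * L * (Z / √q)) := by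
          refine mul_le_mul_of_nonneg_left ?_ (by positivity)
          linarith
      _ = _ := by rw [← hqq]; ring

end MixedData

/-! ### Moments of the noise variables. -/

section NoiseMoments

variable {Ω : Type*} [MeasurableSpace Ω] {P : Measure Ω} {J : Ω → ℝ} {a : ℝ}

theorem integrable_and_integral_eq_of_lintegral {g : Ω → ℝ} {c : ℝ} (hg : AEMeasurable g P)
    (h0 : 0 ≤ᵐ[P] g) (hc : 0 ≤ c) (h : ∫⁻ ω, ENNReal.ofReal (g ω) ∂P = ENNReal.ofReal c) :
    Integrable g P ∧ ∫ ω, g ω ∂P = c := by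
  have hi : Integrable g P :=
    (lintegral_ofReal_ne_top_iff_integrable hg.aestronglyMeasurable h0).1 (by simp [h])
  exact ⟨hi, by rw [integral_eq_lintegral_of_nonneg_ae h0 hg.aestronglyMeasurable, h,
    ENNReal.toReal_ofReal hc]⟩

/-- Multiplication by x raises the shape parameter by one, so the mean follows from the
normalization of another gamma density. -/
theorem gammaPDF_mul_self (ha : 0 < a) (x : ℝ) :
    gammaPDF a 1 x * ENNReal.ofReal x = ENNReal.ofReal a * gammaPDF (a + 1) 1 x := by
  rcases lt_trichotomy x 0 with hx | rfl | hx
  · simp [gammaPDF_of_neg hx]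
  · rw [gammaPDF_of_nonneg le_rfl, gammaPDF_of_nonneg le_rfl]
    simp [Real.zero_rpow ha.ne']
  · rw [gammaPDF_of_nonneg hx.le, gammaPDF_of_nonneg hx.le, ← ENNReal.ofReal_mul' hx.le,
      ← ENNReal.ofReal_mul ha.le]
    congr 1
    rw [Real.Gamma_add_one ha.ne', add_sub_cancel_right, Real.rpow_sub_one hx.ne']
    have := Real.Gamma_pos_of_pos ha
    simp only [Real.one_rpow]
    field_simp

/-- The point 0 is excluded because the identity fails there for a = 2, by the convention 0⁰ = 1 for
real powers; the point is null for the integral. -/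
theorem gammaPDF_mul_inv (ha : 1 < a) {x : ℝ} (hx0 : x ≠ 0) :
    gammaPDF a 1 x * ENNReal.ofReal x⁻¹ =
      ENNReal.ofReal (a - 1)⁻¹ * gammaPDF (a - 1) 1 x := by
  have ha' : 0 < a - 1 := sub_pos.2 ha
  have hi : 0 ≤ (a - 1)⁻¹ := (inv_pos.2 ha').le
  rcases hx0.lt_or_gt with hx | hx
  · simp [gammaPDF_of_neg hx]
  · rw [gammaPDF_of_nonneg hx.le, gammaPDF_of_nonneg hx.le,
      ← ENNReal.ofReal_mul' (inv_pos.2 hx).le, ← ENNReal.ofReal_mul hi]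
    congr 1
    have h1 := Real.Gamma_add_one ha'.ne'
    rw [sub_add_cancel] at h1
    rw [h1, Real.rpow_sub_one hx.ne' (a - 1)]
    have := Real.Gamma_pos_of_pos ha'
    simp only [Real.one_rpow]
    field_simp

theorem measurable_gammaPDF (a r : ℝ) : Measurable (gammaPDF a r) :=
  (measurable_gammaPDFReal a r).ennreal_ofReal

theorem ae_pos_gammaMeasure (a : ℝ) : ∀ᵐ x ∂gammaMeasure a 1, 0 < x := by
  rw [gammaMeasure, ae_withDensity_iff (measurable_gammaPDF a 1)]
  filter_upwards [Measure.ae_ne volume (0 : ℝ)] with x hx h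
  by_contra h'
  exact h (gammaPDF_of_neg (lt_of_le_of_ne (not_lt.1 h') hx))

theorem lintegral_gammaMeasure {g : ℝ → ENNReal} (hg : Measurable g) :
    ∫⁻ x, g x ∂gammaMeasure a 1 = ∫⁻ x, gammaPDF a 1 x * g x := by
  rw [gammaMeasure, lintegral_withDensity_eq_lintegral_mul _ (measurable_gammaPDF a 1) hg]
  rfl

theorem gamma_ae_pos (hJ : HasLaw J (gammaMeasure a 1) P) : ∀ᵐ ω ∂P, 0 < J ω :=
  ae_of_ae_map hJ.aemeasurable (by rw [hJ.map_eq]; exact ae_pos_gammaMeasure a)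

theorem gamma_mean (hJ : HasLaw J (gammaMeasure a 1) P) (ha : 0 < a) :
    Integrable J P ∧ ∫ ω, J ω ∂P = a := by
  refine integrable_and_integral_eq_of_lintegral hJ.aemeasurable
    ((gamma_ae_pos hJ).mono fun _ h => h.le) ha.le ?_
  rw [hJ.lintegral_comp (f := fun x => ENNReal.ofReal x) (by fun_prop),
    lintegral_gammaMeasure (by fun_prop)]
  simp only [gammaPDF_mul_self ha]
  rw [lintegral_const_mul _ (measurable_gammaPDF _ _),
    lintegral_gammaPDF_eq_one (by linarith) one_pos, mul_one]

theorem gamma_mean_inv (hJ : HasLaw J (gammaMeasure a 1) P) (ha : 1 < a) :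
    Integrable (fun ω => (J ω)⁻¹) P ∧ ∫ ω, (J ω)⁻¹ ∂P = (a - 1)⁻¹ := by
  have ha' : 0 < a - 1 := sub_pos.2 ha
  refine integrable_and_integral_eq_of_lintegral hJ.aemeasurable.inv
    ((gamma_ae_pos hJ).mono fun _ h => (inv_pos.2 h).le) (inv_pos.2 ha').le ?_
  rw [hJ.lintegral_comp (f := fun x => ENNReal.ofReal x⁻¹) (by fun_prop),
    lintegral_gammaMeasure (by fun_prop)]
  have : (fun x => gammaPDF a 1 x * ENNReal.ofReal x⁻¹) =ᵐ[volume]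
      fun x => ENNReal.ofReal (a - 1)⁻¹ * gammaPDF (a - 1) 1 x := by
    filter_upwards [Measure.ae_ne volume (0 : ℝ)] with x hx using gammaPDF_mul_inv ha hx
  rw [lintegral_congr_ae this, lintegral_const_mul _ (measurable_gammaPDF _ _),
    lintegral_gammaPDF_eq_one ha' one_pos, mul_one]

theorem gaussian_mean_sq {X : Ω → ℝ} (hX : HasLaw X (gaussianReal 0 1) P) :
    Integrable (fun ω => X ω ^ 2) P ∧ ∫ ω, X ω ^ 2 ∂P = 1 := by
  have hm : MemLp X 2 P := by
    have := memLp_id_gaussianReal (μ := 0) (v := 1) 2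
    rw [← hX.map_eq] at this
    exact (memLp_map_measure_iff aestronglyMeasurable_id hX.aemeasurable).1 this
  refine ⟨hm.integrable_sq, ?_⟩
  have h0 : ∫ ω, X ω ∂P = 0 := by rw [hX.integral_eq, integral_id_gaussianReal]
  rw [← variance_of_integral_eq_zero hX.aemeasurable h0, hX.variance_eq, variance_id_gaussianReal]
  rfl

theorem stdGaussian_mean_norm_sq {p : ℕ} {X : Ω → EuclideanSpace ℝ (Fin p)}
    (hX : HasLaw X (stdGaussian (EuclideanSpace ℝ (Fin p))) P) :
    Integrable (fun ω => ‖X ω‖ ^ 2) P ∧ ∫ ω, ‖X ω‖ ^ 2 ∂P = p := by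
  have h : ∀ i, HasLaw (fun ω => X ω i) (gaussianReal 0 1) P := by
    intro i
    have := (measurePreserving_eval_multivariateGaussian (μ := (0 : EuclideanSpace ℝ (Fin p)))
      (S := 1) Matrix.PosSemidef.one (i := i)).hasLaw
    rw [multivariateGaussian_zero_one] at this
    simpa using this.fun_comp hX
  simp only [EuclideanSpace.norm_sq_eq, Real.norm_eq_abs, sq_abs]
  refine ⟨integrable_finsetSum _ fun i _ => (gaussian_mean_sq (h i)).1, ?_⟩
  rw [integral_finsetSum _ fun i _ => (gaussian_mean_sq (h i)).1]
  simp [fun i => (gaussian_mean_sq (h i)).2]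

end NoiseMoments

namespace MixedData

variable {q : ℕ} {D : MixedData q} {K a₁ a₂ : ℝ} {Ω : Type*} [MeasurableSpace Ω] {P : Measure Ω}
  {N00 : Ω → EuclideanSpace ℝ (Fin D.p)} {Nn : Fin (q + 1) → Ω → ℝ} {J1 J2 : Ω → ℝ}

theorem IsNoise.isProbabilityMeasure (h : D.IsNoise a₁ a₂ P N00 Nn J1 J2) :
    IsProbabilityMeasure P := (h.law_Nn 0).isProbabilityMeasure

theorem IsNoise.integral_noiseSize_le (h : D.IsNoise a₁ a₂ P N00 Nn J1 J2) (hD : D.Regular K)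
    (ha₁ : 0 < a₁) (ha₂ : 0 < a₂) (hq : 4 ≤ q) {c : ℝ} (hp : (D.p : ℝ) ≤ c * q) :
    Integrable (fun ω => D.noiseSize (N00 ω) (fun i => Nn i ω) (J1 ω) (J2 ω)) P ∧
      ∫ ω, D.noiseSize (N00 ω) (fun i => Nn i ω) (J1 ω) (J2 ω) ∂P ≤ a₁ + c + 12 := by
  have hq4 : (4 : ℝ) ≤ q := by exact_mod_cast hq
  have hq0 : (0 : ℝ) < q := by linarith
  have hNq : (D.N : ℝ) = D.rbar * q := by
    rw [N, rbar, Nat.cast_sum, div_mul_cancel₀ _ hq0.ne']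
  have hN4 : (4 : ℝ) ≤ D.N := by
    rw [hNq]
    nlinarith [hD.one_le_rbar]
  obtain ⟨i1, e1⟩ := gamma_mean h.law_J1 (by positivity)
  obtain ⟨i2, e2⟩ := gamma_mean_inv h.law_J1 (by linarith)
  obtain ⟨i3, e3⟩ := gamma_mean_inv h.law_J2 (by linarith)
  obtain ⟨i4, e4⟩ := stdGaussian_mean_norm_sq h.law_N00
  have i5 : Integrable (fun ω => ∑ i, Nn i ω ^ 2) P :=
    integrable_finsetSum _ fun i _ => (gaussian_mean_sq (h.law_Nn i)).1
  have e5 : ∫ ω, ∑ i, Nn i ω ^ 2 ∂P = q + 1 := by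
    rw [integral_finsetSum _ fun i _ => (gaussian_mean_sq (h.law_Nn i)).1]
    simp [fun i => (gaussian_mean_sq (h.law_Nn i)).2]
  obtain ⟨i6, e6⟩ := gaussian_mean_sq (h.law_Nn 0)
  simp only [noiseSize, div_eq_mul_inv]
  have j1 := i1.mul_const (q : ℝ)⁻¹
  have j2 := i3.const_mul (D.rbar * q)
  have j3 := (i4.fun_add i5).mul_const (q : ℝ)⁻¹
  have j4 := i2.const_mul (q : ℝ)
  have k1 := j1.fun_add j2
  have k2 := k1.fun_add j3
  have k3 := k2.fun_add j4
  refine ⟨k3.fun_add i6, ?_⟩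
  rw [integral_add k3 i6, integral_add k2 j4, integral_add k1 j3, integral_add j1 j2, integral_mul_const, integral_mul_const,
    integral_const_mul, integral_const_mul, integral_add i4 i5, e1, e2, e3, e4, e5, e6, ← hNq]
  -- The five expectations are at most 1 + a₁, 4, c + 2, 4 and 1, which add up to a₁ + c + 12. The
  -- condition q ≥ 4 makes both gamma shapes exceed 1, so the inverse moments exist, and keeps them
  -- below 4 after scaling.
  have b1 : (q / 2 + a₁) * (q : ℝ)⁻¹ ≤ 1 + a₁ := by
    rw [← div_eq_mul_inv, div_le_iff₀ hq0]
    nlinarith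
  have b2 : (D.N : ℝ) * (D.N / 2 + a₂ - 1)⁻¹ ≤ 4 := by
    rw [← div_eq_mul_inv, div_le_iff₀ (by linarith)]
    linarith
  have b3 : (q : ℝ) * (q / 2 + a₁ - 1)⁻¹ ≤ 4 := by
    rw [← div_eq_mul_inv, div_le_iff₀ (by linarith)]
    linarith
  have b4 : (D.p + (q + 1)) * (q : ℝ)⁻¹ ≤ c + 2 := by
    rw [← div_eq_mul_inv, div_le_iff₀ hq0]
    nlinarith
  linarith

end MixedData

/-! ### Measurability of the mapping and of its derivatives. -/

namespace MixedData

variable {q : ℕ} {D : MixedData q} {K a₁ a₂ b₁ b₂ l τ : ℝ}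

/-- The matrix Q and the normal equations depend only on λ/τ = exp u. Differentiability along this
curve makes them continuous in u, and composition with the random u = log(λ/τ) makes them
measurable. -/
theorem precisionCurve_exp (s : ℝ) : PrecisionCurve Real.exp (fun _ => 1) s 1 0 where
  lam_pos := Real.exp_pos
  tau_pos _ := one_pos
  deriv_lam := by simpa using Real.hasDerivAt_exp s
  deriv_tau := by simpa using hasDerivAt_const s (1 : ℝ)

theorem wt_eq_wt_exp (hl : 0 < l) (ht : 0 < τ) :
    D.wt l τ = D.wt (Real.exp (Real.log (l / τ))) 1 := by
  ext i
  have := t_pos (D := D) hl ht i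
  rw [Real.exp_log (div_pos hl ht), wt, wt, t, t]
  field_simp

theorem gram_eq_gram_exp (hq : 0 < q) (hl : 0 < l) (ht : 0 < τ) :
    D.gram l τ = D.gram (Real.exp (Real.log (l / τ))) 1 := by
  ext k m
  rw [gram_apply hq hl ht, gram_apply hq (Real.exp_pos _) one_pos, wt_eq_wt_exp hl ht]

theorem cross_eq_cross_exp (hq : 0 < q) (hl : 0 < l) (ht : 0 < τ) :
    D.cross l τ = D.cross (Real.exp (Real.log (l / τ))) 1 := by
  ext k
  rw [cross_apply hq hl ht, cross_apply hq (Real.exp_pos _) one_pos, wt_eq_wt_exp hl ht]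

theorem Q_eq_Q_exp (hq : 0 < q) (hl : 0 < l) (ht : 0 < τ) :
    D.Q l τ = D.Q (Real.exp (Real.log (l / τ))) 1 :=
  congrArg (fun G : Matrix (Fin D.p) (Fin D.p) ℝ => G⁻¹) (gram_eq_gram_exp hq hl ht)

namespace Regular

theorem continuous_Q_mulVec_cross_exp (hD : D.Regular K) (k : Fin D.p) :
    Continuous fun u => (D.Q (Real.exp u) 1 *ᵥ D.cross (Real.exp u) 1) k :=
  continuous_iff_continuousAt.2 fun s => by
    obtain ⟨κ, h0, h1, -⟩ := hD.exists_shr_mul_le (Real.exp_pos s) one_pos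
    obtain ⟨_, h, -⟩ := exists_hasDerivAt_Q_mulVec_cross hD (precisionCurve_exp s) h1 h0
    exact (h k).continuousAt

theorem continuous_sqrt_mulVec_exp (hD : D.Regular K) (x : Fin D.p → ℝ) (k : Fin D.p) :
    Continuous fun u => (psdSqrt (D.Q (Real.exp u) 1) *ᵥ x) k :=
  continuous_iff_continuousAt.2 fun s => by
    obtain ⟨κ, h0, h1, -⟩ := hD.exists_shr_mul_le (Real.exp_pos s) one_pos
    obtain ⟨_, h, -⟩ := exists_hasDerivAt_sqrt_mulVec hD (precisionCurve_exp s) h1 h0 x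
    exact (h k).continuousAt

end Regular

section Measurability

variable {Ω : Type*} [MeasurableSpace Ω] {P : Measure Ω} {L T : Ω → ℝ}

theorem aemeasurable_wt (hL : AEMeasurable L P) (hT : AEMeasurable T P) (i : Fin q) :
    AEMeasurable (fun ω => D.wt (L ω) (T ω) i) P := by
  unfold wt t
  fun_prop

theorem aemeasurable_shr (hL : AEMeasurable L P) (hT : AEMeasurable T P) (i : Fin q) :
    AEMeasurable (fun ω => D.shr (L ω) (T ω) i) P := by
  unfold shr t
  fun_prop

theorem aemeasurable_wmean {ι : Type*} [Fintype ι] {w a : Ω → ι → ℝ}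
    (hw : ∀ i, AEMeasurable (fun ω => w ω i) P) (ha : ∀ i, AEMeasurable (fun ω => a ω i) P) :
    AEMeasurable (fun ω => wmean (w ω) (a ω)) P := by
  unfold wmean
  exact (Finset.aemeasurable_fun_sum _ fun i _ => (hw i).mul (ha i)).div
    (Finset.aemeasurable_fun_sum _ fun i _ => hw i)

variable {x : Ω → Fin D.p → ℝ}

theorem Regular.aemeasurable_coef (hD : D.Regular K) (hL : AEMeasurable L P)
    (hT : AEMeasurable T P) (hpos : ∀ᵐ ω ∂P, 0 < L ω ∧ 0 < T ω)
    (hx : ∀ k, AEMeasurable (fun ω => x ω k) P) (k : Fin D.p) :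
    AEMeasurable (fun ω => D.coef (x ω) (L ω) (T ω) k) P := by
  have hlog : AEMeasurable (fun ω => Real.log (L ω / T ω)) P := by fun_prop
  have hb := (hD.continuous_Q_mulVec_cross_exp k).measurable.comp_aemeasurable hlog
  -- The continuity statement concerns a fixed vector, so the random vector is expanded in the
  -- standard basis.
  have hs : ∀ m, AEMeasurable (fun ω => (psdSqrt (D.Q (Real.exp (Real.log (L ω / T ω))) 1) *ᵥ
      Pi.single m 1) k) P := fun m =>
    (hD.continuous_sqrt_mulVec_exp (Pi.single m 1) k).measurable.comp_aemeasurable hlog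
  have hT' : AEMeasurable (fun ω => (√(T ω))⁻¹) P := hT.sqrt.inv
  refine (hb.add (hT'.mul (Finset.aemeasurable_fun_sum Finset.univ
    fun m _ => (hs m).mul (hx m)))).congr ?_
  filter_upwards [hpos] with ω ⟨hl, ht⟩
  simp only [coef, Pi.add_apply, Pi.mul_apply, Function.comp_apply, Pi.smul_apply, smul_eq_mul,
    Q_eq_Q_exp hD.q_pos hl ht, cross_eq_cross_exp hD.q_pos hl ht, Matrix.mulVec_single_one]
  rfl

theorem Regular.aemeasurable_res (hD : D.Regular K) (hL : AEMeasurable L P)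
    (hT : AEMeasurable T P) (hpos : ∀ᵐ ω ∂P, 0 < L ω ∧ 0 < T ω)
    (hx : ∀ k, AEMeasurable (fun ω => x ω k) P) (i : Fin q) :
    AEMeasurable (fun ω => D.res (x ω) (L ω) (T ω) i) P := by
  unfold res
  exact (Finset.aemeasurable_fun_sum Finset.univ fun k _ =>
    (hD.aemeasurable_coef hL hT hpos hx k).const_mul (D.xbarMat i k)).const_sub _

theorem Regular.aemeasurable_center (hD : D.Regular K) (hL : AEMeasurable L P)
    (hT : AEMeasurable T P) (hpos : ∀ᵐ ω ∂P, 0 < L ω ∧ 0 < T ω)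
    (hx : ∀ k, AEMeasurable (fun ω => x ω k) P) {n0 : Ω → ℝ} (hn : AEMeasurable n0 P) :
    AEMeasurable (fun ω => D.center (x ω) (n0 ω) (L ω) (T ω)) P := by
  unfold center
  have hw := aemeasurable_wt (D := D) hL hT
  exact (aemeasurable_wmean hw (hD.aemeasurable_res hL hT hpos hx)).add
    ((hT.mul (Finset.aemeasurable_fun_sum _ fun i _ => hw i)).sqrt.inv.mul hn)

theorem Regular.aemeasurable_next (hD : D.Regular K) (hL : AEMeasurable L P)
    (hT : AEMeasurable T P) (hpos : ∀ᵐ ω ∂P, 0 < L ω ∧ 0 < T ω)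
    {N00 : Ω → EuclideanSpace ℝ (Fin D.p)} (hN : AEMeasurable N00 P)
    {Nn : Fin (q + 1) → Ω → ℝ} (hn : ∀ i, AEMeasurable (Nn i) P) :
    AEMeasurable (fun ω => D.next (N00 ω) (fun i => Nn i ω) (L ω) (T ω)) P := by
  have hx : ∀ k, AEMeasurable (fun ω => N00 ω k) P := fun k => by fun_prop
  have hc := hD.aemeasurable_center hL hT hpos hx (hn 0)
  refine AEMeasurable.congr ?_ (hpos.mono fun ω h =>
    (next_eq hD.q_pos h.1 h.2 (N00 ω) (fun i => Nn i ω)).symm)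
  refine (WithLp.measurable_toLp 2 _).comp_aemeasurable (aemeasurable_pi_lambda _ ?_)
  rintro (k | i)
  · exact (hD.aemeasurable_coef hL hT hpos hx k).const_mul _
  · refine Fin.cases ?_ (fun i => ?_) i
    · exact hc.const_mul _
    · have hs := aemeasurable_shr (D := D) hL hT i
      have ht : AEMeasurable (fun ω => (√(D.t (L ω) (T ω) i))⁻¹) P := by
        unfold t
        exact ((hT.const_mul _).add hL).sqrt.inv
      exact (((hs.const_sub 1).mul hc).add (hs.mul (hD.aemeasurable_res hL hT hpos hx i))).add
        (ht.mul (hn i.succ))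

variable {N00 : Ω → EuclideanSpace ℝ (Fin D.p)} {Nn : Fin (q + 1) → Ω → ℝ} {J1 J2 : Ω → ℝ}

theorem IsNoise.ae_pos (h : D.IsNoise a₁ a₂ P N00 Nn J1 J2) :
    ∀ᵐ ω ∂P, 0 < J1 ω ∧ 0 < J2 ω :=
  (gamma_ae_pos h.law_J1).and (gamma_ae_pos h.law_J2)

theorem IsNoise.aemeasurable_f (h : D.IsNoise a₁ a₂ P N00 Nn J1 J2) (hD : D.Regular K)
    (hb₁ : 0 < b₁) (hb₂ : 0 < b₂) (η : D.State) :
    AEMeasurable (fun ω => D.f b₁ b₂ (N00 ω) (fun i => Nn i ω) (J1 ω) (J2 ω) η) P := by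
  refine hD.aemeasurable_next (h.law_J1.aemeasurable.div_const _)
    (h.law_J2.aemeasurable.div_const _) ?_ h.law_N00.aemeasurable fun i => (h.law_Nn i).aemeasurable
  filter_upwards [h.ae_pos] with ω ⟨h1, h2⟩
  constructor <;> positivity

theorem IsNoise.ae_differentiableAt (h : D.IsNoise a₁ a₂ P N00 Nn J1 J2) (hD : D.Regular K)
    (hb₁ : 0 < b₁) (hb₂ : 0 < b₂) : ∀ᵐ ω ∂P, ∀ (η d : D.State) (s : ℝ), DifferentiableAt ℝ
      (fun u : ℝ => D.f b₁ b₂ (N00 ω) (fun i => Nn i ω) (J1 ω) (J2 ω) (η + u • d)) s := by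
  filter_upwards [h.ae_pos] with ω ⟨h1, h2⟩ η d s
  obtain ⟨F', hF, -⟩ :=
    exists_hasDerivAt_f hD hb₁ hb₂ h1 h2 (N00 ω) (fun i => Nn i ω) η d s
  exact hF.differentiableAt

/-- The derivative is almost surely the limit of the difference quotients with steps 1/(n+1), each
of which is measurable in ω. -/
theorem IsNoise.aestronglyMeasurable_deriv (h : D.IsNoise a₁ a₂ P N00 Nn J1 J2)
    (hD : D.Regular K) (hb₁ : 0 < b₁) (hb₂ : 0 < b₂) (η d : D.State) (s : ℝ) :
    AEStronglyMeasurable (fun ω => deriv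
      (fun u : ℝ => D.f b₁ b₂ (N00 ω) (fun i => Nn i ω) (J1 ω) (J2 ω) (η + u • d)) s) P := by
  have hu : Tendsto (fun n : ℕ => 1 / ((n : ℝ) + 1)) atTop (𝓝[≠] 0) :=
    tendsto_nhdsWithin_iff.2 ⟨tendsto_one_div_add_atTop_nhds_zero_nat,
      Eventually.of_forall fun n => (Nat.one_div_pos_of_nat (α := ℝ)).ne'⟩
  refine aestronglyMeasurable_of_tendsto_ae atTop (f := fun (n : ℕ) ω => (1 / ((n : ℝ) + 1))⁻¹ •
    (D.f b₁ b₂ (N00 ω) (fun i => Nn i ω) (J1 ω) (J2 ω) (η + (s + 1 / ((n : ℝ) + 1)) • d) -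
      D.f b₁ b₂ (N00 ω) (fun i => Nn i ω) (J1 ω) (J2 ω) (η + s • d))) (fun n => ?_) ?_
  · exact AEStronglyMeasurable.const_smul ((h.aemeasurable_f hD hb₁ hb₂ _).aestronglyMeasurable.sub
      (h.aemeasurable_f hD hb₁ hb₂ _).aestronglyMeasurable) (1 / ((n : ℝ) + 1))⁻¹
  · filter_upwards [h.ae_differentiableAt hD hb₁ hb₂] with ω hω
    exact (hasDerivAt_iff_tendsto_slope_zero.1 (hω η d s).hasDerivAt).comp hu

end Measurability

end MixedData

/-! ### Expected size of the derivative, and regularity from the assumptions. -/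

namespace MixedData

variable {q : ℕ} {D : MixedData q} {K a₁ a₂ b₁ b₂ c m k₁ k₂ ℓ : ℝ}

section DerivativeMoments

variable {Ω : Type*} [MeasurableSpace Ω] {P : Measure Ω}
  {N00 : Ω → EuclideanSpace ℝ (Fin D.p)} {Nn : Fin (q + 1) → Ω → ℝ} {J1 J2 : Ω → ℝ}

theorem derivConst_nonneg (hK : 0 ≤ K) (hb₁ : 0 < b₁) (hb₂ : 0 < b₂) : 0 ≤ derivConst K b₁ b₂ := by
  unfold derivConst
  positivity

theorem IsNoise.integral_norm_deriv_le (h : D.IsNoise a₁ a₂ P N00 Nn J1 J2) (hD : D.Regular K)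
    (ha₁ : 0 < a₁) (ha₂ : 0 < a₂) (hb₁ : 0 < b₁) (hb₂ : 0 < b₂) (hq : 4 ≤ q)
    (hp : (D.p : ℝ) ≤ c * q) (η d : D.State) (s : ℝ) :
    let g := fun ω => ‖deriv
      (fun u : ℝ => D.f b₁ b₂ (N00 ω) (fun i => Nn i ω) (J1 ω) (J2 ω) (η + u • d)) s‖
    Integrable g P ∧
      ∫ ω, g ω ∂P ≤ derivConst K b₁ b₂ * ‖d‖ * (√q * (1 + (a₁ + c + 12))) ∧
      ∀ θ, 1 ≤ θ → D.V (η + s • d) ≤ θ ^ 2 → ∫ ω, g ω ∂P ≤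
        derivConst K b₁ b₂ * ‖d‖ * ((q * θ / √D.rbar + 1 / √q) * (a₁ + c + 12)) := by
  intro g
  have := h.isProbabilityMeasure
  have hC := mul_nonneg (derivConst_nonneg hD.K_pos.le hb₁ hb₂) (norm_nonneg d)
  obtain ⟨hZ, hZle⟩ := h.integral_noiseSize_le hD ha₁ ha₂ hq hp
  set Z := fun ω => D.noiseSize (N00 ω) (fun i => Nn i ω) (J1 ω) (J2 ω)
  have hb : ∀ᵐ ω ∂P, g ω ≤ derivConst K b₁ b₂ * ‖d‖ * (√q * (1 + Z ω)) ∧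
      ∀ θ, 1 ≤ θ → D.V (η + s • d) ≤ θ ^ 2 →
        g ω ≤ derivConst K b₁ b₂ * ‖d‖ * ((q * θ / √D.rbar + 1 / √q) * Z ω) := by
    filter_upwards [h.ae_pos] with ω ⟨h1, h2⟩
    obtain ⟨F', hF, hF'⟩ :=
      exists_hasDerivAt_f hD hb₁ hb₂ h1 h2 (N00 ω) (fun i => Nn i ω) η d s
    simp only [g, hF.deriv]
    exact hF'
  have hi1 : Integrable (fun ω => derivConst K b₁ b₂ * ‖d‖ * (√q * (1 + Z ω))) P :=
    (((integrable_const 1).fun_add hZ).const_mul _).const_mul _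
  have hg : Integrable g P :=
    hi1.mono' (h.aestronglyMeasurable_deriv hD hb₁ hb₂ η d s).norm
      (hb.mono fun ω hω => by simpa [g] using hω.1)
  refine ⟨hg, ?_, fun θ hθ hV => ?_⟩
  · refine (integral_mono_ae hg hi1 (hb.mono fun ω hω => hω.1)).trans ?_
    rw [integral_const_mul, integral_const_mul, integral_add (integrable_const 1) hZ]
    simp only [integral_const, probReal_univ, smul_eq_mul, mul_one]
    gcongr
  · refine (integral_mono_ae hg ((hZ.const_mul _).const_mul _)
      (hb.mono fun ω hω => hω.2 θ hθ hV)).trans ?_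
    rw [integral_const_mul, integral_const_mul]
    have : 0 ≤ θ := zero_le_one.trans hθ
    gcongr

end DerivativeMoments

theorem r_le_mul_r (hm : (D.rmax : ℝ) / D.rmin ≤ m) (i j : Fin q) :
    (D.r i : ℝ) ≤ m * D.r j := by
  -- The index i makes the family of group sizes nonempty, so the infimum in ℕ is attained and is
  -- not the default value 0.
  have hmin : 0 < D.rmin := by
    obtain ⟨k, hk⟩ : D.rmin ∈ Set.range D.r := Nat.sInf_mem ⟨D.r i, i, rfl⟩
    rw [← hk]
    exact D.r_pos k
  have hmin' : (0 : ℝ) < D.rmin := Nat.cast_pos.2 hmin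
  have h1 : (D.r i : ℝ) ≤ D.rmax := Nat.cast_le.2 (Finset.le_sup (Finset.mem_univ i))
  have h2 : (D.rmin : ℝ) ≤ D.r j := Nat.cast_le.2 (Nat.sInf_le ⟨j, rfl⟩)
  have h3 : 0 ≤ m := le_trans (by positivity) hm
  calc (D.r i : ℝ) ≤ D.rmax := h1
    _ ≤ m * D.rmin := (div_le_iff₀ hmin').1 hm
    _ ≤ m * D.r j := by gcongr

/-- Each required constant is one of the summands of the stated sum, all positive; 1/k₁ occurs since
`within_ge` has its constant on the opposite side from the eigenvalue bound. -/
theorem regular_of_bounds (hq : 0 < q) (hm0 : 0 < m) (hk₁ : 0 < k₁) (hk₂ : 0 < k₂) (hℓ : 0 < ℓ)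
    (hm : (D.rmax : ℝ) / D.rmin ≤ m)
    (hmin : k₁ ≤ lambdaMin ((1 / (D.rbar * q)) • (D.Xᵀ * D.X - D.Xbarᵀ * D.Xbar)))
    (hmax : lambdaMax ((1 / (D.rbar * q)) • (D.Xᵀ * D.X)) ≤ k₂)
    (hy : 1 / (D.rbar * q) * ∑ i, ∑ j, D.y i j ^ 2 ≤ ℓ) :
    D.Regular (1 + m + 1 / k₁ + k₂ + ℓ) := by
  have hq' : (0 : ℝ) < q := Nat.cast_pos.2 hq
  have : NeZero q := ⟨hq.ne'⟩
  have hik : 0 < 1 / k₁ := by positivity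
  have hrq : D.rbar * q = ∑ i, (D.r i : ℝ) := by rw [rbar, div_mul_cancel₀ _ hq'.ne']
  have hN : 0 < D.rbar * q := by
    rw [hrq]
    exact Finset.sum_pos (fun i _ => r_cast_pos i) Finset.univ_nonempty
  have hr : 0 < D.rbar := pos_of_mul_pos_left hN hq'.le
  have hX : (D.Xᵀ * D.X).IsHermitian := by
    simpa using Matrix.isHermitian_conjTranspose_mul_self D.X
  have hXb : (D.Xbarᵀ * D.Xbar).IsHermitian := by
    simpa using Matrix.isHermitian_conjTranspose_mul_self D.Xbar
  have hsmul : ∀ A : Matrix (Fin D.p) (Fin D.p) ℝ, A.IsHermitian →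
      ((1 / (D.rbar * q)) • A).IsHermitian := fun A hA => by
    rw [Matrix.IsHermitian, Matrix.conjTranspose_smul, hA.eq]
    simp
  refine ⟨by linarith, hq, fun i => ?_, fun i => ?_, fun x => ?_, fun x => ?_, ?_⟩
  · have h1 : (D.r i : ℝ) ≤ m * D.rbar := by
      refine le_of_mul_le_mul_right ?_ hq'
      rw [mul_assoc, hrq, Finset.mul_sum]
      calc (D.r i : ℝ) * q = ∑ _j : Fin q, (D.r i : ℝ) := by simp [mul_comm]
        _ ≤ _ := Finset.sum_le_sum fun j _ => r_le_mul_r hm i j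
    exact h1.trans (mul_le_mul_of_nonneg_right (by linarith) hr.le)
  · have h1 : D.rbar ≤ m * D.r i := by
      refine le_of_mul_le_mul_right ?_ hq'
      rw [hrq]
      calc ∑ j, (D.r j : ℝ) ≤ ∑ _j : Fin q, m * (D.r i : ℝ) :=
            Finset.sum_le_sum fun j _ => r_le_mul_r hm j i
        _ = _ := by simp [mul_comm]
    exact h1.trans (mul_le_mul_of_nonneg_right (by linarith) (r_cast_pos i).le)
  · have h1 := (hsmul _ (hX.sub hXb)).mul_dotProduct_le_of_le_lambdaMin hmin x
    rw [Matrix.smul_mulVec, dotProduct_smul, smul_eq_mul, div_mul_eq_mul_div, one_mul,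
      le_div_iff₀ hN] at h1
    have hxx : 0 ≤ x ⬝ᵥ x := by rw [← vnorm_sq']; positivity
    have h2 : 0 ≤ x ⬝ᵥ D.within *ᵥ x := le_trans (by positivity) h1
    calc D.rbar * q * (x ⬝ᵥ x) = 1 / k₁ * (k₁ * (x ⬝ᵥ x) * (D.rbar * q)) := by field_simp
      _ ≤ 1 / k₁ * (x ⬝ᵥ D.within *ᵥ x) := by gcongr; exact h1
      _ ≤ _ := mul_le_mul_of_nonneg_right (by linarith) h2
  · have h1 := (hsmul _ hX).dotProduct_le_of_lambdaMax_le hmax x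
    rw [Matrix.smul_mulVec, dotProduct_smul, smul_eq_mul, div_mul_eq_mul_div, one_mul,
      div_le_iff₀ hN] at h1
    have hxx : 0 ≤ x ⬝ᵥ x := by rw [← vnorm_sq']; positivity
    calc _ ≤ _ := h1
      _ = k₂ * (D.rbar * q * (x ⬝ᵥ x)) := by ring
      _ ≤ (1 + m + 1 / k₁ + k₂ + ℓ) * (D.rbar * q * (x ⬝ᵥ x)) :=
          mul_le_mul_of_nonneg_right (by linarith) (by positivity)
      _ = _ := by ring
  · rw [div_mul_eq_mul_div, one_mul, div_le_iff₀ hN] at hy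
    exact hy.trans (mul_le_mul_of_nonneg_right (by linarith) hN.le)

end MixedData

/-! ### Rates in q, and the main theorem. -/

theorem mul_rpow_div_sqrt_le {q R δ : ℝ} (hq : 1 ≤ q) (hδ : 0 ≤ δ) :
    q * q ^ (δ / 6) / √R ≤ √(q ^ (2 + δ) / R) := by
  have hq0 : 0 < q := one_pos.trans_le hq
  rw [Real.sqrt_div (by positivity)]
  refine div_le_div_of_nonneg_right ?_ (Real.sqrt_nonneg _)
  refine Real.le_sqrt_of_sq_le ?_
  -- The claim is q²·q^{δ/3} ≤ q^{2+δ}, with room to spare in the exponent.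
  rw [mul_pow, ← Real.rpow_natCast (q ^ (δ / 6)), ← Real.rpow_mul hq0.le, Real.rpow_add hq0,
    Real.rpow_two]
  gcongr
  push_cast
  linarith

theorem tendsto_max_sqrt_div {R : ℕ → ℝ} {δ : ℝ}
    (h : Tendsto (fun q : ℕ => R q / (q : ℝ) ^ (2 + δ)) atTop atTop) :
    Tendsto (fun q : ℕ => max √((q : ℝ) ^ (2 + δ) / R q) (1 / √(q : ℝ))) atTop (𝓝 0) := by
  have h1 : Tendsto (fun q : ℕ => √((q : ℝ) ^ (2 + δ) / R q)) atTop (𝓝 0) := by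
    have := (Real.continuous_sqrt.tendsto 0).comp h.inv_tendsto_atTop
    simpa [Function.comp_def, inv_div] using this
  have h2 : Tendsto (fun q : ℕ => 1 / √(q : ℝ)) atTop (𝓝 0) := by
    have := (Real.tendsto_sqrt_atTop.comp (tendsto_natCast_atTop_atTop (R := ℝ))).inv_tendsto_atTop
    simpa [Function.comp_def, Pi.inv_def] using this
  simpa using h1.max h2

theorem proposition4
    -- fixed hyperparameters and a sequence of data sets
    (a₁ a₂ b₁ b₂ : ℝ) (ha₁ : 0 < a₁) (ha₂ : 0 < a₂) (hb₁ : 0 < b₁) (hb₂ : 0 < b₂)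
    (D : (q : ℕ) → MixedData q)
    -- (B1)
    (hB1 : ∃ m : ℝ, 0 < m ∧ ∀ q : ℕ, 1 ≤ q → ((D q).rmax : ℝ) / (D q).rmin ≤ m)
    -- (B2)
    (hB2 : ∃ k₁ k₂ : ℝ, 0 < k₁ ∧ 0 < k₂ ∧ ∀ᶠ q : ℕ in atTop,
      k₁ ≤ lambdaMin ((1 / ((D q).rbar * q)) •
        ((D q).Xᵀ * (D q).X - (D q).Xbarᵀ * (D q).Xbar)) ∧
      lambdaMax ((1 / ((D q).rbar * q)) • ((D q).Xᵀ * (D q).X)) ≤ k₂)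
    -- (B3)
    (hB3 : ∃ ℓ : ℝ, 0 < ℓ ∧ ∀ q : ℕ, 1 ≤ q →
      1 / ((D q).rbar * q) * ∑ i, ∑ j, (D q).y i j ^ 2 ≤ ℓ)
    -- (B4)
    (hB4 : (fun q : ℕ => ((D q).p : ℝ)) =O[atTop] fun q : ℕ => (q : ℝ))
    -- (B5)
    (δ : ℝ) (hδ : 0 < δ)
    (hB5 : Tendsto (fun q : ℕ => (D q).rbar / (q : ℝ) ^ (2 + δ)) atTop atTop)
    -- the noise driving the random mapping
    (Ω : ℕ → Type*) [∀ q, MeasurableSpace (Ω q)] (P : (q : ℕ) → Measure (Ω q))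
    (N00 : (q : ℕ) → Ω q → EuclideanSpace ℝ (Fin (D q).p))
    (Nn : (q : ℕ) → Fin (q + 1) → Ω q → ℝ) (J1 J2 : (q : ℕ) → Ω q → ℝ)
    (hnoise : ∀ q : ℕ, 1 ≤ q → (D q).IsNoise a₁ a₂ (P q) (N00 q) (Nn q) (J1 q) (J2 q))
    -- the random mapping
    (f : (q : ℕ) → Ω q → (D q).State → (D q).State)
    (hf : ∀ q ω η, f q ω η =
      (D q).f b₁ b₂ (N00 q ω) (fun i => Nn q i ω) (J1 q ω) (J2 q ω) η) :
    ∃ γ γ₀ : ℕ → ℝ,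
      (∀ q, 0 ≤ γ q) ∧ (∀ q, 0 ≤ γ₀ q) ∧
      (γ =O[atTop] fun q : ℕ => max √((q : ℝ) ^ (2 + δ) / (D q).rbar) (1 / √(q : ℝ))) ∧
      Tendsto γ atTop (𝓝 0) ∧
      (γ₀ =O[atTop] fun q : ℕ => √(q : ℝ)) ∧
      ∃ q₀ : ℕ, 0 < q₀ ∧ ∀ q : ℕ, q₀ ≤ q →
        -- almost surely, the derivatives along segments exist
        (∀ᵐ ω ∂(P q), ∀ η η' : (D q).State, ∀ s ∈ Set.Icc (0 : ℝ) 1,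
          DifferentiableAt ℝ (fun u : ℝ => f q ω (η + u • (η' - η))) s) ∧
        ∀ η η' : (D q).State, ∀ s ∈ Set.Icc (0 : ℝ) 1,
          Integrable (fun ω => ‖deriv (fun u : ℝ => f q ω (η + u • (η' - η))) s‖) (P q) ∧
          ((D q).V η + (D q).V η' ≤ (q : ℝ) ^ (δ / 3) →
            ∫ ω, ‖deriv (fun u : ℝ => f q ω (η + u • (η' - η))) s‖ ∂(P q) ≤ γ q * ‖η' - η‖) ∧
          (¬ (D q).V η + (D q).V η' ≤ (q : ℝ) ^ (δ / 3) →
            ∫ ω, ‖deriv (fun u : ℝ => f q ω (η + u • (η' - η))) s‖ ∂(P q) ≤ γ₀ q * ‖η' - η‖) := by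
  obtain ⟨m, hm0, hm⟩ := hB1
  obtain ⟨k₁, k₂, hk₁, hk₂, hk⟩ := hB2
  obtain ⟨ℓ, hℓ0, hℓ⟩ := hB3
  obtain ⟨c, hc0, hc⟩ := hB4.exists_nonneg
  set K := 1 + m + 1 / k₁ + k₂ + ℓ
  have hC := MixedData.derivConst_nonneg (K := K) (by positivity) hb₁ hb₂
  set C := MixedData.derivConst K b₁ b₂
  set A := 1 + (a₁ + c + 12)
  have hA : 0 ≤ A := by positivity
  obtain ⟨q₀, hq₀⟩ := eventually_atTop.1 (hk.and hc.bound)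
  -- The factor 2 allows each of the two terms of the rate to be bounded by the maximum. The
  -- constant A serves both cases, as 1 + a bound for E Z in one and a bound for E Z in the other.
  -- The threshold 4 is that of the inverse gamma moments.
  refine ⟨fun q => 2 * C * A * max √((q : ℝ) ^ (2 + δ) / (D q).rbar) (1 / √(q : ℝ)),
    fun q => C * A * √(q : ℝ), fun q => by positivity, fun q => by positivity,
    (Asymptotics.isBigO_refl _ _).const_mul_left _,
    by simpa using (tendsto_max_sqrt_div hB5).const_mul (2 * C * A),
    (Asymptotics.isBigO_refl _ _).const_mul_left _, max q₀ 4, by positivity, fun q hq => ?_⟩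
  have hq4 : 4 ≤ q := (le_max_right _ _).trans hq
  have hq1 : 1 ≤ q := by lia
  obtain ⟨⟨hmin, hmax⟩, hp⟩ := hq₀ q ((le_max_left _ _).trans hq)
  have hD : (D q).Regular K :=
    MixedData.regular_of_bounds hq1 hm0 hk₁ hk₂ hℓ0 (hm q hq1) hmin hmax (hℓ q hq1)
  simp only [Real.norm_natCast] at hp
  have hn := hnoise q hq1
  simp only [hf]
  refine ⟨(hn.ae_differentiableAt hD hb₁ hb₂).mono fun ω hω η η' s _ => hω _ _ _,
    fun η η' s hs => ?_⟩
  obtain ⟨hi, hle, hsmall⟩ :=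
    hn.integral_norm_deriv_le hD ha₁ ha₂ hb₁ hb₂ hq4 hp η (η' - η) s
  refine ⟨hi, fun hV => ?_, fun _ => hle.trans (le_of_eq (by ring))⟩
  have hq1' : (1 : ℝ) ≤ q := by exact_mod_cast hq1
  -- The value θ = q^{δ/6} is chosen so that θ² = q^{δ/3}, the threshold for V.
  have hθ : (1 : ℝ) ≤ (q : ℝ) ^ (δ / 6) := Real.one_le_rpow hq1' (by positivity)
  refine (hsmall _ hθ ?_).trans ?_
  · rw [← Real.rpow_natCast, ← Real.rpow_mul (by positivity)]
    refine (MixedData.V_segment_le hD η η' hs).trans (hV.trans (le_of_eq ?_))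
    congr 1
    push_cast
    ring
  · set w := max √((q : ℝ) ^ (2 + δ) / (D q).rbar) (1 / √(q : ℝ))
    have h1 : q * (q : ℝ) ^ (δ / 6) / √(D q).rbar ≤ w :=
      (mul_rpow_div_sqrt_le hq1' hδ.le).trans (le_max_left _ _)
    have h2 : 1 / √(q : ℝ) ≤ w := le_max_right _ _
    have hw : 0 ≤ w := le_trans (by positivity) h2
    calc C * ‖η' - η‖ * ((q * (q : ℝ) ^ (δ / 6) / √(D q).rbar + 1 / √q) * (a₁ + c + 12))
        ≤ C * ‖η' - η‖ * ((w + w) * A) := by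
          have : a₁ + c + 12 ≤ A := by simp only [A]; linarith
          gcongr
      _ = 2 * C * A * w * ‖η' - η‖ := by ring
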